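/- Let $R>0$ be fixed. For integers $k,d\ge 1$ let $\mathcal G_{k,d}$ be the set of distributions $\Gamma=\sum_{j=1}^k w_j\delta_{\mu_j}$ on $\mathbb R^d$ with $\|\mu_j\|_2\le R$, $w_j\ge 0$ and $\sum_{j=1}^k w_j=1$, and for $\Gamma\in\mathcal G_{k,d}$ let $P_\Gamma=\Gamma*N(0,I_d)$ be the corresponding $k$-component Gaussian mixture. Let $H(P,Q)=\big(\int(\sqrt p-\sqrt q)^2\,d\mu\big)^{1/2}$ be the Hellinger distance, where $p,q$ are the densities of $P,Q$ with respect to a dominating measure $\mu$. Let $X_1,\dots,X_n$ ($n\ge1$) be i.i.d. observations from $P_\Gamma$. (i) For every $k\ge 1$ there are constants $c,C>0$, depending only on $k$ and $R$, such that for all $d,n\ge 1$ $$c\Big(\sqrt{\tfrac dn}\wedge 1\Big)\ \le\ \inf_{\hat P}\ \sup_{\Gamma\in\mathcal G_{k,d}}\mathbb E_\Gamma H(\hat P,P_\Gamma)\ \le\ C\Big(\sqrt{\tfrac dn}\wedge 1\Big),$$ where the infimum is over all estimators $\hat P=\hat P(X_1,\dots,X_n)$ with values in the probability distributions on $\mathbb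 R^d$. The same two bounds hold when the infimum is restricted to proper estimators, i.e. those of the form $\hat P=P_{\hat\Gamma}$ with $\hat\Gamma=\hat\Gamma(X_1,\dots,X_n)\in\mathcal G_{k,d}$. (ii) There is a constant $C>0$, depending only on $R$, such that for all $k,d,n\ge 1$ there is a proper estimator $P_{\hat\Gamma}$, $\hat\Gamma=\hat\Gamma(X_1,\dots,X_n)\in\mathcal G_{k,d}$, such that for every $\Gamma\in\mathcal G_{k,d}$ and every $0<\delta<\tfrac12$, with probability at least $1-\delta$, $$H(P_{\hat\Gamma},P_\Gamma)\ \le\ C\sqrt{\frac{k^4d+(2k)^{2k+2}}{n}\,\log\frac1\delta}.$$ -/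

import Mathlib

open MeasureTheory ProbabilityTheory
open scoped ENNReal

noncomputable section

namespace GaussianMixture

/-- The class of `k`-atomic mixing distributions `∑ j, w j • δ_{μ j}` on `ℝ^d` whose atoms lie in the
closed Euclidean ball of radius `R` around the origin. The atoms may coincide and the weights may
vanish. -/
def mixingClass (R : ℝ) (k d : ℕ) : Set (Measure (EuclideanSpace ℝ (Fin d))) :=
  {Γ | ∃ (w : Fin k → ℝ) (μ : Fin k → EuclideanSpace ℝ (Fin d)),
    (∀ j, ‖μ j‖ ≤ R) ∧ (∀ j, 0 ≤ w j) ∧ ∑ j, w j = 1 ∧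
    Γ = ∑ j, ENNReal.ofReal (w j) • Measure.dirac (μ j)}

/-- The Gaussian mixture `P_Γ = Γ * N(0, I_d)` with mixing distribution `Γ`. -/
def mixture {d : ℕ} (Γ : Measure (EuclideanSpace ℝ (Fin d))) :
    Measure (EuclideanSpace ℝ (Fin d)) :=
  Measure.conv Γ (stdGaussian (EuclideanSpace ℝ (Fin d)))

/-- The Hellinger distance `H(P, Q) = (∫ (√p - √q)² dμ)^{1/2}`, where `p` and `q` are the densities
of `P` and `Q` with respect to the dominating measure `μ = P + Q`. -/
def hellinger {Ω : Type*} [MeasurableSpace Ω] (P Q : Measure Ω) : ℝ :=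
  √(∫ x, (√((P.rnDeriv (P + Q) x).toReal) - √((Q.rnDeriv (P + Q) x).toReal)) ^ 2 ∂(P + Q))

/-- The law of an i.i.d. sample `X_1, …, X_n` from `P_Γ`. -/
def sampleLaw {d : ℕ} (n : ℕ) (Γ : Measure (EuclideanSpace ℝ (Fin d))) :
    Measure (Fin n → EuclideanSpace ℝ (Fin d)) :=
  Measure.pi fun _ => mixture Γ

/-- An estimate of the mixture from `n` observations: a measurable map from samples to probability
measures on `ℝ^d`, not required to be mixtures. -/
def IsEstimator {n d : ℕ}
    (Phat : (Fin n → EuclideanSpace ℝ (Fin d)) → Measure (EuclideanSpace ℝ (Fin d))) : Prop :=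
  Measurable Phat ∧ ∀ x, IsProbabilityMeasure (Phat x)

/-- An estimate of the mixing distribution: a measurable map from samples to the class of mixing
distributions. The associated proper density estimate is `x ↦ mixture (Γhat x)`. -/
def IsMixingEstimator (R : ℝ) (k : ℕ) {n d : ℕ}
    (Γhat : (Fin n → EuclideanSpace ℝ (Fin d)) → Measure (EuclideanSpace ℝ (Fin d))) : Prop :=
  Measurable Γhat ∧ ∀ x, Γhat x ∈ mixingClass R k d

/-- The Hellinger risk `E_Γ H(Phat, P_Γ)`. -/
def risk {n d : ℕ}
    (Phat : (Fin n → EuclideanSpace ℝ (Fin d)) → Measure (EuclideanSpace ℝ (Fin d)))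
    (Γ : Measure (EuclideanSpace ℝ (Fin d))) : ℝ≥0∞ :=
  ∫⁻ x, ENNReal.ofReal (hellinger (Phat x) (mixture Γ)) ∂(sampleLaw n Γ)

/-- The minimax Hellinger risk over all estimators. -/
def minimaxRisk (R : ℝ) (k d n : ℕ) : ℝ≥0∞ :=
  ⨅ (Phat : (Fin n → EuclideanSpace ℝ (Fin d)) → Measure (EuclideanSpace ℝ (Fin d)))
    (_ : IsEstimator Phat), ⨆ Γ ∈ mixingClass R k d, risk Phat Γ

/-- The minimax Hellinger risk over proper estimators. -/
def properMinimaxRisk (R : ℝ) (k d n : ℕ) : ℝ≥0∞ :=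
  ⨅ (Γhat : (Fin n → EuclideanSpace ℝ (Fin d)) → Measure (EuclideanSpace ℝ (Fin d)))
    (_ : IsMixingEstimator R k Γhat),
    ⨆ Γ ∈ mixingClass R k d, risk (fun x => mixture (Γhat x)) Γ

end GaussianMixture

end

noncomputable section

namespace GaussianMixture

/-! Two `k`-component mixtures are compared through the squared `L²(N(0,I))` distance of their
relative densities. The relative densities of `N(a,I)` and `N(b,I)` have inner product `exp ⟪a, b⟫`,
so this distance is the quadratic form `energy` of the signed measure `Γ - Γ'`. Expanding the
exponential gives `∑ l, ‖M_l‖² / l!` with `M_l` the moment tensors (`hasSum_energy`). The signed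
measure has at most `N = 2k` atoms, and multiplying it by a coordinate minus its value at one atom
removes that atom; by induction the moments of order below `N` control all moments with geometric
growth (`abs_sum_word_le`). The atoms span at most `N` dimensions, so no constant here depends on
`d`.

Two consequences carry the upper bound. First, exponential tilting by an atom multiplies the energy
by at most a constant (`energy_tilt_le`), so energy, squared Hellinger distance and chi-square
divergence are equivalent on the class (`sqDist_le_sqHell`, `sqHell_le_chiSq`, `chiSq_le`). Second,
within an energy ball of radius `r` a mixture is described up to `ε` by `N` vectors of the unit ball
and by moments of order below `N` rescaled by `r`; hence local packing numbers are at most `(J * r /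
ε) ^ D` with `D = N * d + N ^ N` (`card_packing_le`). Local rather than global counting is what
avoids a factor `log n`.

The estimator maximizes the likelihood over a maximal `ε`-separated set. A Chernoff bound with the
square root of the likelihood ratio (`measure_likelihood_le`) and a union bound over shells of the
net (`sum_exp_neg_sqDist_le`) give exponential tails. The comparison constants are exponential in
`k²`, but they enter only through their logarithms (`one_add_pow_le`); multiplying `D` by `k²` leads
to the effective dimension `k⁴d + (2k)^(2k+2)`. Integrating the tail bounds the risk.

The lower bound needs only single Gaussians: Assouad's argument on the vertices of a cube
(`le_iSup_risk`), after turning any density estimator into a vertex estimator by a minimum distance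
rule over finitely many test functions (`exists_vertex_estimator`). -/

open scoped RealInnerProductSpace

/-! ### Moments of finitely supported signed measures -/

/-- The moments of a discrete signed measure along coordinate words: if the words shorter than the
number of atoms have moments bounded by `A`, all words have controlled moments. -/
theorem abs_sum_word_le {ι κ : Type*} {R : ℝ} (hR : 0 ≤ R) (y : ι → κ → ℝ)
    (hy : ∀ i b, |y i b| ≤ R) (s : Finset ι) :
    ∀ (c : ι → ℝ) (A : ℝ), 0 ≤ A →
      (∀ β : List κ, β.length < s.card → |∑ i ∈ s, c i * (β.map (y i)).prod| ≤ A) →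
      ∀ α : List κ, |∑ i ∈ s, c i * (α.map (y i)).prod| ≤ (1 + 2 * R) ^ α.length * A := by
  classical
  induction s using Finset.induction_on with
  | empty =>
    intro c A hA _ α
    simp only [Finset.sum_empty, abs_zero]
    positivity
  | insert a s ha ih =>
    intro c A hA h α
    have hone : 1 ≤ 1 + 2 * R := by linarith
    induction α with
    | nil => simpa using h [] (by simp [Finset.card_insert_of_notMem ha])
    | cons b α ihα =>
      -- Write `y i b = (y i b - y a b) + y a b`. The weights `c i * (y i b - y a b)` vanish at `a`,
      -- so `ih` applies to them; their short moments use one extra letter and are at most `(1 + R)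
      -- * A`. The induction on the length closes because `(1 + R) + R = 1 + 2 * R`.
      have key : ∑ i ∈ insert a s, c i * ((b :: α).map (y i)).prod
          = ∑ i ∈ s, (c i * (y i b - y a b)) * (α.map (y i)).prod
            + y a b * ∑ i ∈ insert a s, c i * (α.map (y i)).prod := by
        rw [Finset.sum_insert ha, Finset.sum_insert ha, mul_add, Finset.mul_sum, add_left_comm,
          ← Finset.sum_add_distrib]
        congr 1
        · simp only [List.map_cons, List.prod_cons]; ring
        · refine Finset.sum_congr rfl fun i _ => ?_
          simp only [List.map_cons, List.prod_cons]; ring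
      have h1 : |∑ i ∈ s, (c i * (y i b - y a b)) * (α.map (y i)).prod|
          ≤ (1 + 2 * R) ^ α.length * ((1 + R) * A) := by
        refine ih _ _ (by positivity) (fun β hβ => ?_) α
        have e : ∑ i ∈ s, (c i * (y i b - y a b)) * (β.map (y i)).prod
            = ∑ i ∈ insert a s, c i * ((b :: β).map (y i)).prod
              - y a b * ∑ i ∈ insert a s, c i * (β.map (y i)).prod := by
          rw [Finset.sum_insert ha, Finset.sum_insert ha, mul_add, Finset.mul_sum]
          have : ∑ i ∈ s, (c i * (y i b - y a b)) * (β.map (y i)).prod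
              = ∑ i ∈ s, c i * ((b :: β).map (y i)).prod
                - ∑ i ∈ s, y a b * (c i * (β.map (y i)).prod) := by
            rw [← Finset.sum_sub_distrib]
            refine Finset.sum_congr rfl fun i _ => ?_
            simp only [List.map_cons, List.prod_cons]; ring
          rw [this]
          simp only [List.map_cons, List.prod_cons]; ring
        rw [e]
        have hc : (insert a s).card = s.card + 1 := Finset.card_insert_of_notMem ha
        have b1 := h (b :: β) (by simp [hc]; omega)
        have b2 := h β (by omega)
        calc _ ≤ |∑ i ∈ insert a s, c i * ((b :: β).map (y i)).prod|
              + |y a b * ∑ i ∈ insert a s, c i * (β.map (y i)).prod| := abs_sub _ _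
          _ ≤ A + R * A := by
              rw [abs_mul]
              gcongr
              exact hy a b
          _ = (1 + R) * A := by ring
      rw [key]
      calc _ ≤ |∑ i ∈ s, (c i * (y i b - y a b)) * (α.map (y i)).prod|
              + |y a b * ∑ i ∈ insert a s, c i * (α.map (y i)).prod| := abs_add_le _ _
        _ ≤ (1 + 2 * R) ^ α.length * ((1 + R) * A) + R * ((1 + 2 * R) ^ α.length * A) := by
            rw [abs_mul]
            gcongr
            exact hy a b
        _ = (1 + 2 * R) ^ (b :: α).length * A := by
            rw [List.length_cons, pow_succ]; ring

/-- The coordinate moment `∑ i, c i * ∏ j, y i (α j)` of a discrete signed measure. -/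
def wordMoment {ι κ : Type*} [Fintype ι] (c : ι → ℝ) (y : ι → κ → ℝ) {l : ℕ} (α : Fin l → κ) : ℝ :=
  ∑ i, c i * ∏ j, y i (α j)

theorem abs_wordMoment_le {ι κ : Type*} [Fintype ι] {R : ℝ} (hR : 0 ≤ R) {y : ι → κ → ℝ}
    (hy : ∀ i b, |y i b| ≤ R) {c : ι → ℝ} {A : ℝ} (hA : 0 ≤ A)
    (h : ∀ l < Fintype.card ι, ∀ α : Fin l → κ, |wordMoment c y α| ≤ A) {l : ℕ} (α : Fin l → κ) :
    |wordMoment c y α| ≤ (1 + 2 * R) ^ l * A := by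
  have e : ∀ {l : ℕ} (α : Fin l → κ),
      wordMoment c y α = ∑ i, c i * ((List.ofFn α).map (y i)).prod := by
    intro l α
    simp [wordMoment, List.map_ofFn, List.prod_ofFn]
  have := abs_sum_word_le hR y hy Finset.univ c A hA (fun β hβ => ?_) (List.ofFn α)
  · simpa [e] using this
  · have := h β.length (by simpa using hβ) β.get
    rw [e] at this
    simpa using this

/-! ### The exponential energy and its expansion in moments -/

/-- The exponential energy of a discrete signed measure given by weights `c` and inner products. -/
def energy {ι E : Type*} [Fintype ι] [NormedAddCommGroup E] [InnerProductSpace ℝ E]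
    (c : ι → ℝ) (x : ι → E) : ℝ :=
  ∑ i, ∑ j, c i * c j * Real.exp ⟪x i, x j⟫

theorem sum_wordMoment_sq {ι κ : Type*} [Fintype ι] [Fintype κ] (c : ι → ℝ) (y : ι → κ → ℝ)
    (l : ℕ) :
    ∑ α : Fin l → κ, wordMoment c y α ^ 2 = ∑ i, ∑ j, c i * c j * (∑ b, y i b * y j b) ^ l := by
  have e : ∀ i j, (∑ b, y i b * y j b) ^ l = ∑ α : Fin l → κ, ∏ p, (y i (α p) * y j (α p)) :=
    fun i j => by
      classical
      exact Fintype.sum_pow _ _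
  simp_rw [e, wordMoment, sq, Finset.sum_mul_sum, Finset.mul_sum, Finset.prod_mul_distrib]
  rw [Finset.sum_comm]
  refine Finset.sum_congr rfl fun i _ => ?_
  rw [Finset.sum_comm]
  refine Finset.sum_congr rfl fun j _ => Finset.sum_congr rfl fun α _ => ?_
  ring

/-- The power series of `exp` applied to each inner product: the order `l` part is the squared norm
of the `l`-th moment tensor. All terms are nonnegative, so the energy dominates each single moment
and is dominated once all moments are. -/
theorem hasSum_energy {ι κ E : Type*} [Fintype ι] [Fintype κ] [NormedAddCommGroup E]
    [InnerProductSpace ℝ E] (c : ι → ℝ) (x : ι → E) (y : ι → κ → ℝ)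
    (hxy : ∀ i j, ⟪x i, x j⟫ = ∑ b, y i b * y j b) :
    HasSum (fun l : ℕ => (∑ α : Fin l → κ, wordMoment c y α ^ 2) / (l.factorial : ℝ))
      (energy c x) := by
  simp_rw [sum_wordMoment_sq, ← hxy, Finset.sum_div]
  refine hasSum_sum fun i _ => hasSum_sum fun j _ => ?_
  simp_rw [mul_div_assoc]
  refine HasSum.mul_left _ ?_
  rw [Real.exp_eq_exp_ℝ]
  exact NormedSpace.expSeries_div_hasSum_exp _

theorem sq_wordMoment_le {ι κ E : Type*} [Fintype ι] [Fintype κ] [NormedAddCommGroup E]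
    [InnerProductSpace ℝ E] {c : ι → ℝ} {x : ι → E} {y : ι → κ → ℝ}
    (hxy : ∀ i j, ⟪x i, x j⟫ = ∑ b, y i b * y j b) {l : ℕ} (α : Fin l → κ) :
    wordMoment c y α ^ 2 ≤ l.factorial * energy c x := by
  have h := hasSum_energy c x y hxy
  have h1 : (∑ α : Fin l → κ, wordMoment c y α ^ 2) / (l.factorial : ℝ) ≤ energy c x :=
    le_hasSum h l fun j _ => by positivity
  rw [div_le_iff₀' (by positivity)] at h1
  refine le_trans ?_ h1
  exact Finset.single_le_sum (f := fun α : Fin l → κ => wordMoment c y α ^ 2)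
    (fun _ _ => sq_nonneg _) (Finset.mem_univ α)

theorem energy_le {ι κ E : Type*} [Fintype ι] [Fintype κ] [NormedAddCommGroup E]
    [InnerProductSpace ℝ E] {c : ι → ℝ} {x : ι → E} {y : ι → κ → ℝ}
    (hxy : ∀ i j, ⟪x i, x j⟫ = ∑ b, y i b * y j b) {Q B : ℝ}
    (h : ∀ (l : ℕ) (α : Fin l → κ), |wordMoment c y α| ≤ Q ^ l * B) :
    energy c x ≤ Real.exp (Fintype.card κ * Q ^ 2) * B ^ 2 := by
  have h1 := hasSum_energy c x y hxy
  have h2 : HasSum (fun l : ℕ => ((Fintype.card κ * Q ^ 2) ^ l / (l.factorial : ℝ)) * B ^ 2)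
      (Real.exp (Fintype.card κ * Q ^ 2) * B ^ 2) := by
    refine HasSum.mul_right _ ?_
    rw [Real.exp_eq_exp_ℝ]
    exact NormedSpace.expSeries_div_hasSum_exp _
  refine hasSum_le (fun l => ?_) h1 h2
  rw [div_mul_eq_mul_div]
  gcongr
  calc ∑ α : Fin l → κ, wordMoment c y α ^ 2 ≤ ∑ α : Fin l → κ, (Q ^ l * B) ^ 2 := by
        refine Finset.sum_le_sum fun α _ => ?_
        rw [← sq_abs]
        exact pow_le_pow_left₀ (abs_nonneg _) (h l α) 2
    _ = _ := by
        simp [Finset.card_univ]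
        ring

/-- Exponential tilting of a discrete signed measure keeps its word moments bounded. -/
theorem abs_wordMoment_tilt_le {ι κ : Type*} [Fintype ι] [Fintype κ] {R : ℝ} (hR : 0 ≤ R)
    {y : ι → κ → ℝ} {c : ι → ℝ} {A : ℝ}
    (h : ∀ (l : ℕ) (α : Fin l → κ), |wordMoment c y α| ≤ (1 + 2 * R) ^ l * A)
    {z : κ → ℝ} (hz : ∀ b, |z b| ≤ R) {l : ℕ} (α : Fin l → κ) :
    |wordMoment (fun i => c i * Real.exp (∑ b, y i b * z b)) y α|
      ≤ (1 + 2 * R) ^ l * (Real.exp (Fintype.card κ * (R * (1 + 2 * R))) * A) := by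
  classical
  -- The order `r` term of the tilting exponential lengthens the word `α` by all words of length
  -- `r`. There are `card κ ^ r` of them, each costing `(R * (1 + 2 * R)) ^ r`, and the factor `1 /
  -- r!` makes the sum an exponential.
  have h1 : HasSum (fun r : ℕ => (∑ γ : Fin r → κ, (∏ p, z (γ p)) *
      wordMoment c y (Fin.append α γ)) / (r.factorial : ℝ))
      (wordMoment (fun i => c i * Real.exp (∑ b, y i b * z b)) y α) := by
    have e : ∀ r : ℕ, (∑ γ : Fin r → κ, (∏ p, z (γ p)) * wordMoment c y (Fin.append α γ))
        = ∑ i, (c i * ∏ j, y i (α j)) * (∑ b, y i b * z b) ^ r := by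
      intro r
      simp_rw [Fintype.sum_pow, wordMoment, Finset.mul_sum]
      rw [Finset.sum_comm]
      refine Finset.sum_congr rfl fun i _ => Finset.sum_congr rfl fun γ _ => ?_
      rw [Fin.prod_univ_add]
      simp only [Fin.append_left, Fin.append_right, Finset.prod_mul_distrib]
      ring
    simp_rw [e, Finset.sum_div, wordMoment]
    refine hasSum_sum fun i _ => ?_
    have : HasSum (fun r : ℕ => (c i * ∏ j, y i (α j)) *
        ((∑ b, y i b * z b) ^ r / (r.factorial : ℝ)))
        ((c i * ∏ j, y i (α j)) * Real.exp (∑ b, y i b * z b)) := by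
      refine HasSum.mul_left _ ?_
      rw [Real.exp_eq_exp_ℝ]
      exact NormedSpace.expSeries_div_hasSum_exp _
    convert this using 1
    · ext r; ring
    · ring
  have h2 : HasSum (fun r : ℕ => (1 + 2 * R) ^ l *
      (((Fintype.card κ * (R * (1 + 2 * R))) ^ r / (r.factorial : ℝ)) * A))
      ((1 + 2 * R) ^ l * (Real.exp (Fintype.card κ * (R * (1 + 2 * R))) * A)) := by
    refine HasSum.mul_left _ (HasSum.mul_right _ ?_)
    rw [Real.exp_eq_exp_ℝ]
    exact NormedSpace.expSeries_div_hasSum_exp _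
  rw [← h1.tsum_eq, ← Real.norm_eq_abs]
  refine tsum_of_norm_bounded h2 fun r => ?_
  rw [Real.norm_eq_abs, abs_div, abs_of_pos (a := (r.factorial : ℝ)) (by positivity)]
  have : |∑ γ : Fin r → κ, (∏ p, z (γ p)) * wordMoment c y (Fin.append α γ)|
      ≤ ∑ γ : Fin r → κ, R ^ r * ((1 + 2 * R) ^ (l + r) * A) := by
    refine (Finset.abs_sum_le_sum_abs _ _).trans (Finset.sum_le_sum fun γ _ => ?_)
    rw [abs_mul, Finset.abs_prod]
    refine mul_le_mul ?_ (h _ _) (abs_nonneg _) (by positivity)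
    calc ∏ p, |z (γ p)| ≤ ∏ _p : Fin r, R :=
          Finset.prod_le_prod (fun _ _ => abs_nonneg _) fun p _ => hz _
      _ = R ^ r := by simp
  calc _ ≤ (∑ γ : Fin r → κ, R ^ r * ((1 + 2 * R) ^ (l + r) * A)) / (r.factorial : ℝ) := by gcongr
    _ = _ := by
      simp only [Finset.sum_const, Finset.card_univ, Fintype.card_fun, Fintype.card_fin,
        nsmul_eq_mul, Nat.cast_pow]
      rw [mul_pow, mul_pow, pow_add]
      ring

/-! ### Frames, tilting, and local packing numbers -/

section Packing

variable {E : Type*} [NormedAddCommGroup E] [InnerProductSpace ℝ E]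

/-- Finitely many vectors are reproduced by a family of as many vectors of norm at most one. -/
theorem exists_frame {ι : Type*} [Fintype ι] (x : ι → E) {N : ℕ} (hN : Fintype.card ι ≤ N) :
    ∃ v : Fin N → E, (∀ b, ‖v b‖ ≤ 1) ∧ ∀ i, x i = ∑ b, ⟪v b, x i⟫ • v b := by
  classical
  let S := Submodule.span ℝ (Set.range x)
  have hfin : FiniteDimensional ℝ S := FiniteDimensional.span_of_finite ℝ (Set.finite_range x)
  have hle : Module.finrank ℝ S ≤ N := (finrank_range_le_card x).trans hN
  let b := stdOrthonormalBasis ℝ S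
  -- An orthonormal basis of the span, padded with zeros so that the index type does not depend on
  -- the rank.
  let v : Fin N → E := fun a =>
    if h : (a : ℕ) < Module.finrank ℝ S then (b ⟨a, h⟩ : E) else 0
  refine ⟨v, fun a => ?_, fun i => ?_⟩
  · by_cases h : (a : ℕ) < Module.finrank ℝ S
    · simp only [v, h, dif_pos]
      exact (b.norm_eq_one ⟨a, h⟩).le
    · simp [v, h]
  · have hx : x i ∈ S := Submodule.subset_span (Set.mem_range_self i)
    have h1 := b.sum_repr' ⟨x i, hx⟩
    have h2 := congrArg (Subtype.val) h1
    rw [Submodule.coe_sum] at h2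
    rw [← Fintype.sum_of_injective (Fin.castLE hle) (Fin.castLE_injective hle)
      (fun a => (⟪b a, (⟨x i, hx⟩ : S)⟫ • b a : S).val)]
    · exact h2.symm
    · intro a ha
      have : ¬ (a : ℕ) < Module.finrank ℝ S := fun h => ha ⟨⟨a, h⟩, by ext; simp⟩
      simp [v, this]
    · intro a
      simp [v]

theorem inner_eq_sum_of_frame {κ : Type*} [Fintype κ] {v : κ → E} {x : E}
    (hx : x = ∑ b, ⟪v b, x⟫ • v b) (u : E) : ⟪u, x⟫ = ∑ b, ⟪v b, x⟫ * ⟪u, v b⟫ := by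
  conv_lhs => rw [hx]
  simp [inner_sum, inner_smul_right]

theorem inner_eq_sum_mul_of_frame {κ : Type*} [Fintype κ] {v : κ → E} {x : E}
    (hx : x = ∑ b, ⟪v b, x⟫ • v b) (u : E) : ⟪u, x⟫ = ∑ b, ⟪v b, u⟫ * ⟪v b, x⟫ := by
  rw [inner_eq_sum_of_frame hx]
  exact Finset.sum_congr rfl fun b _ => by rw [real_inner_comm u, mul_comm]

theorem energy_nonneg {ι : Type*} [Fintype ι] (c : ι → ℝ) (x : ι → E) : 0 ≤ energy c x := by
  obtain ⟨v, -, hv⟩ := exists_frame x le_rfl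
  exact (hasSum_energy c x (fun i b => ⟪v b, x i⟫)
    fun i j => inner_eq_sum_mul_of_frame (hv j) _).nonneg fun l => by positivity

/-- The constant by which tilting can increase the energy of `N` atoms. -/
def tiltConst (R : ℝ) (N : ℕ) : ℝ :=
  Real.exp (N * (1 + 2 * R) ^ 2 + 2 * (N * (R * (1 + 2 * R)))) * N.factorial

theorem abs_wordMoment_le_sqrt {ι κ : Type*} [Fintype ι] [Fintype κ] {c : ι → ℝ} {x : ι → E}
    {y : ι → κ → ℝ} (hxy : ∀ i j, ⟪x i, x j⟫ = ∑ b, y i b * y j b) {N l : ℕ} (hl : l ≤ N)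
    (α : Fin l → κ) : |wordMoment c y α| ≤ √(N.factorial * energy c x) := by
  refine Real.abs_le_sqrt ((sq_wordMoment_le hxy α).trans ?_)
  have := energy_nonneg c x
  gcongr

theorem abs_inner_frame_le {R : ℝ} {v x : E} (hv : ‖v‖ ≤ 1) (hx : ‖x‖ ≤ R) : |⟪v, x⟫| ≤ R :=
  (abs_real_inner_le_norm v x).trans
    ((mul_le_mul hv hx (norm_nonneg _) zero_le_one).trans (one_mul R).le)

/-- The energy bounds the short moments, the short moments bound all moments, tilting preserves such
bounds, and bounds on all moments bound the tilted energy. Tilting towards an atom keeps everything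
in the span of the atoms, so the constant depends on their number and not on the dimension of `E`.
-/
theorem energy_tilt_le {ι : Type*} [Fintype ι] {R : ℝ} (hR : 0 ≤ R) (c : ι → ℝ) {x : ι → E}
    (hx : ∀ i, ‖x i‖ ≤ R) (i₀ : ι) {s : ℝ} (hs : |s| ≤ 1) :
    energy (fun i => c i * Real.exp (s * ⟪x i, x i₀⟫)) x
      ≤ tiltConst R (Fintype.card ι) * energy c x := by
  obtain ⟨N, hN⟩ : ∃ N, N = Fintype.card ι := ⟨_, rfl⟩
  rw [← hN]
  obtain ⟨v, hv1, hv⟩ := exists_frame x hN.ge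
  set y : ι → Fin N → ℝ := fun i b => ⟪v b, x i⟫
  have hxy : ∀ i j, ⟪x i, x j⟫ = ∑ b, y i b * y j b :=
    fun i j => inner_eq_sum_mul_of_frame (hv j) _
  have hy : ∀ i b, |y i b| ≤ R := fun i b => abs_inner_frame_le (hv1 b) (hx i)
  have h0 := energy_nonneg c x
  have h1 : ∀ (l : ℕ) (α : Fin l → Fin N),
      |wordMoment c y α| ≤ (1 + 2 * R) ^ l * √(N.factorial * energy c x) := fun l α =>
    abs_wordMoment_le hR hy (Real.sqrt_nonneg _)
      (fun l hl α => abs_wordMoment_le_sqrt hxy (hl.le.trans hN.ge) α) α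
  have h2 : ∀ (l : ℕ) (α : Fin l → Fin N),
      |wordMoment (fun i => c i * Real.exp (s * ⟪x i, x i₀⟫)) y α|
        ≤ (1 + 2 * R) ^ l * (Real.exp (N * (R * (1 + 2 * R))) * √(N.factorial * energy c x)) := by
    intro l α
    have hz : ∀ b, |s * y i₀ b| ≤ R := fun b => by
      rw [abs_mul]
      exact (mul_le_mul hs (hy i₀ b) (abs_nonneg _) zero_le_one).trans (one_mul R).le
    have := abs_wordMoment_tilt_le hR h1 hz α
    rw [Fintype.card_fin] at this
    convert this using 5 with i
    congr 1
    rw [hxy, Finset.mul_sum]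
    exact Finset.sum_congr rfl fun b _ => by ring
  refine (energy_le hxy h2).trans_eq ?_
  rw [Fintype.card_fin, mul_pow, Real.sq_sqrt (by positivity), tiltConst, Real.exp_add,
    ← Real.exp_nat_mul, Nat.cast_ofNat]
  ring

/-- Products of numbers of modulus at most one depend on their factors in a Lipschitz way. -/
theorem abs_prod_sub_prod_le {l : ℕ} {a b : Fin l → ℝ} {η : ℝ} (ha : ∀ p, |a p| ≤ 1)
    (hb : ∀ p, |b p| ≤ 1) (h : ∀ p, |a p - b p| ≤ η) : |∏ p, a p - ∏ p, b p| ≤ l * η := by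
  induction l with
  | zero => simp
  | succ l ih =>
    rw [Fin.prod_univ_succ, Fin.prod_univ_succ]
    have h1 := ih (a := fun p => a p.succ) (b := fun p => b p.succ) (fun p => ha _) (fun p => hb _)
      fun p => h _
    have h2 : |∏ p : Fin l, a p.succ| ≤ 1 := by
      rw [Finset.abs_prod]
      exact Finset.prod_le_one (fun _ _ => abs_nonneg _) fun p _ => ha _
    calc |a 0 * ∏ p : Fin l, a p.succ - b 0 * ∏ p : Fin l, b p.succ|
        = |(a 0 - b 0) * ∏ p : Fin l, a p.succ
            + b 0 * (∏ p : Fin l, a p.succ - ∏ p : Fin l, b p.succ)| := by ring_nf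
      _ ≤ |a 0 - b 0| * |∏ p : Fin l, a p.succ|
            + |b 0| * |∏ p : Fin l, a p.succ - ∏ p : Fin l, b p.succ| := by
          refine (abs_add_le _ _).trans_eq ?_
          rw [abs_mul, abs_mul]
      _ ≤ η * 1 + 1 * (l * η) := by
          have hη : 0 ≤ η := (abs_nonneg _).trans (h 0)
          gcongr
          · exact h 0
          · exact hb 0
      _ = _ := by push_cast; ring

/-- Separated finite subsets of the unit ball of a finite-dimensional space. -/
theorem card_le_of_separated {F : Type*} [NormedAddCommGroup F] [NormedSpace ℝ F]
    [FiniteDimensional ℝ F] {η : ℝ} (hη : 0 < η) (s : Finset F) (hs : ∀ c ∈ s, ‖c‖ ≤ 1)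
    (h : ∀ c ∈ s, ∀ d ∈ s, c ≠ d → η ≤ ‖c - d‖) :
    (s.card : ℝ) ≤ (1 + 2 / η) ^ Module.finrank ℝ F := by
  borelize F
  let μ : Measure F := Measure.addHaar
  have hδ : 0 < η / 2 := by positivity
  have hρ : 0 < 1 + η / 2 := by positivity
  set A := ⋃ c ∈ s, Metric.ball (c : F) (η / 2) with hA
  have D : Set.Pairwise (s : Set F) (Function.onFun Disjoint fun c => Metric.ball c (η / 2)) := by
    rintro c hc d hd hcd
    apply Metric.ball_disjoint_ball
    rw [dist_eq_norm]
    linarith [h c hc d hd hcd]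
  have A_subset : A ⊆ Metric.ball (0 : F) (1 + η / 2) := by
    refine Set.iUnion₂_subset fun x hx => ?_
    apply Metric.ball_subset_ball'
    rw [dist_zero_right]
    linarith [hs x hx]
  have I : (s.card : ℝ≥0∞) * ENNReal.ofReal ((η / 2) ^ Module.finrank ℝ F) * μ (Metric.ball 0 1) ≤
      ENNReal.ofReal ((1 + η / 2) ^ Module.finrank ℝ F) * μ (Metric.ball 0 1) :=
    calc
      _ = μ A := by
        rw [hA, measure_biUnion_finset D fun c _ => measurableSet_ball]
        simp only [μ.addHaar_ball_of_pos _ hδ]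
        simp only [Finset.sum_const, nsmul_eq_mul, mul_assoc]
      _ ≤ μ (Metric.ball (0 : F) (1 + η / 2)) := measure_mono A_subset
      _ = _ := by simp only [μ.addHaar_ball_of_pos _ hρ]
  have J : (s.card : ℝ≥0∞) * ENNReal.ofReal ((η / 2) ^ Module.finrank ℝ F) ≤
      ENNReal.ofReal ((1 + η / 2) ^ Module.finrank ℝ F) :=
    (ENNReal.mul_le_mul_iff_left (Metric.measure_ball_pos _ _ zero_lt_one).ne'
      measure_ball_lt_top.ne).1 I
  have K := ENNReal.toReal_le_of_le_ofReal (pow_nonneg hρ.le _) J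
  rw [ENNReal.toReal_mul, ENNReal.toReal_natCast, ENNReal.toReal_ofReal (by positivity),
    ← le_div_iff₀ (by positivity), ← div_pow] at K
  refine K.trans_eq ?_
  congr 1
  field_simp
  ring

/-- Weights and atoms of a `k`-atomic measure. -/
abbrev Atoms (k : ℕ) (E : Type*) := (Fin k → ℝ) × (Fin k → E)

/-- Weights of the difference of two `k`-atomic measures. -/
def diffWeight {k : ℕ} (γ γ' : Atoms k E) : Fin k ⊕ Fin k → ℝ := Sum.elim γ.1 (-γ'.1)

/-- Atoms of the difference of two `k`-atomic measures. -/
def diffAtom {k : ℕ} (γ γ' : Atoms k E) : Fin k ⊕ Fin k → E := Sum.elim γ.2 γ'.2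

/-- The squared distance of two `k`-atomic measures in the exponential energy. -/
def sqDist {k : ℕ} (γ γ' : Atoms k E) : ℝ := energy (diffWeight γ γ') (diffAtom γ γ')

theorem sqDist_nonneg {k : ℕ} (γ γ' : Atoms k E) : 0 ≤ sqDist γ γ' := energy_nonneg _ _

theorem norm_diffAtom_le {F : Type*} [NormedAddCommGroup F] {k : ℕ} {R : ℝ} {γ γ' : Atoms k F} (h : ∀ j, ‖γ.2 j‖ ≤ R)
    (h' : ∀ j, ‖γ'.2 j‖ ≤ R) (i : Fin k ⊕ Fin k) : ‖diffAtom γ γ' i‖ ≤ R := by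
  rcases i with i | i
  · exact h i
  · exact h' i

theorem sum_diffWeight {F : Type*} {k : ℕ} (γ γ' : Atoms k F) (f : F → ℝ) :
    ∑ i, diffWeight γ γ' i * f (diffAtom γ γ' i)
      = ∑ j, γ.1 j * f (γ.2 j) - ∑ j, γ'.1 j * f (γ'.2 j) := by
  simp [diffWeight, diffAtom, Fintype.sum_sum_type, sub_eq_add_neg]

/-- The base of the packing numbers of `k`-atomic measures, with `N = 2 * k`. -/
def packConst (R : ℝ) (N : ℕ) : ℝ :=
  6 * (N ^ N * √N.factorial * Real.exp (N * (1 + 2 * R) ^ 2 / 2))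

/-- Multilinearity: moments along arbitrary directions are recovered from the moment tensor in a
frame that reproduces the atoms. This allows moments taken in different frames to be compared. -/
theorem sum_prod_inner_of_frame {ι κ : Type*} [Fintype ι] [Fintype κ] {x : ι → E} {v : κ → E}
    (hv : ∀ i, x i = ∑ b, ⟪v b, x i⟫ • v b) (c : ι → ℝ) {l : ℕ} (u : Fin l → E) :
    ∑ i, c i * ∏ p, ⟪u p, x i⟫ = ∑ α : Fin l → κ,
      (∏ p, ⟪u p, v (α p)⟫) * wordMoment c (fun i b => ⟪v b, x i⟫) α := by
  classical
  simp_rw [wordMoment, Finset.mul_sum]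
  rw [Finset.sum_comm]
  refine Finset.sum_congr rfl fun i _ => ?_
  have : ∀ p, ⟪u p, x i⟫ = ∑ b, ⟪v b, x i⟫ * ⟪u p, v b⟫ := fun p => inner_eq_sum_of_frame (hv i) _
  simp_rw [this, Finset.prod_univ_sum, Fintype.piFinset_univ, Finset.mul_sum,
    Finset.prod_mul_distrib]
  exact Finset.sum_congr rfl fun α _ => by ring

theorem sum_geom_le (N : ℕ) : ∑ l : Fin N, N ^ (l : ℕ) ≤ N ^ N := by
  calc ∑ l : Fin N, N ^ (l : ℕ) ≤ ∑ _l : Fin N, N ^ (N - 1) :=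
        Finset.sum_le_sum fun l _ => Nat.pow_le_pow_right
          (Nat.pos_of_ne_zero (by rintro rfl; exact l.elim0)) (Nat.le_sub_one_of_lt l.2)
    _ = N * N ^ (N - 1) := by simp
    _ ≤ N ^ N := by
        rcases N with _ | N
        · simp
        · rw [Nat.add_sub_cancel, pow_succ, mul_comm]

/-- Two `k`-atomic measures whose differences to a third one have close frames and close moments
along these frames are close. -/
theorem sqDist_lt_of_close {k N : ℕ} (hN : N = 2 * k) {R : ℝ} (hR : 0 ≤ R) {γ γ' γ₀ : Atoms k E}
    (h : ∀ j, ‖γ.2 j‖ ≤ R) (h' : ∀ j, ‖γ'.2 j‖ ≤ R) {ε r η : ℝ} (hε : 0 < ε) (hr : 0 < r)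
    (hη : η = ε / r / (2 * ((N : ℝ) ^ N * √N.factorial
      * Real.exp (N * (1 + 2 * R) ^ 2 / 2))))
    (hd : sqDist γ γ₀ ≤ r ^ 2) {v v' : Fin N → E}
    (hv1 : ∀ b, ‖v b‖ ≤ 1) (hv1' : ∀ b, ‖v' b‖ ≤ 1)
    (hv : ∀ i, diffAtom γ γ₀ i = ∑ b, ⟪v b, diffAtom γ γ₀ i⟫ • v b)
    (hv' : ∀ i, diffAtom γ' γ₀ i = ∑ b, ⟪v' b, diffAtom γ' γ₀ i⟫ • v' b)
    (hvv : ∀ b, ‖v b - v' b‖ ≤ η)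
    (hm : ∀ l < N, ∀ α : Fin l → Fin N,
      |wordMoment (diffWeight γ γ₀) (fun i b => ⟪v b, diffAtom γ γ₀ i⟫) α
        - wordMoment (diffWeight γ' γ₀) (fun i b => ⟪v' b, diffAtom γ' γ₀ i⟫) α|
        ≤ η * (√N.factorial * r)) :
    sqDist γ γ' < ε ^ 2 := by
  have hcard : Fintype.card (Fin k ⊕ Fin k) = N := by simp [hN]; omega
  have hNN : 0 < (N : ℝ) ^ N := by
    rcases Nat.eq_zero_or_pos N with h0 | h0
    · simp [h0]
    · positivity
  set G := (N : ℝ) ^ N * √N.factorial * Real.exp (N * (1 + 2 * R) ^ 2 / 2) with hG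
  have hGpos : 0 < G := by positivity
  have hηpos : 0 < η := by rw [hη]; positivity
  -- A third frame is needed: `v` and `v'` reproduce the atoms of `γ - γ₀` and `γ' - γ₀`, whereas
  -- the energy to be bounded is that of `γ - γ'`. Its moments along `u` are differences of moments
  -- of the first two, each of which is expanded in its own frame.
  obtain ⟨u, hu1, hu⟩ := exists_frame (diffAtom γ γ') hcard.le
  have hxy : ∀ i j, ⟪diffAtom γ γ' i, diffAtom γ γ' j⟫
      = ∑ b, ⟪u b, diffAtom γ γ' i⟫ * ⟪u b, diffAtom γ γ' j⟫ :=
    fun i j => inner_eq_sum_mul_of_frame (hu j) _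
  set A := (N : ℝ) ^ N * (η * (√N.factorial * r)) with hA
  have hA0 : 0 ≤ A := by positivity
  have hshort : ∀ l < Fintype.card (Fin k ⊕ Fin k), ∀ β : Fin l → Fin N,
      |wordMoment (diffWeight γ γ') (fun i b => ⟪u b, diffAtom γ γ' i⟫) β| ≤ A := by
    intro l hl β
    rw [hcard] at hl
    set c := diffWeight γ γ₀
    set c' := diffWeight γ' γ₀
    have e0 : ∀ δ δ' : Atoms k E,
        ∑ i, diffWeight δ δ' i * ∏ p, ⟪u (β p), diffAtom δ δ' i⟫
          = ∑ j, δ.1 j * (∏ p, ⟪u (β p), δ.2 j⟫) - ∑ j, δ'.1 j * (∏ p, ⟪u (β p), δ'.2 j⟫) :=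
      fun δ δ' => sum_diffWeight δ δ' fun z => ∏ p, ⟪u (β p), z⟫
    have e1 : wordMoment (diffWeight γ γ') (fun i b => ⟪u b, diffAtom γ γ' i⟫) β
        = ∑ i, c i * ∏ p, ⟪u (β p), diffAtom γ γ₀ i⟫
          - ∑ i, c' i * ∏ p, ⟪u (β p), diffAtom γ' γ₀ i⟫ := by
      rw [e0, e0, wordMoment, e0]
      ring
    rw [e1, sum_prod_inner_of_frame hv, sum_prod_inner_of_frame hv', ← Finset.sum_sub_distrib]
    have hb : ∀ (w : Fin N → E), (∀ b, ‖w b‖ ≤ 1) → ∀ b b', |⟪u b, w b'⟫| ≤ 1 :=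
      fun w hw b b' => abs_inner_frame_le (hu1 b) (hw b')
    have hxy0 : ∀ i j, ⟪diffAtom γ γ₀ i, diffAtom γ γ₀ j⟫
        = ∑ b, ⟪v b, diffAtom γ γ₀ i⟫ * ⟪v b, diffAtom γ γ₀ j⟫ :=
      fun i j => inner_eq_sum_mul_of_frame (hv j) _
    have term : ∀ α : Fin l → Fin N,
        |(∏ p, ⟪u (β p), v (α p)⟫) * wordMoment c (fun i b => ⟪v b, diffAtom γ γ₀ i⟫) α
          - (∏ p, ⟪u (β p), v' (α p)⟫) * wordMoment c' (fun i b => ⟪v' b, diffAtom γ' γ₀ i⟫) α|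
          ≤ (l + 1) * (η * (√N.factorial * r)) := by
      intro α
      have t1 := abs_prod_sub_prod_le (a := fun p => ⟪u (β p), v (α p)⟫)
        (b := fun p => ⟪u (β p), v' (α p)⟫) (η := η) (fun p => hb v hv1 _ _)
        (fun p => hb v' hv1' _ _) (fun p => by
          rw [← inner_sub_right]
          exact abs_inner_frame_le (hu1 _) (hvv _))
      have t2 : |wordMoment c (fun i b => ⟪v b, diffAtom γ γ₀ i⟫) α| ≤ √N.factorial * r := by
        refine (abs_wordMoment_le_sqrt hxy0 hl.le α).trans ?_
        rw [Real.sqrt_mul (by positivity)]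
        gcongr
        exact (Real.sqrt_le_left hr.le).2 hd
      have t3 : |∏ p, ⟪u (β p), v' (α p)⟫| ≤ 1 := by
        rw [Finset.abs_prod]
        exact Finset.prod_le_one (fun _ _ => abs_nonneg _) fun p _ => hb v' hv1' _ _
      set P := ∏ p, ⟪u (β p), v (α p)⟫
      set P' := ∏ p, ⟪u (β p), v' (α p)⟫
      set W := wordMoment c (fun i b => ⟪v b, diffAtom γ γ₀ i⟫) α
      set W' := wordMoment c' (fun i b => ⟪v' b, diffAtom γ' γ₀ i⟫) α
      have t4 : |W - W'| ≤ η * (√N.factorial * r) := hm l hl α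
      calc |P * W - P' * W'| = |(P - P') * W + P' * (W - W')| := by ring_nf
        _ ≤ |P - P'| * |W| + |P'| * |W - W'| := by
            refine (abs_add_le _ _).trans_eq ?_
            rw [abs_mul, abs_mul]
        _ ≤ (l * η) * (√N.factorial * r) + 1 * (η * (√N.factorial * r)) := by gcongr
        _ = _ := by ring
    calc _ ≤ ∑ _α : Fin l → Fin N, (l + 1 : ℝ) * (η * (√N.factorial * r)) :=
          (Finset.abs_sum_le_sum_abs _ _).trans (Finset.sum_le_sum fun α _ => term α)
      _ = ((N ^ l * (l + 1) : ℕ) : ℝ) * (η * (√N.factorial * r)) := by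
          simp only [Finset.sum_const, Finset.card_univ, Fintype.card_fun, Fintype.card_fin,
            nsmul_eq_mul]
          push_cast
          ring
      _ ≤ ((N ^ N : ℕ) : ℝ) * (η * (√N.factorial * r)) := by
          gcongr
          calc N ^ l * (l + 1) ≤ N ^ (N - 1) * N :=
                Nat.mul_le_mul (Nat.pow_le_pow_right (by omega) (by omega)) (by omega)
            _ = N ^ N := by rw [← pow_succ]; congr 1; omega
      _ = A := by rw [hA]; push_cast; ring
  have hlong := fun (l : ℕ) (α : Fin l → Fin N) =>
    abs_wordMoment_le hR (fun i b => abs_inner_frame_le (hu1 b) (norm_diffAtom_le h h' i)) hA0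
      hshort α
  have hfin := energy_le hxy hlong
  rw [Fintype.card_fin] at hfin
  -- This identity dictates the choice of `η`: it makes the final energy bound equal to `(ε / 2) ^
  -- 2`, strictly below `ε ^ 2`.
  have hAe : A = ε / 2 / Real.exp (N * (1 + 2 * R) ^ 2 / 2) := by
    rw [hA, hη, hG]
    field_simp
  have hexp : Real.exp (N * (1 + 2 * R) ^ 2) = Real.exp (N * (1 + 2 * R) ^ 2 / 2) ^ 2 := by
    rw [← Real.exp_nat_mul]
    congr 1
    push_cast
    ring
  calc sqDist γ γ' ≤ Real.exp (N * (1 + 2 * R) ^ 2) * A ^ 2 := hfin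
    _ = (ε / 2) ^ 2 := by
        rw [hAe, hexp, div_pow _ (Real.exp _)]
        field_simp
    _ < ε ^ 2 := by nlinarith

/-- Local packing numbers of `k`-atomic measures. -/
theorem card_packing_le {k : ℕ} {R : ℝ} (hR : 0 ≤ R) [FiniteDimensional ℝ E] {γ₀ : Atoms k E}
    (S : Finset (Atoms k E)) (hS : ∀ γ ∈ S, ∀ j, ‖γ.2 j‖ ≤ R) {ε r : ℝ} (hε : 0 < ε)
    (hεr : ε ≤ r) (hball : ∀ γ ∈ S, sqDist γ γ₀ ≤ r ^ 2)
    (hsep : ∀ γ ∈ S, ∀ γ' ∈ S, γ ≠ γ' → ε ^ 2 ≤ sqDist γ γ') :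
    (S.card : ℝ) ≤ (packConst R (2 * k) * (r / ε)) ^
      (2 * k * Module.finrank ℝ E + (2 * k) ^ (2 * k)) := by
  classical
  have hr : 0 < r := hε.trans_le hεr
  set N := 2 * k with hN
  have hcard : Fintype.card (Fin k ⊕ Fin k) = N := by simp [hN]; omega
  have hNN : 1 ≤ (N : ℝ) ^ N := by
    rcases Nat.eq_zero_or_pos N with h0 | h0
    · simp [h0]
    · exact one_le_pow₀ (by exact_mod_cast h0)
  set G := (N : ℝ) ^ N * √N.factorial * Real.exp (N * (1 + 2 * R) ^ 2 / 2) with hG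
  have hG1 : 1 ≤ G := by
    have h1 : 1 ≤ √(N.factorial : ℝ) :=
      Real.one_le_sqrt.2 (by exact_mod_cast Nat.succ_le_of_lt N.factorial_pos)
    have h2 : 1 ≤ Real.exp (N * (1 + 2 * R) ^ 2 / 2) := Real.one_le_exp (by positivity)
    exact one_le_mul_of_one_le_of_one_le (one_le_mul_of_one_le_of_one_le hNN h1) h2
  have hGpos : 0 < G := by linarith
  set η := ε / r / (2 * G) with hη
  have hηpos : 0 < η := by positivity
  choose v hv1 hv using fun γ : Atoms k E => exists_frame (diffAtom γ γ₀) hcard.le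
  -- Each element is coded by a frame and by its moments of order below `N`. Dividing by `√N! * r`,
  -- an upper bound for these moments in the ball of radius `r`, places the code in a unit ball, so
  -- only the ratio `r / ε` enters the count.
  let code : Atoms k E → (Fin N → E) × ((Σ l : Fin N, (Fin l → Fin N)) → ℝ) := fun γ =>
    (v γ, fun α => wordMoment (diffWeight γ γ₀) (fun i b => ⟪v γ b, diffAtom γ γ₀ i⟫) α.2
      / (√N.factorial * r))
  have hfac : 0 < √(N.factorial : ℝ) * r := by positivity
  have hfar : ∀ γ ∈ S, ∀ γ' ∈ S, γ ≠ γ' → η ≤ ‖code γ - code γ'‖ := by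
    intro γ hγ γ' hγ' hne
    by_contra! hlt
    refine absurd (hsep γ hγ γ' hγ' hne) (not_le.2 ?_)
    have hc1 : ‖(code γ - code γ').1‖ ≤ η := (norm_fst_le _).trans hlt.le
    have hc2 : ‖(code γ - code γ').2‖ ≤ η := (norm_snd_le _).trans hlt.le
    refine sqDist_lt_of_close hN hR (hS γ hγ) (hS γ' hγ') hε hr hη (hball γ hγ) (hv1 γ) (hv1 γ')
      (hv γ) (hv γ') (fun b => (norm_le_pi_norm (code γ - code γ').1 b).trans hc1) ?_
    intro l hl α
    have := (norm_le_pi_norm (code γ - code γ').2 ⟨⟨l, hl⟩, α⟩).trans hc2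
    simp only [code, Prod.snd_sub, Pi.sub_apply, Real.norm_eq_abs, ← sub_div] at this
    rwa [abs_div, abs_of_pos hfac, div_le_iff₀ hfac] at this
  have hinj : Set.InjOn code S := by
    intro γ hγ γ' hγ' heq
    by_contra hne
    have := hfar γ hγ γ' hγ' hne
    rw [heq, sub_self, norm_zero] at this
    linarith
  have hcount := card_le_of_separated hηpos (S.image code) (fun c hc => ?_) (fun c hc d hd hcd => ?_)
  · rw [Finset.card_image_of_injOn hinj] at hcount
    refine hcount.trans ?_
    have hdim : Module.finrank ℝ ((Fin N → E) × ((Σ l : Fin N, (Fin l → Fin N)) → ℝ))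
        ≤ N * Module.finrank ℝ E + N ^ N := by
      rw [Module.finrank_prod, Module.finrank_pi_fintype, Module.finrank_fintype_fun_eq_card]
      simp only [Finset.sum_const, Finset.card_univ, Fintype.card_fin, smul_eq_mul,
        Fintype.card_sigma, Fintype.card_fun]
      exact Nat.add_le_add_left (sum_geom_le N) _
    have hbase : 1 + 2 / η ≤ packConst R N * (r / ε) := by
      have h1 : 1 ≤ r / ε := (one_le_div hε).2 hεr
      have h2 : 2 / η = 4 * G * (r / ε) := by
        rw [hη]
        field_simp
        norm_num
      have h3 : packConst R N = 6 * G := rfl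
      rw [h2, h3]
      nlinarith [mul_le_mul hG1 h1 zero_le_one hGpos.le]
    have h0 : 0 ≤ 2 / η := by positivity
    calc (1 + 2 / η) ^ Module.finrank ℝ ((Fin N → E) × ((Σ l : Fin N, (Fin l → Fin N)) → ℝ))
        ≤ (1 + 2 / η) ^ (N * Module.finrank ℝ E + N ^ N) :=
          pow_le_pow_right₀ (by linarith) hdim
      _ ≤ _ := pow_le_pow_left₀ (by linarith) hbase _
  · obtain ⟨γ, hγ, rfl⟩ := Finset.mem_image.1 hc
    refine max_le ?_ ?_
    · exact (pi_norm_le_iff_of_nonneg zero_le_one).2 (hv1 γ)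
    · refine (pi_norm_le_iff_of_nonneg zero_le_one).2 fun α => ?_
      simp only [code, Real.norm_eq_abs]
      rw [abs_div, abs_of_pos hfac, div_le_one hfac]
      refine (abs_wordMoment_le_sqrt (fun i j => inner_eq_sum_mul_of_frame (hv γ j) _)
        (N := N) α.1.2.le α.2).trans ?_
      rw [Real.sqrt_mul (by positivity)]
      gcongr
      exact (Real.sqrt_le_left hr.le).2 (hball γ hγ)
  · obtain ⟨γ, hγ, rfl⟩ := Finset.mem_image.1 hc
    obtain ⟨γ', hγ', rfl⟩ := Finset.mem_image.1 hd
    exact hfar γ hγ γ' hγ' fun h => hcd (by rw [h])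

end Packing

/-! ### Densities relative to the standard Gaussian -/

section Density

variable {E : Type*} [NormedAddCommGroup E] [InnerProductSpace ℝ E]

/-- The density of `N(m, I)` with respect to `N(0, I)`. -/
def shiftDensity (m x : E) : ℝ := Real.exp (⟪m, x⟫ - ‖m‖ ^ 2 / 2)

theorem shiftDensity_pos (m x : E) : 0 < shiftDensity m x := Real.exp_pos _

/-- The density of a Gaussian mixture with respect to the standard Gaussian measure. -/
def density {k : ℕ} (γ : Atoms k E) (x : E) : ℝ := ∑ j, γ.1 j * shiftDensity (γ.2 j) x

/-- `γ` is a probability measure with atoms in the ball of radius `R`. -/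
def IsMixing {F : Type*} [Norm F] (R : ℝ) {k : ℕ} (γ : Atoms k F) : Prop :=
  (∀ j, ‖γ.2 j‖ ≤ R) ∧ (∀ j, 0 ≤ γ.1 j) ∧ ∑ j, γ.1 j = 1

theorem density_pos {R : ℝ} {k : ℕ} {γ : Atoms k E} (h : IsMixing R γ) (x : E) :
    0 < density γ x := by
  obtain ⟨j, -, hj⟩ : ∃ j ∈ Finset.univ, 0 < γ.1 j := by
    by_contra! hcon
    have := Finset.sum_nonpos hcon
    rw [h.2.2] at this
    linarith
  exact Finset.sum_pos' (fun i _ => mul_nonneg (h.2.1 i) (shiftDensity_pos _ _).le)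
    ⟨j, Finset.mem_univ j, mul_pos hj (shiftDensity_pos _ _)⟩

theorem shiftDensity_mul_shiftDensity (a b z x : E) :
    shiftDensity a x * shiftDensity b x * shiftDensity z x
      = Real.exp (-((‖a‖ ^ 2 + ‖b‖ ^ 2 + ‖z‖ ^ 2) / 2)) * Real.exp ⟪a + b + z, x⟫ := by
  simp only [shiftDensity, ← Real.exp_add, inner_add_left]
  congr 1
  ring

theorem density_sub_density {k : ℕ} (γ γ' : Atoms k E) (x : E) :
    density γ x - density γ' x
      = ∑ i, diffWeight γ γ' i * shiftDensity (diffAtom γ γ' i) x :=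
  (sum_diffWeight γ γ' fun z => shiftDensity z x).symm

theorem sq_sum_mul_shiftDensity {ι : Type*} [Fintype ι] (c : ι → ℝ) (a : ι → E) (z x : E) :
    (∑ i, c i * shiftDensity (a i) x) ^ 2 * shiftDensity z x
      = ∑ i, ∑ j, c i * c j * (shiftDensity (a i) x * shiftDensity (a j) x * shiftDensity z x) := by
  rw [sq, Finset.sum_mul_sum, Finset.sum_mul]
  refine Finset.sum_congr rfl fun i _ => ?_
  rw [Finset.sum_mul]
  exact Finset.sum_congr rfl fun j _ => by ring

theorem shiftDensity_zero (x : E) : shiftDensity (0 : E) x = 1 := by simp [shiftDensity]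

theorem sq_sqrt_sub_le {a b : ℝ} (ha : 0 ≤ a) (hb : 0 ≤ b) : (√a - √b) ^ 2 ≤ a + b := by
  nlinarith [Real.sq_sqrt ha, Real.sq_sqrt hb, mul_nonneg (Real.sqrt_nonneg a) (Real.sqrt_nonneg b)]

theorem tiltConst_pos (R : ℝ) (N : ℕ) : 0 < tiltConst R N := by
  unfold tiltConst
  positivity

/-- Jensen's inequality for `t ↦ t⁻¹`, and the fact that the reciprocal of the relative density of
`N(m,I)` is `exp (‖m‖ ^ 2)` times that of `N(-m,I)`. Division by a mixture density thus becomes a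
tilt by reflected atoms. -/
theorem inv_density_le {k : ℕ} {R : ℝ} {γ : Atoms k E} (h : IsMixing R γ) (x : E) :
    (density γ x)⁻¹ ≤ Real.exp (R ^ 2) * ∑ j, γ.1 j * shiftDensity ((-1 : ℝ) • γ.2 j) x := by
  have hconv : ConvexOn ℝ (Set.Ioi (0 : ℝ)) fun t : ℝ => t⁻¹ := by
    simpa using convexOn_zpow (𝕜 := ℝ) (-1)
  have := hconv.map_sum_le (t := Finset.univ) (w := γ.1) (p := fun j => shiftDensity (γ.2 j) x)
    (fun j _ => h.2.1 j) h.2.2 (fun j _ => shiftDensity_pos _ _)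
  simp only [smul_eq_mul] at this
  refine this.trans ?_
  rw [Finset.mul_sum]
  refine Finset.sum_le_sum fun j _ => ?_
  have e : (shiftDensity (γ.2 j) x)⁻¹
      = Real.exp (‖γ.2 j‖ ^ 2) * shiftDensity ((-1 : ℝ) • γ.2 j) x := by
    rw [shiftDensity, shiftDensity, ← Real.exp_neg, ← Real.exp_add]
    congr 1
    simp [inner_neg_left]
    ring
  rw [e]
  have h1 : Real.exp (‖γ.2 j‖ ^ 2) ≤ Real.exp (R ^ 2) :=
    Real.exp_le_exp.2 (pow_le_pow_left₀ (norm_nonneg _) (h.1 j) 2)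
  calc γ.1 j * (Real.exp (‖γ.2 j‖ ^ 2) * shiftDensity ((-1 : ℝ) • γ.2 j) x)
      ≤ γ.1 j * (Real.exp (R ^ 2) * shiftDensity ((-1 : ℝ) • γ.2 j) x) :=
        mul_le_mul_of_nonneg_left
          (mul_le_mul_of_nonneg_right h1 (shiftDensity_pos _ _).le) (h.2.1 j)
    _ = _ := by ring

end Density

/-! ### Gaussian integrals; comparison of energy, Hellinger distance and chi-square -/

section Gaussian

variable {E : Type*} [NormedAddCommGroup E] [InnerProductSpace ℝ E] [FiniteDimensional ℝ E]
  [MeasurableSpace E] [BorelSpace E]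

/-- The Laplace–Fourier transform of the standard Gaussian measure. -/
theorem integral_cexp_inner_stdGaussian (m t : E) :
    ∫ x, Complex.exp (⟪x, m⟫ + ⟪x, t⟫ * Complex.I) ∂(stdGaussian E)
      = Complex.exp ((‖m‖ ^ 2 - ‖t‖ ^ 2) / 2 + ⟪m, t⟫ * Complex.I) := by
  let b := stdOrthonormalBasis ℝ E
  rw [stdGaussian, integral_map (Measurable.aemeasurable (by fun_prop))
    (Measurable.aestronglyMeasurable (by fun_prop))]
  have e : ∀ x : Fin (Module.finrank ℝ E) → ℝ,
      Complex.exp (⟪∑ i, x i • b i, m⟫ + ⟪∑ i, x i • b i, t⟫ * Complex.I)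
        = ∏ i, Complex.exp ((⟪b i, m⟫ + ⟪b i, t⟫ * Complex.I) * x i) := by
    intro x
    rw [← Complex.exp_sum]
    congr 1
    simp only [sum_inner, real_inner_smul_left, Complex.ofReal_sum, Complex.ofReal_mul,
      Finset.sum_mul, ← Finset.sum_add_distrib]
    exact Finset.sum_congr rfl fun i _ => by ring
  simp only [b] at e
  simp_rw [e]
  rw [integral_fintype_prod_eq_prod (f := fun i (x : ℝ) =>
    Complex.exp ((⟪stdOrthonormalBasis ℝ E i, m⟫ + ⟪stdOrthonormalBasis ℝ E i, t⟫ * Complex.I) * x))]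
  have e2 : ∀ z : ℂ, ∫ x : ℝ, Complex.exp (z * x) ∂(gaussianReal 0 1) = Complex.exp (z ^ 2 / 2) := by
    intro z
    have := complexMGF_id_gaussianReal (μ := 0) (v := 1) z
    simpa [complexMGF] using this
  simp_rw [e2]
  rw [← Complex.exp_sum]
  congr 1
  have n1 := b.sum_sq_inner_right m
  have n2 := b.sum_sq_inner_right t
  have n3 := b.sum_inner_mul_inner m t
  rw [← Complex.ofReal_pow, ← Complex.ofReal_pow, ← n1, ← n2, ← n3]
  push_cast
  rw [← Finset.sum_sub_distrib, Finset.sum_div, Finset.sum_mul, ← Finset.sum_add_distrib]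
  refine Finset.sum_congr rfl fun i _ => ?_
  rw [real_inner_comm (b i) m]
  linear_combination (⟪b i, t⟫ : ℂ) ^ 2 / 2 * Complex.I_sq

theorem integrable_exp_inner_stdGaussian (a : E) :
    Integrable (fun x => Real.exp ⟪a, x⟫) (stdGaussian E) := by
  have h : (stdGaussian E).map (innerSL ℝ a) = gaussianReal 0 (‖a‖ ^ 2).toNNReal := by
    rw [IsGaussian.map_eq_gaussianReal, integral_strongDual_stdGaussian,
      variance_dual_stdGaussian]
    simp
  have h2 : Integrable (fun y : ℝ => Real.exp (1 * y)) (gaussianReal 0 (‖a‖ ^ 2).toNNReal) :=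
    integrable_exp_mul_gaussianReal 1
  rw [← h] at h2
  have := h2.comp_measurable (innerSL ℝ a).continuous.measurable
  simpa [Function.comp_def] using this

theorem integral_exp_inner_stdGaussian (a : E) :
    ∫ x, Real.exp ⟪a, x⟫ ∂(stdGaussian E) = Real.exp (‖a‖ ^ 2 / 2) := by
  have h := integral_cexp_inner_stdGaussian a 0
  simp only [inner_zero_right, Complex.ofReal_zero, zero_mul, add_zero, norm_zero] at h
  have h2 : ∫ x, ((Real.exp ⟪x, a⟫ : ℝ) : ℂ) ∂(stdGaussian E) = ((Real.exp (‖a‖ ^ 2 / 2) : ℝ) : ℂ) := by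
    push_cast
    rw [h]
    congr 1
    ring
  rw [integral_complex_ofReal] at h2
  have h3 := Complex.ofReal_injective h2
  simp_rw [real_inner_comm a] at h3 ⊢
  exact h3

theorem measurable_shiftDensity (m : E) : Measurable (shiftDensity m) := by
  unfold shiftDensity
  fun_prop

theorem integrable_shiftDensity (m : E) : Integrable (shiftDensity m) (stdGaussian E) := by
  unfold shiftDensity
  simp_rw [Real.exp_sub]
  exact (integrable_exp_inner_stdGaussian m).div_const _

theorem integral_shiftDensity (m : E) : ∫ x, shiftDensity m x ∂(stdGaussian E) = 1 := by
  unfold shiftDensity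
  simp_rw [Real.exp_sub, integral_div, integral_exp_inner_stdGaussian]
  exact div_self (Real.exp_pos _).ne'

/-- The Cameron–Martin formula in finite dimension, by equality of characteristic functions. -/
theorem map_add_stdGaussian (m : E) : (stdGaussian E).map (fun x => m + x)
    = (stdGaussian E).withDensity fun x => ENNReal.ofReal (shiftDensity m x) := by
  have : IsFiniteMeasure ((stdGaussian E).withDensity
      fun x => ENNReal.ofReal (shiftDensity m x)) :=
    isFiniteMeasure_withDensity_ofReal (integrable_shiftDensity m).2
  have : IsFiniteMeasure ((stdGaussian E).map (fun x => m + x)) := inferInstance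
  apply Measure.ext_of_charFun
  ext t
  rw [charFun_apply, charFun_apply, integral_map (by fun_prop) (by fun_prop),
    integral_withDensity_eq_integral_toReal_smul (measurable_shiftDensity m).ennreal_ofReal
      (ae_of_all _ fun _ => ENNReal.ofReal_lt_top)]
  simp_rw [ENNReal.toReal_ofReal (shiftDensity_pos m _).le, shiftDensity]
  have e1 : ∀ x : E, Complex.exp (⟪m + x, t⟫ * Complex.I)
      = Complex.exp (⟪m, t⟫ * Complex.I) * Complex.exp (⟪x, (0 : E)⟫ + ⟪x, t⟫ * Complex.I) := by
    intro x
    rw [← Complex.exp_add, inner_add_left]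
    congr 1
    push_cast
    simp
    ring
  have e2 : ∀ x : E, Real.exp (⟪m, x⟫ - ‖m‖ ^ 2 / 2) • Complex.exp (⟪x, t⟫ * Complex.I)
      = Complex.exp (-(‖m‖ ^ 2 / 2)) * Complex.exp (⟪x, m⟫ + ⟪x, t⟫ * Complex.I) := by
    intro x
    rw [Complex.real_smul, Complex.ofReal_exp, ← Complex.exp_add, ← Complex.exp_add,
      real_inner_comm]
    congr 1
    push_cast
    ring
  simp_rw [e1, e2]
  rw [integral_const_mul, integral_const_mul, integral_cexp_inner_stdGaussian,
    integral_cexp_inner_stdGaussian, ← Complex.exp_add, ← Complex.exp_add]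
  congr 1
  simp
  ring

theorem measurable_density {k : ℕ} (γ : Atoms k E) : Measurable (density γ) := by
  unfold density
  exact Finset.measurable_sum _ fun j _ => (measurable_shiftDensity _).const_mul _

theorem integrable_density {k : ℕ} (γ : Atoms k E) : Integrable (density γ) (stdGaussian E) := by
  unfold density
  exact integrable_finsetSum _ fun j _ => (integrable_shiftDensity _).const_mul _

theorem integral_density {R : ℝ} {k : ℕ} {γ : Atoms k E} (h : IsMixing R γ) :
    ∫ x, density γ x ∂(stdGaussian E) = 1 := by
  unfold density
  rw [integral_finsetSum _ fun j _ => (integrable_shiftDensity _).const_mul _]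
  simp_rw [integral_const_mul, integral_shiftDensity, mul_one]
  exact h.2.2

theorem integrable_shiftDensity_mul (a b z : E) :
    Integrable (fun x => shiftDensity a x * shiftDensity b x * shiftDensity z x)
      (stdGaussian E) := by
  simp_rw [shiftDensity_mul_shiftDensity]
  exact (integrable_exp_inner_stdGaussian _).const_mul _

theorem integral_shiftDensity_mul (a b z : E) :
    ∫ x, shiftDensity a x * shiftDensity b x * shiftDensity z x ∂(stdGaussian E)
      = Real.exp (⟪a, b⟫ + ⟪a, z⟫ + ⟪b, z⟫) := by
  simp_rw [shiftDensity_mul_shiftDensity]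
  rw [integral_const_mul, integral_exp_inner_stdGaussian, ← Real.exp_add]
  congr 1
  simp only [← real_inner_self_eq_norm_sq, inner_add_left, inner_add_right,
    real_inner_comm a b, real_inner_comm a z, real_inner_comm b z]
  ring

theorem integrable_sq_density_sub_mul {k : ℕ} (γ γ' : Atoms k E) (z : E) :
    Integrable (fun x => (density γ x - density γ' x) ^ 2 * shiftDensity z x) (stdGaussian E) := by
  simp_rw [density_sub_density, sq_sum_mul_shiftDensity]
  exact integrable_finsetSum _ fun i _ => integrable_finsetSum _ fun j _ =>
    (integrable_shiftDensity_mul _ _ _).const_mul _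

/-- The factor `exp (⟪a, b⟫ + ⟪a, z⟫ + ⟪b, z⟫)` splits into the energy kernel and one exponential
for each weight: weighting the `L²` distance by the density of `N(z,I)` tilts the signed measure. -/
theorem integral_sq_density_sub_mul {k : ℕ} (γ γ' : Atoms k E) (z : E) :
    ∫ x, (density γ x - density γ' x) ^ 2 * shiftDensity z x ∂(stdGaussian E)
      = energy (fun i => diffWeight γ γ' i * Real.exp ⟪diffAtom γ γ' i, z⟫) (diffAtom γ γ') := by
  simp_rw [density_sub_density, sq_sum_mul_shiftDensity]
  rw [integral_finsetSum _ fun i _ => integrable_finsetSum _ fun j _ =>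
    (integrable_shiftDensity_mul _ _ _).const_mul _]
  refine Finset.sum_congr rfl fun i _ => ?_
  rw [integral_finsetSum _ fun j _ => (integrable_shiftDensity_mul _ _ _).const_mul _]
  refine Finset.sum_congr rfl fun j _ => ?_
  rw [integral_const_mul, integral_shiftDensity_mul, Real.exp_add, Real.exp_add]
  ring

theorem integrable_sq_density_sub {k : ℕ} (γ γ' : Atoms k E) :
    Integrable (fun x => (density γ x - density γ' x) ^ 2) (stdGaussian E) := by
  simpa [shiftDensity_zero] using integrable_sq_density_sub_mul γ γ' 0

theorem integral_sq_density_sub {k : ℕ} (γ γ' : Atoms k E) :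
    ∫ x, (density γ x - density γ' x) ^ 2 ∂(stdGaussian E) = sqDist γ γ' := by
  simpa [shiftDensity_zero, sqDist] using integral_sq_density_sub_mul γ γ' 0

theorem integral_sq_density_sub_mul_le {k : ℕ} {R : ℝ} (hR : 0 ≤ R) {γ γ' : Atoms k E}
    (h : IsMixing R γ) (h' : IsMixing R γ') (i₀ : Fin k ⊕ Fin k) {s : ℝ} (hs : |s| ≤ 1) :
    ∫ x, (density γ x - density γ' x) ^ 2 * shiftDensity (s • diffAtom γ γ' i₀) x
      ∂(stdGaussian E) ≤ tiltConst R (2 * k) * sqDist γ γ' := by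
  rw [integral_sq_density_sub_mul]
  simp_rw [inner_smul_right]
  have := energy_tilt_le hR (diffWeight γ γ') (norm_diffAtom_le h.1 h'.1) i₀ hs
  rwa [Fintype.card_sum, Fintype.card_fin, ← two_mul] at this

/-- The affinity form of the squared Hellinger distance of two mixtures. -/
def sqHell {k : ℕ} (γ γ' : Atoms k E) : ℝ :=
  ∫ x, (√(density γ x) - √(density γ' x)) ^ 2 ∂(stdGaussian E)

theorem integrable_sq_sqrt_sub {k : ℕ} {R : ℝ} {γ γ' : Atoms k E}
    (h : IsMixing R γ) (h' : IsMixing R γ') :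
    Integrable (fun x => (√(density γ x) - √(density γ' x)) ^ 2) (stdGaussian E) := by
  refine ((integrable_density γ).add (integrable_density γ')).mono' ?_ (ae_of_all _ fun x => ?_)
  · exact (((measurable_density γ).sqrt.sub (measurable_density γ').sqrt).pow_const 2).aestronglyMeasurable
  · rw [Real.norm_eq_abs, abs_of_nonneg (sq_nonneg _)]
    exact sq_sqrt_sub_le (density_pos h x).le (density_pos h' x).le

theorem sqHell_nonneg {k : ℕ} (γ γ' : Atoms k E) : 0 ≤ sqHell γ γ' :=
  integral_nonneg fun _ => sq_nonneg _

theorem sqHell_le_two {k : ℕ} {R : ℝ} {γ γ' : Atoms k E}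
    (h : IsMixing R γ) (h' : IsMixing R γ') : sqHell γ γ' ≤ 2 := by
  calc sqHell γ γ' ≤ ∫ x, (density γ x + density γ' x) ∂(stdGaussian E) :=
        integral_mono (integrable_sq_sqrt_sub h h')
          ((integrable_density γ).add (integrable_density γ'))
          fun x => sq_sqrt_sub_le (density_pos h x).le (density_pos h' x).le
    _ = 2 := by
        rw [integral_add (integrable_density γ) (integrable_density γ'), integral_density h,
          integral_density h']
        norm_num

theorem sqHell_triangle {k : ℕ} {R : ℝ} {γ γ' γ'' : Atoms k E}
    (h : IsMixing R γ) (h' : IsMixing R γ') (h'' : IsMixing R γ'') :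
    sqHell γ γ'' ≤ 2 * sqHell γ γ' + 2 * sqHell γ' γ'' := by
  unfold sqHell
  rw [← integral_const_mul, ← integral_const_mul, ← integral_add
    ((integrable_sq_sqrt_sub h h').const_mul 2) ((integrable_sq_sqrt_sub h' h'').const_mul 2)]
  refine integral_mono (integrable_sq_sqrt_sub h h'')
    (((integrable_sq_sqrt_sub h h').const_mul 2).add ((integrable_sq_sqrt_sub h' h'').const_mul 2))
    fun x => ?_
  nlinarith [sq_nonneg ((√(density γ x) - √(density γ' x)) - (√(density γ' x) - √(density γ'' x)))]

theorem integral_sq_density_sub_mul_density_le {k : ℕ} {R : ℝ} (hR : 0 ≤ R) {γ γ' γ₁ : Atoms k E}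
    (h : IsMixing R γ) (h' : IsMixing R γ') (h₁ : γ₁ = γ ∨ γ₁ = γ') :
    Integrable (fun x => (density γ x - density γ' x) ^ 2 * density γ₁ x) (stdGaussian E) ∧
    ∫ x, (density γ x - density γ' x) ^ 2 * density γ₁ x ∂(stdGaussian E)
      ≤ tiltConst R (2 * k) * sqDist γ γ' := by
  have e : ∀ x, (density γ x - density γ' x) ^ 2 * density γ₁ x
      = ∑ j, γ₁.1 j * ((density γ x - density γ' x) ^ 2 * shiftDensity (γ₁.2 j) x) := by
    intro x
    rw [density.eq_def γ₁, Finset.mul_sum]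
    exact Finset.sum_congr rfl fun j _ => by ring
  have hint : ∀ j ∈ Finset.univ, Integrable
      (fun x => γ₁.1 j * ((density γ x - density γ' x) ^ 2 * shiftDensity (γ₁.2 j) x))
      (stdGaussian E) := fun j _ => (integrable_sq_density_sub_mul _ _ _).const_mul _
  have hm : IsMixing R γ₁ := by
    rcases h₁ with rfl | rfl
    · exact h
    · exact h'
  simp_rw [e]
  refine ⟨integrable_finsetSum _ hint, ?_⟩
  rw [integral_finsetSum _ hint]
  calc _ ≤ ∑ j, γ₁.1 j * (tiltConst R (2 * k) * sqDist γ γ') := by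
        refine Finset.sum_le_sum fun j _ => ?_
        rw [integral_const_mul]
        refine mul_le_mul_of_nonneg_left ?_ (hm.2.1 j)
        rcases h₁ with rfl | rfl
        · simpa [diffAtom] using integral_sq_density_sub_mul_le hR h h' (Sum.inl j) (s := 1) (by simp)
        · simpa [diffAtom] using integral_sq_density_sub_mul_le hR h h' (Sum.inr j) (s := 1) (by simp)
    _ = _ := by rw [← Finset.sum_mul, hm.2.2, one_mul]

/-- The exponential energy is bounded by the squared Hellinger distance. -/
theorem sqDist_le_sqHell {k : ℕ} {R : ℝ} (hR : 0 ≤ R) {γ γ' : Atoms k E}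
    (h : IsMixing R γ) (h' : IsMixing R γ') :
    sqDist γ γ' ≤ 4 * tiltConst R (2 * k) * sqHell γ γ' := by
  set K := tiltConst R (2 * k) with hK
  have hKpos : 0 < K := tiltConst_pos _ _
  obtain ⟨i1, b1⟩ := integral_sq_density_sub_mul_density_le hR h h' (Or.inl rfl)
  obtain ⟨i2, b2⟩ := integral_sq_density_sub_mul_density_le hR h h' (Or.inr rfl)
  have i0 := integrable_sq_sqrt_sub h h'
  -- Factor `(a - b)² = (√a - √b) * ((a - b) * (√a + √b))` and apply a weighted AM-GM inequality.
  -- The second square is at most `2 * (a - b)² * (a + b)`, whose integral is a tilted energy; the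
  -- weights are tuned so that it contributes exactly half of `sqDist`, which is absorbed on the
  -- left.
  have key : ∀ x, (density γ x - density γ' x) ^ 2
      ≤ 2 * K * (√(density γ x) - √(density γ' x)) ^ 2
        + (1 / (4 * K)) * ((density γ x - density γ' x) ^ 2 * density γ x
          + (density γ x - density γ' x) ^ 2 * density γ' x) := by
    intro x
    have ha := (density_pos h x).le
    have hb := (density_pos h' x).le
    set a := density γ x
    set b := density γ' x
    have e1 : a - b = (√a - √b) * (√a + √b) := by
      nlinarith [Real.sq_sqrt ha, Real.sq_sqrt hb]
    have e2 : (√a + √b) ^ 2 ≤ 2 * (a + b) := by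
      nlinarith [Real.sq_sqrt ha, Real.sq_sqrt hb, sq_nonneg (√a - √b)]
    have e3 : (a - b) ^ 2 = (√a - √b) * ((a - b) * (√a + √b)) := by
      rw [sq]
      nth_rewrite 1 [e1]
      ring
    have e4 : (√a - √b) * ((a - b) * (√a + √b))
        ≤ 2 * K * (√a - √b) ^ 2 + (1 / (8 * K)) * ((a - b) * (√a + √b)) ^ 2 := by
      have e5 : 2 * K * (√a - √b) ^ 2 + (1 / (8 * K)) * ((a - b) * (√a + √b)) ^ 2
          - (√a - √b) * ((a - b) * (√a + √b))
          = (1 / (8 * K)) * (4 * K * (√a - √b) - (a - b) * (√a + √b)) ^ 2 := by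
        field_simp
        ring
      have e6 : 0 ≤ (1 / (8 * K)) * (4 * K * (√a - √b) - (a - b) * (√a + √b)) ^ 2 := by positivity
      linarith
    have e7 : (1 / (8 * K)) * ((a - b) * (√a + √b)) ^ 2
        ≤ (1 / (4 * K)) * ((a - b) ^ 2 * a + (a - b) ^ 2 * b) := by
      calc (1 / (8 * K)) * ((a - b) * (√a + √b)) ^ 2
          = (1 / (8 * K)) * ((a - b) ^ 2 * (√a + √b) ^ 2) := by ring
        _ ≤ (1 / (8 * K)) * ((a - b) ^ 2 * (2 * (a + b))) := by gcongr
        _ = _ := by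
            field_simp
            ring
    linarith
  have hI := integral_mono (integrable_sq_density_sub γ γ')
    ((i0.const_mul (2 * K)).add ((i1.add i2).const_mul (1 / (4 * K)))) key
  rw [integral_sq_density_sub] at hI
  simp only [Pi.add_apply] at hI
  have i3 : Integrable (fun x => (density γ x - density γ' x) ^ 2 * density γ x
      + (density γ x - density γ' x) ^ 2 * density γ' x) (stdGaussian E) := i1.add i2
  rw [integral_add (i0.const_mul (2 * K)) (i3.const_mul (1 / (4 * K))),
    integral_const_mul, integral_const_mul, integral_add i1 i2] at hI
  have hb : (1 / (4 * K)) * (∫ x, (density γ x - density γ' x) ^ 2 * density γ x ∂(stdGaussian E)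
      + ∫ x, (density γ x - density γ' x) ^ 2 * density γ' x ∂(stdGaussian E))
      ≤ (1 / (4 * K)) * (K * sqDist γ γ' + K * sqDist γ γ') := by gcongr
  have he : (1 / (4 * K)) * (K * sqDist γ γ' + K * sqDist γ γ') = sqDist γ γ' / 2 := by
    field_simp
    ring
  change _ ≤ 2 * K * sqHell γ γ' + _ at hI
  linarith

/-- The ratio of the chi-square divergence and the exponential energy. -/
def chiConst (R : ℝ) (N : ℕ) : ℝ := Real.exp (R ^ 2) * tiltConst R N

/-- The chi-square divergence of two mixtures. -/
def chiSq {k : ℕ} (γ γ' : Atoms k E) : ℝ :=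
  ∫ x, (density γ x - density γ' x) ^ 2 / density γ' x ∂(stdGaussian E)

/-- The bound `inv_density_le` replaces the denominator by tilts towards the reflected atoms of
`γ'`, which is the case `s = -1` of the tilting inequality. -/
theorem chiSq_le {k : ℕ} {R : ℝ} (hR : 0 ≤ R) {γ γ' : Atoms k E}
    (h : IsMixing R γ) (h' : IsMixing R γ') :
    Integrable (fun x => (density γ x - density γ' x) ^ 2 / density γ' x) (stdGaussian E) ∧
    chiSq γ γ' ≤ chiConst R (2 * k) * sqDist γ γ' := by
  have hint : ∀ j ∈ Finset.univ, Integrable (fun x => γ'.1 j *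
      ((density γ x - density γ' x) ^ 2 * shiftDensity ((-1 : ℝ) • γ'.2 j) x)) (stdGaussian E) :=
    fun j _ => (integrable_sq_density_sub_mul _ _ _).const_mul _
  have hle : ∀ x, (density γ x - density γ' x) ^ 2 / density γ' x ≤ Real.exp (R ^ 2) * ∑ j, γ'.1 j *
      ((density γ x - density γ' x) ^ 2 * shiftDensity ((-1 : ℝ) • γ'.2 j) x) := by
    intro x
    rw [div_eq_mul_inv]
    refine (mul_le_mul_of_nonneg_left (inv_density_le h' x) (sq_nonneg _)).trans_eq ?_
    rw [mul_left_comm, Finset.mul_sum]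
    congr 1
    exact Finset.sum_congr rfl fun j _ => by ring
  have hI := (integrable_finsetSum _ hint).const_mul (Real.exp (R ^ 2))
  have hi : Integrable (fun x => (density γ x - density γ' x) ^ 2 / density γ' x)
      (stdGaussian E) := by
    refine hI.mono' ?_ (ae_of_all _ fun x => ?_)
    · exact ((((measurable_density γ).sub (measurable_density γ')).pow_const 2).div
        (measurable_density γ')).aestronglyMeasurable
    · rw [Real.norm_eq_abs, abs_of_nonneg (div_nonneg (sq_nonneg _) (density_pos h' x).le)]
      exact hle x
  refine ⟨hi, (integral_mono hi hI hle).trans ?_⟩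
  rw [integral_const_mul, integral_finsetSum _ hint, chiConst, mul_assoc]
  refine mul_le_mul_of_nonneg_left ?_ (Real.exp_pos _).le
  calc _ ≤ ∑ j, γ'.1 j * (tiltConst R (2 * k) * sqDist γ γ') := by
        refine Finset.sum_le_sum fun j _ => ?_
        rw [integral_const_mul]
        refine mul_le_mul_of_nonneg_left ?_ (h'.2.1 j)
        simpa [diffAtom] using
          integral_sq_density_sub_mul_le hR h h' (Sum.inr j) (s := -1) (by simp)
    _ = _ := by rw [← Finset.sum_mul, h'.2.2, one_mul]

theorem sq_sqrt_sub_le_div {a b : ℝ} (ha : 0 ≤ a) (hb : 0 < b) :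
    (√a - √b) ^ 2 ≤ (a - b) ^ 2 / b := by
  rw [le_div_iff₀ hb]
  have e1 : a - b = (√a - √b) * (√a + √b) := by
    nlinarith [Real.sq_sqrt ha, Real.sq_sqrt hb.le]
  rw [e1, mul_pow]
  refine mul_le_mul_of_nonneg_left ?_ (sq_nonneg _)
  nlinarith [Real.sq_sqrt ha, Real.sq_sqrt hb.le, Real.sqrt_nonneg a, Real.sqrt_nonneg b,
    mul_nonneg (Real.sqrt_nonneg a) (Real.sqrt_nonneg b)]

theorem sqHell_le_chiSq {k : ℕ} {R : ℝ} (hR : 0 ≤ R) {γ γ' : Atoms k E}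
    (h : IsMixing R γ) (h' : IsMixing R γ') : sqHell γ γ' ≤ chiSq γ γ' :=
  integral_mono (integrable_sq_sqrt_sub h h') (chiSq_le hR h h').1
    fun x => sq_sqrt_sub_le_div (density_pos h x).le (density_pos h' x)

/-- The expected square root likelihood ratio under a distribution close to the denominator. -/
theorem integral_sqrt_ratio_le {k : ℕ} {R : ℝ} (hR : 0 ≤ R) {γ γ₀ γ₁ : Atoms k E}
    (h : IsMixing R γ) (h₀ : IsMixing R γ₀) (h₁ : IsMixing R γ₁) :
    Integrable (fun x => density γ x * √(density γ₁ x / density γ₀ x)) (stdGaussian E) ∧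
    ∫ x, density γ x * √(density γ₁ x / density γ₀ x) ∂(stdGaussian E)
      ≤ 1 + chiSq γ γ₀ - sqHell γ₁ γ₀ / 4 := by
  obtain ⟨ic, -⟩ := chiSq_le hR h h₀
  have ih := integrable_sq_sqrt_sub h₁ h₀
  have i1 := integrable_density γ
  have i2 := integrable_density γ₁
  have i3 := integrable_density γ₀
  have key : ∀ x, density γ x * √(density γ₁ x / density γ₀ x)
      ≤ density γ x + (density γ₁ x - density γ₀ x) / 2
        + ((density γ x - density γ₀ x) ^ 2 / density γ₀ x
          - (√(density γ₁ x) - √(density γ₀ x)) ^ 2 / 4) := by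
    intro x
    have ha := (density_pos h x).le
    have hb := (density_pos h₁ x).le
    have hc := density_pos h₀ x
    set a := density γ x
    set b := density γ₁ x
    set c := density γ₀ x
    rw [Real.sqrt_div hb]
    have hs : 0 < √c := Real.sqrt_pos.2 hc
    have sb := Real.sq_sqrt hb
    have sc := Real.sq_sqrt hc.le
    set p := √b
    set q := √c
    rw [← sb, ← sc]
    have e : a + (p ^ 2 - q ^ 2) / 2 + ((a - q ^ 2) ^ 2 / q ^ 2 - (p - q) ^ 2 / 4) - a * (p / q)
        = ((a - q ^ 2) / q - (p - q) / 2) ^ 2 := by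
      field_simp
      ring
    nlinarith [sq_nonneg ((a - q ^ 2) / q - (p - q) / 2)]
  have hI : Integrable (fun x => density γ x + (density γ₁ x - density γ₀ x) / 2
        + ((density γ x - density γ₀ x) ^ 2 / density γ₀ x
          - (√(density γ₁ x) - √(density γ₀ x)) ^ 2 / 4)) (stdGaussian E) :=
    (i1.add ((i2.sub i3).div_const 2)).add (ic.sub (ih.div_const 4))
  have hi : Integrable (fun x => density γ x * √(density γ₁ x / density γ₀ x)) (stdGaussian E) := by
    refine hI.mono' ?_ (ae_of_all _ fun x => ?_)
    · exact ((measurable_density γ).mul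
        ((measurable_density γ₁).div (measurable_density γ₀)).sqrt).aestronglyMeasurable
    · rw [Real.norm_eq_abs, abs_of_nonneg (mul_nonneg (density_pos h x).le (Real.sqrt_nonneg _))]
      exact key x
  refine ⟨hi, (integral_mono hi hI key).trans_eq ?_⟩
  have j1 : Integrable (fun x => density γ x + (density γ₁ x - density γ₀ x) / 2) (stdGaussian E) :=
    i1.add ((i2.sub i3).div_const 2)
  have j2 : Integrable (fun x => (density γ x - density γ₀ x) ^ 2 / density γ₀ x
          - (√(density γ₁ x) - √(density γ₀ x)) ^ 2 / 4) (stdGaussian E) := ic.sub (ih.div_const 4)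
  have j3 : Integrable (fun x => (density γ₁ x - density γ₀ x) / 2) (stdGaussian E) :=
    (i2.sub i3).div_const 2
  rw [integral_add j1 j2, integral_add i1 j3, integral_sub ic (ih.div_const 4), integral_div,
    integral_div, integral_sub i2 i3, integral_density h, integral_density h₀, integral_density h₁]
  simp only [sub_self, zero_div, add_zero, chiSq, sqHell]
  ring

end Gaussian

/-! ### Mixture laws, their Hellinger distance, and likelihood ratios -/

/-- The Hellinger distance computed from densities with respect to any dominating measure. -/
theorem hellinger_withDensity {Ω : Type*} [MeasurableSpace Ω] {ν : Measure Ω} [SigmaFinite ν]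
    {p q : Ω → ℝ} (hp : Measurable p) (hq : Measurable q) (hp0 : ∀ x, 0 < p x)
    (hq0 : ∀ x, 0 < q x) (hpi : Integrable p ν) (hqi : Integrable q ν) :
    hellinger (ν.withDensity fun x => ENNReal.ofReal (p x))
      (ν.withDensity fun x => ENNReal.ofReal (q x)) = √(∫ x, (√(p x) - √(q x)) ^ 2 ∂ν) := by
  set P := ν.withDensity fun x => ENNReal.ofReal (p x) with hP
  set Q := ν.withDensity fun x => ENNReal.ofReal (q x) with hQ
  have : IsFiniteMeasure P := isFiniteMeasure_withDensity_ofReal hpi.2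
  have : IsFiniteMeasure Q := isFiniteMeasure_withDensity_ofReal hqi.2
  have hsum : P + Q = ν.withDensity fun x => ENNReal.ofReal (p x + q x) := by
    rw [hP, hQ, ← withDensity_add_left hp.ennreal_ofReal]
    congr 1
    ext x
    simp [ENNReal.ofReal_add (hp0 x).le (hq0 x).le]
  have hpq : Measurable fun x => p x + q x := hp.add hq
  have hfd : ∀ f : Ω → ℝ, Measurable f → Measurable fun x => f x / (p x + q x) :=
    fun f hf => hf.div hpq
  have hd : ∀ f : Ω → ℝ, Measurable f → (∀ x, 0 < f x) →
      (ν.withDensity fun x => ENNReal.ofReal (f x))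
        = (P + Q).withDensity fun x => ENNReal.ofReal (f x / (p x + q x)) := by
    intro f hf hf0
    rw [hsum, ← withDensity_mul _ hpq.ennreal_ofReal (hfd f hf).ennreal_ofReal]
    congr 1
    ext x
    have h0 : 0 < p x + q x := add_pos (hp0 x) (hq0 x)
    rw [Pi.mul_apply, ← ENNReal.ofReal_mul h0.le]
    congr 1
    field_simp
  have hr : ∀ f : Ω → ℝ, Measurable f → (∀ x, 0 < f x) →
      (ν.withDensity fun x => ENNReal.ofReal (f x)).rnDeriv (P + Q)
        =ᵐ[P + Q] fun x => ENNReal.ofReal (f x / (p x + q x)) := by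
    intro f hf hf0
    rw [hd f hf hf0]
    exact Measure.rnDeriv_withDensity _ (hfd f hf).ennreal_ofReal
  unfold hellinger
  congr 1
  have hae : (fun x => (√((P.rnDeriv (P + Q) x).toReal) - √((Q.rnDeriv (P + Q) x).toReal)) ^ 2)
      =ᵐ[P + Q] fun x => (√(p x / (p x + q x)) - √(q x / (p x + q x))) ^ 2 := by
    filter_upwards [hr p hp hp0, hr q hq hq0] with x h1 h2
    have h0 : 0 < p x + q x := add_pos (hp0 x) (hq0 x)
    rw [h1, h2, ENNReal.toReal_ofReal (div_pos (hp0 x) h0).le,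
      ENNReal.toReal_ofReal (div_pos (hq0 x) h0).le]
  rw [integral_congr_ae hae, hsum, integral_withDensity_eq_integral_toReal_smul
    hpq.ennreal_ofReal (ae_of_all _ fun _ => ENNReal.ofReal_lt_top)]
  refine integral_congr_ae (ae_of_all _ fun x => ?_)
  have h0 : 0 < p x + q x := add_pos (hp0 x) (hq0 x)
  simp only
  rw [ENNReal.toReal_ofReal h0.le, Real.sqrt_div (hp0 x).le, Real.sqrt_div (hq0 x).le, ← sub_div,
    div_pow, Real.sq_sqrt h0.le, smul_eq_mul, mul_div_cancel₀ _ h0.ne']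

section Law

variable {E : Type*} [NormedAddCommGroup E] [InnerProductSpace ℝ E] [FiniteDimensional ℝ E]
  [MeasurableSpace E] [BorelSpace E]

/-- The Gaussian mixture with the given weights and centers. -/
def law {k : ℕ} (γ : Atoms k E) : Measure E :=
  (stdGaussian E).withDensity fun x => ENNReal.ofReal (density γ x)

theorem isProbabilityMeasure_law {k : ℕ} {R : ℝ} {γ : Atoms k E} (h : IsMixing R γ) :
    IsProbabilityMeasure (law γ) := by
  refine ⟨?_⟩
  rw [law, withDensity_apply _ MeasurableSet.univ, Measure.restrict_univ,
    ← ofReal_integral_eq_lintegral_ofReal (integrable_density γ)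
      (ae_of_all _ fun x => (density_pos h x).le), integral_density h, ENNReal.ofReal_one]

theorem hellinger_law {k : ℕ} {R : ℝ} {γ γ' : Atoms k E} (h : IsMixing R γ)
    (h' : IsMixing R γ') : hellinger (law γ) (law γ') = √(sqHell γ γ') :=
  hellinger_withDensity (measurable_density γ) (measurable_density γ') (density_pos h)
    (density_pos h') (integrable_density γ) (integrable_density γ')

theorem sqHell_comm {k : ℕ} (γ γ' : Atoms k E) : sqHell γ γ' = sqHell γ' γ := by
  unfold sqHell
  refine integral_congr_ae (ae_of_all _ fun x => ?_)
  simp only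
  ring

theorem sqDist_comm {k : ℕ} (γ γ' : Atoms k E) : sqDist γ γ' = sqDist γ' γ := by
  rw [← integral_sq_density_sub, ← integral_sq_density_sub]
  refine integral_congr_ae (ae_of_all _ fun x => ?_)
  simp only
  ring

theorem sqDist_self {k : ℕ} (γ : Atoms k E) : sqDist γ γ = 0 := by
  rw [← integral_sq_density_sub]
  simp

/-- Markov's inequality for the square root of the likelihood ratio, whose expectation factorizes
over the sample, followed by `1 + x ≤ exp x`. The sampling law may differ from both competitors, as
the truth need not lie in the net. -/
theorem measure_likelihood_le {k n : ℕ} {R : ℝ} (hR : 0 ≤ R) {γ γ₀ γ₁ : Atoms k E}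
    (h : IsMixing R γ) (h₀ : IsMixing R γ₀) (h₁ : IsMixing R γ₁) :
    Measure.pi (fun _ : Fin n => law γ)
        {x | ∏ i, density γ₀ (x i) ≤ ∏ i, density γ₁ (x i)}
      ≤ ENNReal.ofReal (Real.exp (n * (chiSq γ γ₀ - sqHell γ₁ γ₀ / 4))) := by
  have := isProbabilityMeasure_law h
  obtain ⟨hi, hle⟩ := integral_sqrt_ratio_le hR h h₀ h₁
  set g : E → ℝ := fun x => √(density γ₁ x / density γ₀ x) with hg
  have hgm : Measurable g := ((measurable_density γ₁).div (measurable_density γ₀)).sqrt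
  have hgi : Integrable g (law γ) := by
    rw [law, integrable_withDensity_iff_integrable_smul' (measurable_density γ).ennreal_ofReal
      (ae_of_all _ fun _ => ENNReal.ofReal_lt_top)]
    simpa [ENNReal.toReal_ofReal (density_pos h _).le] using hi
  have hgint : ∫ x, g x ∂(law γ) = ∫ x, density γ x * g x ∂(stdGaussian E) := by
    rw [law, integral_withDensity_eq_integral_toReal_smul (measurable_density γ).ennreal_ofReal
      (ae_of_all _ fun _ => ENNReal.ofReal_lt_top)]
    simp [ENNReal.toReal_ofReal (density_pos h _).le]
  have hsub : {x : Fin n → E | ∏ i, density γ₀ (x i) ≤ ∏ i, density γ₁ (x i)}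
      ⊆ {x | 1 ≤ ENNReal.ofReal (∏ i, g (x i))} := by
    intro x hx
    simp only [Set.mem_ofPred_eq] at hx ⊢
    rw [← ENNReal.ofReal_one]
    refine ENNReal.ofReal_le_ofReal ?_
    have h0 : 0 < ∏ i, density γ₀ (x i) := Finset.prod_pos fun i _ => density_pos h₀ _
    rw [← Real.sqrt_prod _ fun i _ => (div_pos (density_pos h₁ _) (density_pos h₀ _)).le,
      Finset.prod_div_distrib]
    exact Real.one_le_sqrt.2 ((one_le_div h0).2 hx)
  have hprod : Integrable (fun x : Fin n → E => ∏ i, g (x i)) (Measure.pi fun _ => law γ) :=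
    Integrable.fintype_prod fun _ => hgi
  calc _ ≤ Measure.pi (fun _ : Fin n => law γ) {x | 1 ≤ ENNReal.ofReal (∏ i, g (x i))} :=
        measure_mono hsub
    _ ≤ ∫⁻ x, ENNReal.ofReal (∏ i, g (x i)) ∂(Measure.pi fun _ : Fin n => law γ) := by
        have := mul_meas_ge_le_lintegral (μ := Measure.pi fun _ : Fin n => law γ)
          (f := fun x => ENNReal.ofReal (∏ i, g (x i)))
          (Finset.measurable_prod _ fun i _ => hgm.comp (measurable_pi_apply i)).ennreal_ofReal 1
        simpa using this
    _ = ENNReal.ofReal ((∫ x, density γ x * g x ∂(stdGaussian E)) ^ n) := by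
        rw [← ofReal_integral_eq_lintegral_ofReal hprod
          (ae_of_all _ fun x => Finset.prod_nonneg fun i _ => Real.sqrt_nonneg _),
          integral_fintype_prod_eq_pow, hgint, Fintype.card_fin]
    _ ≤ _ := by
        refine ENNReal.ofReal_le_ofReal ?_
        rw [Real.exp_nat_mul]
        refine pow_le_pow_left₀ (integral_nonneg fun x =>
          mul_nonneg (density_pos h x).le (Real.sqrt_nonneg _)) ?_ n
        have := Real.add_one_le_exp (chiSq γ γ₀ - sqHell γ₁ γ₀ / 4)
        linarith

end Law

/-! ### Measurable selection and sums over shells -/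

/-- A measurable choice of a maximizer among finitely many measurable functions. -/
theorem exists_measurable_argmax {Ω β : Type*} [MeasurableSpace Ω] {S : Finset β}
    (hS : S.Nonempty) {f : β → Ω → ℝ} (hf : ∀ b, Measurable (f b)) :
    ∃ sel : Ω → β, (∀ x, sel x ∈ S) ∧ (∀ x, ∀ b ∈ S, f b x ≤ f (sel x) x) ∧
      ∀ b, MeasurableSet {x | sel x = b} := by
  classical
  induction hS using Finset.Nonempty.cons_induction with
  | singleton a => exact ⟨fun _ => a, by simp, by simp, fun b => by simp⟩
  | cons a S ha hS ih =>
    obtain ⟨sel, h1, h2, h3⟩ := ih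
    let B : Set Ω := {x | ∀ b ∈ S, f b x ≤ f a x}
    have hB : MeasurableSet B := by
      have : B = ⋂ b ∈ S, {x | f b x ≤ f a x} := by ext; simp [B]
      rw [this]
      exact Finset.measurableSet_biInter _ fun b _ => measurableSet_le (hf b) (hf a)
    refine ⟨fun x => if x ∈ B then a else sel x, fun x => ?_, fun x b hb => ?_, fun b => ?_⟩
    · by_cases hx : x ∈ B
      · simp [hx]
      · simp [hx, h1 x]
    · by_cases hx : x ∈ B
      · simp only [hx, if_true]
        rcases Finset.mem_cons.1 hb with rfl | hb
        · exact le_rfl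
        · exact hx b hb
      · simp only [hx, if_false]
        rcases Finset.mem_cons.1 hb with rfl | hb
        · obtain ⟨c, hc, hlt⟩ : ∃ c ∈ S, f b x < f c x := by simpa [B] using hx
          exact hlt.le.trans (h2 x c hc)
        · exact h2 x b hb
    · have : {x | (if x ∈ B then a else sel x) = b}
          = (B ∩ {_x | a = b}) ∪ (Bᶜ ∩ {x | sel x = b}) := by
        ext x
        by_cases hx : x ∈ B <;> simp [hx]
      rw [this]
      exact (hB.inter (MeasurableSet.const _)).union (hB.compl.inter (h3 b))

theorem measurable_comp_of_finite_range {Ω β α : Type*} [MeasurableSpace Ω] [MeasurableSpace α]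
    {S : Finset β} {sel : Ω → β} (h1 : ∀ x, sel x ∈ S) (h2 : ∀ b, MeasurableSet {x | sel x = b})
    (g : β → α) : Measurable fun x => g (sel x) := by
  classical
  intro T _
  have : (fun x => g (sel x)) ⁻¹' T = ⋃ b ∈ S.filter fun b => g b ∈ T, {x | sel x = b} := by
    ext x
    simp only [Set.mem_preimage, Set.mem_iUnion, Finset.mem_filter, Set.mem_ofPred_eq]
    constructor
    · intro h
      exact ⟨sel x, ⟨h1 x, h⟩, rfl⟩
    · rintro ⟨b, ⟨-, hb⟩, rfl⟩
      exact hb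
  rw [this]
  exact Finset.measurableSet_biUnion _ fun b _ => h2 b

theorem sum_inv_sq_le (M : ℕ) : ∑ i ∈ Finset.range M, 1 / ((i : ℝ) + 1) ^ 2 ≤ 2 := by
  -- The stronger bound is one that telescopes under induction.
  have : ∑ i ∈ Finset.range M, 1 / ((i : ℝ) + 1) ^ 2 ≤ 2 - 2 / ((M : ℝ) + 1) := by
    induction M with
    | zero => simp
    | succ M ih =>
      rw [Finset.sum_range_succ]
      have : 1 / ((M : ℝ) + 1) ^ 2 ≤ 2 / ((M : ℝ) + 1) - 2 / (((M + 1 : ℕ) : ℝ) + 1) := by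
        push_cast
        rw [div_sub_div _ _ (by positivity) (by positivity), div_le_div_iff₀ (by positivity)
          (by positivity)]
        have : (0 : ℝ) ≤ M := Nat.cast_nonneg M
        nlinarith [mul_nonneg this this, mul_nonneg (mul_nonneg this this) this]
      linarith
  have h0 : 0 ≤ 2 / ((M : ℝ) + 1) := by positivity
  linarith

/-- A finite set with polynomially growing shells has a bounded sum of inverse powers. -/
theorem sum_inv_pow_le_of_card_le {β : Type*} (S : Finset β) {ρ : β → ℝ} (hρ : ∀ b, 0 ≤ ρ b)
    {J : ℝ} (hJ : 0 ≤ J) {D : ℕ}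
    (hcard : ∀ r : ℝ, 1 ≤ r → ∀ T ⊆ S, (∀ b ∈ T, ρ b ≤ r) → (T.card : ℝ) ≤ (J * r) ^ D) :
    ∑ b ∈ S, 1 / (1 + ρ b) ^ (D + 2) ≤ 2 * J ^ D := by
  classical
  obtain ⟨M, hM⟩ : ∃ M : ℕ, ∀ b ∈ S, ⌊ρ b⌋₊ < M := by
    refine ⟨S.sup (fun b => ⌊ρ b⌋₊) + 1, fun b hb => Nat.lt_succ_of_le ?_⟩
    exact Finset.le_sup (f := fun b => ⌊ρ b⌋₊) hb
  rw [← Finset.sum_fiberwise_of_maps_to (t := Finset.range M) (g := fun b => ⌊ρ b⌋₊)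
    fun b hb => Finset.mem_range.2 (hM b hb)]
  -- The shell `⌊ρ b⌋₊ = i` has at most `(J * (i + 1)) ^ D` points; the two surplus powers in the
  -- exponent `D + 2` leave a summable factor.
  have hshell : ∀ i ∈ Finset.range M, ∑ b ∈ S with ⌊ρ b⌋₊ = i, 1 / (1 + ρ b) ^ (D + 2)
      ≤ J ^ D * (1 / ((i : ℝ) + 1) ^ 2) := by
    intro i _
    have hpos : (0 : ℝ) < (i : ℝ) + 1 := by positivity
    have h1 : ∀ b ∈ S.filter (fun b => ⌊ρ b⌋₊ = i),
        1 / (1 + ρ b) ^ (D + 2) ≤ 1 / ((i : ℝ) + 1) ^ (D + 2) := by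
      intro b hb
      have h2 : (i : ℝ) ≤ ρ b := by
        rw [← (Finset.mem_filter.1 hb).2]
        exact Nat.floor_le (hρ b)
      refine one_div_le_one_div_of_le (by positivity) (pow_le_pow_left₀ hpos.le (by linarith) _)
    refine (Finset.sum_le_sum h1).trans ?_
    rw [Finset.sum_const, nsmul_eq_mul]
    have h3 := hcard ((i : ℝ) + 1) (by linarith [(Nat.cast_nonneg i : (0 : ℝ) ≤ i)])
      (S.filter fun b => ⌊ρ b⌋₊ = i) (Finset.filter_subset _ _) fun b hb => by
        rw [← (Finset.mem_filter.1 hb).2]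
        exact (Nat.lt_floor_add_one _).le
    calc _ ≤ (J * ((i : ℝ) + 1)) ^ D * (1 / ((i : ℝ) + 1) ^ (D + 2)) := by gcongr
      _ = _ := by
          rw [mul_pow, pow_add]
          field_simp
  refine (Finset.sum_le_sum hshell).trans ?_
  rw [← Finset.mul_sum]
  have := sum_inv_sq_le M
  have h3 : 0 ≤ J ^ D := pow_nonneg hJ D
  calc _ ≤ J ^ D * 2 := by gcongr
    _ = _ := by ring

/-! ### Maximal separated sets and the likelihood maximizer -/

section Net

variable {E : Type*} [NormedAddCommGroup E] [InnerProductSpace ℝ E] [FiniteDimensional ℝ E]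
  [MeasurableSpace E] [BorelSpace E]

/-- A set of mixing distributions that is separated in the exponential energy. -/
def IsSeparatedMixing (R : ℝ) {k : ℕ} (ε : ℝ) (S : Finset (Atoms k E)) : Prop :=
  (∀ γ ∈ S, IsMixing R γ) ∧ ∀ γ ∈ S, ∀ γ' ∈ S, γ ≠ γ' → ε ^ 2 ≤ sqDist γ γ'

/-- A separated set of maximal cardinality is a net. Cardinalities are bounded because the class has
finite energy diameter: squared Hellinger distances are at most `2`, hence energies at most `8 *
tiltConst R (2 * k)`, and the packing bound applies with this radius. -/
theorem exists_net {k : ℕ} {R : ℝ} (hR : 0 ≤ R) (hk : 1 ≤ k) {ε : ℝ} (hε : 0 < ε) :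
    ∃ S : Finset (Atoms k E), S.Nonempty ∧ IsSeparatedMixing R ε S ∧
      ∀ γ : Atoms k E, IsMixing R γ → ∃ γ₀ ∈ S, sqDist γ γ₀ ≤ ε ^ 2 := by
  classical
  let γ₁ : Atoms k E := (fun j => if j = ⟨0, hk⟩ then 1 else 0, fun _ => 0)
  have hγ₁ : IsMixing R γ₁ := by
    refine ⟨fun j => by simpa [γ₁] using hR, fun j => ?_, by simp [γ₁]⟩
    simp only [γ₁]
    split_ifs <;> norm_num
  set r := max ε (√(8 * tiltConst R (2 * k)))
  have hK := tiltConst_pos R (2 * k)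
  have hbound : ∀ S : Finset (Atoms k E), IsSeparatedMixing R ε S →
      (S.card : ℝ) ≤ (packConst R (2 * k) * (r / ε)) ^
        (2 * k * Module.finrank ℝ E + (2 * k) ^ (2 * k)) := by
    intro S hS
    refine card_packing_le hR (γ₀ := γ₁) S (fun γ hγ => (hS.1 γ hγ).1) hε (le_max_left _ _)
      (fun γ hγ => ?_) hS.2
    calc sqDist γ γ₁ ≤ 4 * tiltConst R (2 * k) * sqHell γ γ₁ :=
          sqDist_le_sqHell hR (hS.1 γ hγ) hγ₁
      _ ≤ 4 * tiltConst R (2 * k) * 2 := by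
          have := sqHell_le_two (hS.1 γ hγ) hγ₁
          gcongr
      _ = (√(8 * tiltConst R (2 * k))) ^ 2 := by
          rw [Real.sq_sqrt (by positivity)]
          ring
      _ ≤ r ^ 2 := pow_le_pow_left₀ (Real.sqrt_nonneg _) (le_max_right _ _) 2
  let C : Set ℕ := {m | ∃ S : Finset (Atoms k E), IsSeparatedMixing R ε S ∧ S.card = m}
  have hC : C.Nonempty := ⟨0, ∅, by simp [IsSeparatedMixing]⟩
  have hCb : BddAbove C := by
    refine ⟨⌈(packConst R (2 * k) * (r / ε)) ^
        (2 * k * Module.finrank ℝ E + (2 * k) ^ (2 * k))⌉₊, ?_⟩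
    rintro m ⟨S, hS, rfl⟩
    exact_mod_cast (hbound S hS).trans (Nat.le_ceil _)
  obtain ⟨S, hS, hcard⟩ := Nat.sSup_mem hC hCb
  have hcover : ∀ γ : Atoms k E, IsMixing R γ → ∃ γ₀ ∈ S, sqDist γ γ₀ ≤ ε ^ 2 := by
    intro γ hγ
    by_contra! hfar
    have hnot : γ ∉ S := by
      intro hmem
      have := hfar γ hmem
      rw [sqDist_self] at this
      nlinarith [sq_nonneg ε]
    have hins : IsSeparatedMixing R ε (insert γ S) := by
      refine ⟨fun γ' h' => ?_, fun γ' h' γ'' h'' hne => ?_⟩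
      · rcases Finset.mem_insert.1 h' with rfl | h'
        · exact hγ
        · exact hS.1 γ' h'
      · rcases Finset.mem_insert.1 h' with rfl | h1
        · rcases Finset.mem_insert.1 h'' with rfl | h2
          · exact absurd rfl hne
          · exact (hfar _ h2).le
        · rcases Finset.mem_insert.1 h'' with rfl | h2
          · rw [sqDist_comm]
            exact (hfar _ h1).le
          · exact hS.2 γ' h1 γ'' h2 hne
    have hle := le_csSup hCb ⟨insert γ S, hins, rfl⟩
    rw [Finset.card_insert_of_notMem hnot] at hle
    omega
  obtain ⟨γ₀, h₀, -⟩ := hcover γ₁ hγ₁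
  exact ⟨S, ⟨γ₀, h₀⟩, hS, hcover⟩

theorem one_le_packConst {R : ℝ} {N : ℕ} (hN : 1 ≤ N) : 1 ≤ packConst R N := by
  have h0 : 1 ≤ (N : ℝ) ^ N := one_le_pow₀ (by exact_mod_cast hN)
  have h1 : 1 ≤ √(N.factorial : ℝ) :=
    Real.one_le_sqrt.2 (by exact_mod_cast Nat.succ_le_of_lt N.factorial_pos)
  have h2 : 1 ≤ Real.exp (N * (1 + 2 * R) ^ 2 / 2) := Real.one_le_exp (by positivity)
  have := one_le_mul_of_one_le_of_one_le (one_le_mul_of_one_le_of_one_le h0 h1) h2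
  unfold packConst
  linarith

/-- Apply `x ≤ exp (x² / 2)` to `x = (1 + y) * exp (-b)`. Polynomial growth is absorbed by a
Gaussian whose exponent is reduced by `exp (-2 * b)`, at a price only linear in `b` in the exponent.
This is how comparison constants exponential in `k²` cost only a factor `k²`. -/
theorem one_add_pow_le (b y : ℝ) (hy : 0 ≤ y) (m : ℕ) :
    (1 + y) ^ m ≤ Real.exp ((b + 1) * m) * Real.exp (m * Real.exp (-2 * b) * y ^ 2) *
      Real.exp (m * Real.exp (-2 * b)) := by
  have h1 : (1 + y) * Real.exp (-b) ≤ Real.exp (((1 + y) * Real.exp (-b)) ^ 2 / 2) := by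
    have := Real.add_one_le_exp (((1 + y) * Real.exp (-b)) ^ 2 / 2)
    nlinarith [sq_nonneg ((1 + y) * Real.exp (-b) - 1)]
  have h2 : ((1 + y) * Real.exp (-b)) ^ 2 / 2 ≤ Real.exp (-2 * b) * y ^ 2 + Real.exp (-2 * b) := by
    have e : Real.exp (-b) ^ 2 = Real.exp (-2 * b) := by
      rw [← Real.exp_nat_mul]
      congr 1
      push_cast
      ring
    rw [mul_pow, e]
    nlinarith [mul_nonneg (Real.exp_pos (-2 * b)).le (sq_nonneg (1 - y))]
  have h3 : 1 + y ≤ Real.exp b * Real.exp (Real.exp (-2 * b) * y ^ 2 + Real.exp (-2 * b)) := by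
    calc 1 + y = Real.exp b * ((1 + y) * Real.exp (-b)) := by
          rw [Real.exp_neg]
          field_simp
      _ ≤ _ := by
          gcongr
          exact h1.trans (Real.exp_le_exp.2 h2)
  calc (1 + y) ^ m
      ≤ (Real.exp b * Real.exp (Real.exp (-2 * b) * y ^ 2 + Real.exp (-2 * b))) ^ m :=
        pow_le_pow_left₀ (by linarith) h3 m
    _ ≤ _ := by
        rw [← Real.exp_add, ← Real.exp_nat_mul, ← Real.exp_add, ← Real.exp_add]
        refine Real.exp_le_exp.2 ?_
        have : (0 : ℝ) ≤ m := Nat.cast_nonneg m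
        nlinarith

/-- The Gaussian-type sum over a separated set. -/
theorem sum_exp_neg_sqDist_le {k : ℕ} {R : ℝ} (hR : 0 ≤ R) (hk : 1 ≤ k) {ε : ℝ} (hε : 0 < ε)
    {S : Finset (Atoms k E)} (hS : IsSeparatedMixing R ε S) (γ₀ : Atoms k E) {m : ℕ}
    (hm : m = 2 * k * Module.finrank ℝ E + (2 * k) ^ (2 * k)) {b c : ℝ} (hb : 0 ≤ b)
    (hc : (m + 2 : ℕ) * Real.exp (-2 * b) ≤ c) :
    ∑ γ ∈ S, Real.exp (-(c * (sqDist γ γ₀ / ε ^ 2)))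
      ≤ 2 * packConst R (2 * k) ^ m * Real.exp ((b + 2) * (m + 2 : ℕ)) := by
  classical
  set ρ : Atoms k E → ℝ := fun γ => √(sqDist γ γ₀) / ε with hρ
  have hρ0 : ∀ γ, 0 ≤ ρ γ := fun γ => by positivity
  have hρ2 : ∀ γ, ρ γ ^ 2 = sqDist γ γ₀ / ε ^ 2 := fun γ => by
    rw [hρ, div_pow, Real.sq_sqrt (sqDist_nonneg _ _)]
  have hJ : 1 ≤ packConst R (2 * k) := one_le_packConst (by omega)
  have hsum := sum_inv_pow_le_of_card_le S hρ0 (zero_le_one.trans hJ) (D := m) (by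
    intro r hr T hT hTr
    have := card_packing_le hR (γ₀ := γ₀) T (fun γ hγ => (hS.1 γ (hT hγ)).1) hε
      (r := r * ε) (by nlinarith) (fun γ hγ => ?_)
      (fun γ hγ γ' hγ' hne => hS.2 γ (hT hγ) γ' (hT hγ') hne)
    · rwa [mul_div_cancel_right₀ _ hε.ne', ← hm] at this
    · have h1 := pow_le_pow_left₀ (hρ0 γ) (hTr γ hγ) 2
      rw [hρ2, div_le_iff₀ (by positivity)] at h1
      rwa [mul_pow])
  have hterm : ∀ γ ∈ S, Real.exp (-(c * (sqDist γ γ₀ / ε ^ 2)))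
      ≤ Real.exp ((b + 2) * (m + 2 : ℕ)) * (1 / (1 + ρ γ) ^ (m + 2)) := by
    intro γ _
    have h1 := one_add_pow_le b (ρ γ) (hρ0 γ) (m + 2)
    have h2 : Real.exp ((m + 2 : ℕ) * Real.exp (-2 * b) * ρ γ ^ 2) ≤ Real.exp (c * ρ γ ^ 2) :=
      Real.exp_le_exp.2 (mul_le_mul_of_nonneg_right hc (sq_nonneg _))
    have h3 : Real.exp ((m + 2 : ℕ) * Real.exp (-2 * b)) ≤ Real.exp ((m + 2 : ℕ) * 1) := by
      refine Real.exp_le_exp.2 (mul_le_mul_of_nonneg_left ?_ (Nat.cast_nonneg _))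
      exact Real.exp_le_one_iff.2 (by linarith)
    have hpos : 0 < (1 + ρ γ) ^ (m + 2) := pow_pos (by linarith [hρ0 γ]) _
    rw [mul_one_div, le_div_iff₀ hpos, ← hρ2]
    calc Real.exp (-(c * ρ γ ^ 2)) * (1 + ρ γ) ^ (m + 2)
        ≤ Real.exp (-(c * ρ γ ^ 2)) * (Real.exp ((b + 1) * (m + 2 : ℕ)) *
            Real.exp (c * ρ γ ^ 2) * Real.exp ((m + 2 : ℕ) * 1)) := by
          refine mul_le_mul_of_nonneg_left (h1.trans ?_) (Real.exp_pos _).le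
          gcongr
      _ = Real.exp ((b + 2) * (m + 2 : ℕ)) := by
          rw [← Real.exp_add, ← Real.exp_add, ← Real.exp_add]
          congr 1
          ring
  refine (Finset.sum_le_sum hterm).trans ?_
  rw [← Finset.mul_sum, mul_comm]
  exact mul_le_mul_of_nonneg_right hsum (Real.exp_pos _).le

/-- The maximum likelihood estimator over a net concentrates around the true distribution. -/
theorem measure_sqHell_gt_le {k n : ℕ} {R : ℝ} (hR : 0 ≤ R) (hk : 1 ≤ k) (hn : 1 ≤ n) {ε : ℝ}
    (hε : 0 < ε) {S : Finset (Atoms k E)} (hS : IsSeparatedMixing R ε S)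
    {sel : (Fin n → E) → Atoms k E} (hsel : ∀ x, sel x ∈ S)
    (hmax : ∀ x, ∀ γ ∈ S, ∏ i, density γ (x i) ≤ ∏ i, density (sel x) (x i))
    {γ γ₀ : Atoms k E} (h : IsMixing R γ) (h₀ : γ₀ ∈ S) (hγ : sqDist γ γ₀ ≤ ε ^ 2) {m : ℕ}
    (hm : m = 2 * k * Module.finrank ℝ E + (2 * k) ^ (2 * k)) {b : ℝ} (hb : 0 ≤ b)
    (hc : (m + 2 : ℕ) * Real.exp (-2 * b) ≤ n * ε ^ 2 / (32 * tiltConst R (2 * k))) (t : ℝ) :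
    Measure.pi (fun _ : Fin n => law γ) {x | t < sqHell (sel x) γ₀}
      ≤ ENNReal.ofReal (Real.exp (n * (chiConst R (2 * k) * ε ^ 2) - n * t / 8) *
          (2 * packConst R (2 * k) ^ m * Real.exp ((b + 2) * (m + 2 : ℕ)))) := by
  classical
  have hK := tiltConst_pos R (2 * k)
  have hn0 : (0 : ℝ) < n := by exact_mod_cast hn
  have hchi : chiSq γ γ₀ ≤ chiConst R (2 * k) * ε ^ 2 := by
    refine (chiSq_le hR h (hS.1 γ₀ h₀)).2.trans ?_
    have : 0 < chiConst R (2 * k) := mul_pos (Real.exp_pos _) hK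
    gcongr
  set T := S.filter fun γ₁ => t < sqHell γ₁ γ₀ with hT
  have hsub : {x | t < sqHell (sel x) γ₀} ⊆ ⋃ γ₁ ∈ T,
      {x : Fin n → E | ∏ i, density γ₀ (x i) ≤ ∏ i, density γ₁ (x i)} := by
    intro x hx
    simp only [Set.mem_iUnion]
    exact ⟨sel x, Finset.mem_filter.2 ⟨hsel x, hx⟩, hmax x γ₀ h₀⟩
  -- The gain `sqHell γ₁ γ₀ / 4` is split in two: one half exceeds `t / 8` on `T` and gives the
  -- tail, the other is converted to energy and makes the union bound summable.
  have hterm : ∀ γ₁ ∈ T, Real.exp (n * (chiSq γ γ₀ - sqHell γ₁ γ₀ / 4))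
      ≤ Real.exp (n * (chiConst R (2 * k) * ε ^ 2) - n * t / 8) *
        Real.exp (-(n * ε ^ 2 / (32 * tiltConst R (2 * k)) * (sqDist γ₁ γ₀ / ε ^ 2))) := by
    intro γ₁ h₁
    obtain ⟨h1S, h1t⟩ := Finset.mem_filter.1 h₁
    rw [← Real.exp_add]
    refine Real.exp_le_exp.2 ?_
    have e1 : n * ε ^ 2 / (32 * tiltConst R (2 * k)) * (sqDist γ₁ γ₀ / ε ^ 2)
        = n * (sqDist γ₁ γ₀ / (32 * tiltConst R (2 * k))) := by
      field_simp
    have e2 : sqDist γ₁ γ₀ / (32 * tiltConst R (2 * k)) ≤ sqHell γ₁ γ₀ / 8 := by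
      rw [div_le_iff₀ (by positivity)]
      have := sqDist_le_sqHell hR (hS.1 γ₁ h1S) (hS.1 γ₀ h₀)
      linarith
    rw [e1]
    have e3 : (n : ℝ) * (chiSq γ γ₀ - sqHell γ₁ γ₀ / 4)
        ≤ n * (chiConst R (2 * k) * ε ^ 2 - t / 8 - sqDist γ₁ γ₀ / (32 * tiltConst R (2 * k))) := by
      refine mul_le_mul_of_nonneg_left ?_ hn0.le
      linarith
    linarith
  calc _ ≤ ∑ γ₁ ∈ T, Measure.pi (fun _ : Fin n => law γ)
        {x : Fin n → E | ∏ i, density γ₀ (x i) ≤ ∏ i, density γ₁ (x i)} :=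
        (measure_mono hsub).trans (measure_biUnion_finset_le _ _)
    _ ≤ ∑ γ₁ ∈ T, ENNReal.ofReal (Real.exp (n * (chiSq γ γ₀ - sqHell γ₁ γ₀ / 4))) :=
        Finset.sum_le_sum fun γ₁ h₁ =>
          measure_likelihood_le hR h (hS.1 γ₀ h₀) (hS.1 γ₁ (Finset.mem_filter.1 h₁).1)
    _ = ENNReal.ofReal (∑ γ₁ ∈ T, Real.exp (n * (chiSq γ γ₀ - sqHell γ₁ γ₀ / 4))) :=
        (ENNReal.ofReal_sum_of_nonneg fun _ _ => (Real.exp_pos _).le).symm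
    _ ≤ _ := by
        refine ENNReal.ofReal_le_ofReal ((Finset.sum_le_sum hterm).trans ?_)
        rw [← Finset.mul_sum]
        refine mul_le_mul_of_nonneg_left ?_ (Real.exp_pos _).le
        refine le_trans ?_ (sum_exp_neg_sqDist_le hR hk hε hS γ₀ hm hb hc)
        exact Finset.sum_le_sum_of_subset_of_nonneg (Finset.filter_subset _ _)
          fun _ _ _ => (Real.exp_pos _).le

end Net

/-! ### Growth of the constants in `k` -/

/-- The rate at which the logarithms of all constants grow in `k ^ 2`. -/
def logRate (R : ℝ) : ℝ := 10 + 2 * (1 + 2 * R) ^ 2 + 4 * (R * (1 + 2 * R)) + R ^ 2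

theorem factorial_le_exp (k : ℕ) : ((2 * k).factorial : ℝ) ≤ Real.exp (4 * (k : ℝ) ^ 2) ∧
    ((2 * k : ℕ) : ℝ) ^ (2 * k) ≤ Real.exp (4 * (k : ℝ) ^ 2) := by
  have h1 : ((2 * k : ℕ) : ℝ) ^ (2 * k) ≤ Real.exp (4 * (k : ℝ) ^ 2) := by
    have h2 : ((2 * k : ℕ) : ℝ) ≤ Real.exp ((2 * k : ℕ) : ℝ) := by
      linarith [Real.add_one_le_exp ((2 * k : ℕ) : ℝ)]
    calc ((2 * k : ℕ) : ℝ) ^ (2 * k) ≤ Real.exp ((2 * k : ℕ) : ℝ) ^ (2 * k) :=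
          pow_le_pow_left₀ (Nat.cast_nonneg _) h2 _
      _ = Real.exp (4 * (k : ℝ) ^ 2) := by
          rw [← Real.exp_nat_mul]
          congr 1
          push_cast
          ring
  refine ⟨le_trans ?_ h1, h1⟩
  exact_mod_cast Nat.factorial_le_pow (2 * k)

theorem tiltConst_le_exp {R : ℝ} (hR : 0 ≤ R) {k : ℕ} (hk : 1 ≤ k) :
    tiltConst R (2 * k) ≤ Real.exp (logRate R * (k : ℝ) ^ 2) ∧
      chiConst R (2 * k) ≤ Real.exp (logRate R * (k : ℝ) ^ 2) := by
  have hk1 : (1 : ℝ) ≤ k := by exact_mod_cast hk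
  have hk2 : (k : ℝ) ≤ (k : ℝ) ^ 2 := by nlinarith
  have hk3 : (1 : ℝ) ≤ (k : ℝ) ^ 2 := by nlinarith
  have hq : 0 ≤ (1 + 2 * R) ^ 2 := sq_nonneg _
  have hs : 0 ≤ R * (1 + 2 * R) := by positivity
  have h2 : chiConst R (2 * k) ≤ Real.exp (logRate R * (k : ℝ) ^ 2) := by
    unfold chiConst tiltConst
    calc _ ≤ Real.exp (R ^ 2) * (Real.exp ((2 * k : ℕ) * (1 + 2 * R) ^ 2
            + 2 * ((2 * k : ℕ) * (R * (1 + 2 * R)))) * Real.exp (4 * (k : ℝ) ^ 2)) := by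
          gcongr
          exact (factorial_le_exp k).1
      _ ≤ _ := by
          rw [← Real.exp_add, ← Real.exp_add]
          refine Real.exp_le_exp.2 ?_
          unfold logRate
          push_cast
          nlinarith [mul_le_mul_of_nonneg_left hk2 hq, mul_le_mul_of_nonneg_left hk2 hs,
            mul_le_mul_of_nonneg_left hk3 (sq_nonneg R)]
  refine ⟨le_trans ?_ h2, h2⟩
  have h0 := tiltConst_pos R (2 * k)
  have h1 : 1 ≤ Real.exp (R ^ 2) := Real.one_le_exp (sq_nonneg R)
  unfold chiConst
  nlinarith

theorem packConst_le_exp {R : ℝ} (hR : 0 ≤ R) {k : ℕ} (hk : 1 ≤ k) :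
    packConst R (2 * k) ≤ Real.exp (logRate R * (k : ℝ) ^ 2) := by
  have hk1 : (1 : ℝ) ≤ k := by exact_mod_cast hk
  have hk2 : (k : ℝ) ≤ (k : ℝ) ^ 2 := by nlinarith
  have hk3 : (1 : ℝ) ≤ (k : ℝ) ^ 2 := by nlinarith
  have hq : 0 ≤ (1 + 2 * R) ^ 2 := sq_nonneg _
  have hs : 0 ≤ R * (1 + 2 * R) := by positivity
  have h6 : (6 : ℝ) ≤ Real.exp 2 := by
    have e : Real.exp 2 = Real.exp 1 * Real.exp 1 := by rw [← Real.exp_add]; norm_num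
    rw [e]
    nlinarith [Real.exp_one_gt_d9]
  have hf : √((2 * k).factorial : ℝ) ≤ Real.exp (4 * (k : ℝ) ^ 2) := by
    refine le_trans ?_ (factorial_le_exp k).1
    have h1 : (1 : ℝ) ≤ (2 * k).factorial := by exact_mod_cast Nat.factorial_pos (2 * k)
    exact Real.sqrt_le_left (by linarith) |>.2 (by nlinarith)
  unfold packConst
  -- The factors `6`, `N ^ N` and `√N!` contribute `2 + 4 + 4`, the constant term of `logRate`.
  calc _ ≤ Real.exp 2 * (Real.exp (4 * (k : ℝ) ^ 2) * Real.exp (4 * (k : ℝ) ^ 2)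
          * Real.exp ((2 * k : ℕ) * (1 + 2 * R) ^ 2 / 2)) := by
        gcongr
        exact (factorial_le_exp k).2
    _ ≤ _ := by
        rw [← Real.exp_add, ← Real.exp_add, ← Real.exp_add]
        refine Real.exp_le_exp.2 ?_
        unfold logRate
        push_cast
        nlinarith [mul_le_mul_of_nonneg_left hk2 hq, mul_nonneg hs (sq_nonneg (k : ℝ)),
          mul_nonneg (sq_nonneg R) (sq_nonneg (k : ℝ)), mul_nonneg hq (sq_nonneg (k : ℝ))]

/-- The effective dimension of `k`-component mixtures. -/
def effDim (k d : ℕ) : ℝ := (k : ℝ) ^ 4 * d + (2 * k : ℝ) ^ (2 * k + 2)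

theorem one_le_effDim {k : ℕ} (hk : 1 ≤ k) (d : ℕ) : 1 ≤ effDim k d := by
  have hk1 : (1 : ℝ) ≤ k := by exact_mod_cast hk
  have h1 : (1 : ℝ) ≤ (2 * k : ℝ) ^ (2 * k + 2) := one_le_pow₀ (by linarith)
  have h2 : (0 : ℝ) ≤ (k : ℝ) ^ 4 * d := by positivity
  unfold effDim
  linarith

/-- The packing dimension times the logarithmic rate `k²` of the constants; this product is where
the form of `effDim` comes from. -/
theorem packDim_mul_le {k : ℕ} (hk : 1 ≤ k) (d : ℕ) :
    ((2 * k * d + (2 * k) ^ (2 * k) + 2 : ℕ) : ℝ) * (k : ℝ) ^ 2 ≤ 3 * effDim k d := by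
  have hk1 : (1 : ℝ) ≤ k := by exact_mod_cast hk
  have h1 : (1 : ℝ) ≤ (2 * k : ℝ) ^ (2 * k) := one_le_pow₀ (by linarith)
  have h2 : (k : ℝ) ^ 3 * d ≤ (k : ℝ) ^ 4 * d :=
    mul_le_mul_of_nonneg_right (pow_le_pow_right₀ hk1 (by norm_num)) (Nat.cast_nonneg _)
  have h3 : (0 : ℝ) ≤ (k : ℝ) ^ 4 * d := by positivity
  have h4 := mul_le_mul_of_nonneg_right h1 (sq_nonneg (k : ℝ))
  unfold effDim
  push_cast
  rw [pow_add (2 * k : ℝ)]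
  nlinarith [mul_nonneg (zero_le_one.trans h1) (sq_nonneg (k : ℝ))]

/-! ### The estimator and its exponential tail -/

section Estimator

variable {E : Type*} [NormedAddCommGroup E] [InnerProductSpace ℝ E] [FiniteDimensional ℝ E]
  [MeasurableSpace E] [BorelSpace E]

/-- The constant in the high-probability bound for the squared Hellinger loss. -/
def tailConst (R : ℝ) : ℝ := 192 * logRate R + 564

/-- The tail bound for the maximum likelihood estimator over a net, in closed form. -/
theorem exp_mul_packing_le {k m n : ℕ} {R : ℝ} (hR : 0 ≤ R) (hk : 1 ≤ k) (hn : 1 ≤ n) {d : ℕ}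
    (hm : m = 2 * k * d + (2 * k) ^ (2 * k)) {u L : ℝ} (hu : n * u = effDim k d) :
    Real.exp (n * u - n * (8 / n * (effDim k d * (6 * logRate R + 17) + L)) / 8) *
      (2 * packConst R (2 * k) ^ m *
        Real.exp ((logRate R * (k : ℝ) ^ 2 + 3 + 2) * (m + 2 : ℕ))) ≤ Real.exp (-L) := by
  have hk1 : (1 : ℝ) ≤ k := by exact_mod_cast hk
  have hk3 : (1 : ℝ) ≤ (k : ℝ) ^ 2 := by nlinarith
  have hn0 : (0 : ℝ) < n := by exact_mod_cast hn
  have hD := one_le_effDim hk d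
  have hA : 0 ≤ logRate R := by unfold logRate; positivity
  have hm3 : ((m + 2 : ℕ) : ℝ) * (k : ℝ) ^ 2 ≤ 3 * effDim k d := by
    rw [hm]
    exact packDim_mul_le hk d
  have hm0 : (0 : ℝ) ≤ ((m + 2 : ℕ) : ℝ) := Nat.cast_nonneg _
  have hm4 : ((m + 2 : ℕ) : ℝ) ≤ 3 * effDim k d := by nlinarith
  have hpow : packConst R (2 * k) ^ m ≤ Real.exp (logRate R * (3 * effDim k d)) := by
    calc packConst R (2 * k) ^ m ≤ Real.exp (logRate R * (k : ℝ) ^ 2) ^ m :=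
          pow_le_pow_left₀ (zero_le_one.trans (one_le_packConst (by omega)))
            (packConst_le_exp hR hk) m
      _ = Real.exp (logRate R * ((m : ℝ) * (k : ℝ) ^ 2)) := by
          rw [← Real.exp_nat_mul]
          congr 1
          ring
      _ ≤ _ := by
          refine Real.exp_le_exp.2 (mul_le_mul_of_nonneg_left (le_trans ?_ hm3) hA)
          push_cast
          nlinarith
  have h2 : (2 : ℝ) ≤ Real.exp 1 := by linarith [Real.exp_one_gt_d9]
  calc _ ≤ Real.exp (n * u - n * (8 / n * (effDim k d * (6 * logRate R + 17) + L)) / 8) *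
      (Real.exp 1 * Real.exp (logRate R * (3 * effDim k d)) *
        Real.exp ((logRate R * (k : ℝ) ^ 2 + 3 + 2) * (m + 2 : ℕ))) := by
        have : 0 ≤ packConst R (2 * k) ^ m :=
          pow_nonneg (zero_le_one.trans (one_le_packConst (by omega))) m
        gcongr
    _ ≤ _ := by
        rw [← Real.exp_add, ← Real.exp_add, ← Real.exp_add]
        refine Real.exp_le_exp.2 ?_
        -- The budget, with `A = logRate R`: approximation costs `effDim`, the factor `2` costs `1 ≤
        -- effDim`, the packing constant `3 * A * effDim`, and the Gaussian sum `(A * k² + 5) * (m +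
        -- 2) ≤ (3 * A + 15) * effDim`. The total is at most `(6 * A + 17) * effDim`, leaving `-L`.
        have e : n * (8 / n * (effDim k d * (6 * logRate R + 17) + L)) / 8
            = effDim k d * (6 * logRate R + 17) + L := by
          field_simp
        rw [e, hu]
        nlinarith [mul_le_mul_of_nonneg_left hm3 hA]

/-- A proper estimator with values in a finite net that satisfies the high-probability bound at
all confidence levels. -/
theorem exists_estimator {k n : ℕ} {R : ℝ} (hR : 0 ≤ R) (hk : 1 ≤ k) (hn : 1 ≤ n) {d : ℕ}
    (hd : Module.finrank ℝ E = d) :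
    ∃ (S : Finset (Atoms k E)) (sel : (Fin n → E) → Atoms k E), (∀ x, sel x ∈ S) ∧
      (∀ γ, MeasurableSet {x | sel x = γ}) ∧ (∀ x, IsMixing R (sel x)) ∧
      ∀ γ : Atoms k E, IsMixing R γ → ∀ δ : ℝ, 0 < δ → δ < 1 / 2 →
        Measure.pi (fun _ : Fin n => law γ)
          {x | tailConst R * (effDim k d / n * Real.log (1 / δ)) < sqHell (sel x) γ}
          ≤ ENNReal.ofReal δ := by
  have hn0 : (0 : ℝ) < n := by exact_mod_cast hn
  have hD := one_le_effDim hk d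
  have hK := tiltConst_pos R (2 * k)
  have hX : 0 < chiConst R (2 * k) := mul_pos (Real.exp_pos _) hK
  have hA : 0 ≤ logRate R := by unfold logRate; positivity
  have hk1 : (1 : ℝ) ≤ k := by exact_mod_cast hk
  have hk3 : (1 : ℝ) ≤ (k : ℝ) ^ 2 := by nlinarith
  -- The mesh makes the total chi-square cost `n * chiConst * ε²` of replacing the truth by a net
  -- point equal to `effDim`. It does not involve `δ`, so one estimator serves all confidence
  -- levels.
  set ε := √(effDim k d / (n * chiConst R (2 * k))) with hεdef
  have hε2 : ε ^ 2 = effDim k d / (n * chiConst R (2 * k)) := Real.sq_sqrt (by positivity)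
  have hε : 0 < ε := Real.sqrt_pos.2 (by positivity)
  obtain ⟨S, hSne, hS, hcover⟩ := exists_net (E := E) hR hk hε
  obtain ⟨sel, h1, h2, h3⟩ := exists_measurable_argmax hSne
    (f := fun (γ : Atoms k E) (x : Fin n → E) => ∏ i, density γ (x i))
    fun γ => Finset.measurable_prod _ fun i _ => (measurable_density γ).comp (measurable_pi_apply i)
  refine ⟨S, sel, h1, h3, fun x => hS.1 _ (h1 x), fun γ hγ δ hδ hδ2 => ?_⟩
  obtain ⟨γ₀, h₀, hclose⟩ := hcover γ hγ
  obtain ⟨m, hm⟩ : ∃ m, m = 2 * k * Module.finrank ℝ E + (2 * k) ^ (2 * k) := ⟨_, rfl⟩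
  have hmd : m = 2 * k * d + (2 * k) ^ (2 * k) := by rw [hm, hd]
  set L := Real.log (1 / δ) with hL
  have hL2 : 1 / 2 ≤ L := by
    have h4 : Real.log 2 ≤ L :=
      Real.log_le_log (by norm_num) (by rw [le_div_iff₀ hδ]; linarith)
    linarith [Real.log_two_gt_d9]
  -- Here `b = logRate R * k² + 3`: `exp (-2 * b)` cancels both constants, each at most `exp
  -- (logRate R * k²)`, and the `3` handles the remaining factor `3 * 32 = 96 ≤ exp 6`.
  have hc : (m + 2 : ℕ) * Real.exp (-2 * (logRate R * (k : ℝ) ^ 2 + 3))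
      ≤ n * ε ^ 2 / (32 * tiltConst R (2 * k)) := by
    have hm3 : ((m + 2 : ℕ) : ℝ) * (k : ℝ) ^ 2 ≤ 3 * effDim k d := by
      rw [hmd]
      exact packDim_mul_le hk d
    have hm0 : (0 : ℝ) ≤ ((m + 2 : ℕ) : ℝ) := Nat.cast_nonneg _
    have hm4 : ((m + 2 : ℕ) : ℝ) ≤ 3 * effDim k d := by nlinarith
    obtain ⟨t1, t2⟩ := tiltConst_le_exp hR hk
    have h96 : 96 ≤ Real.exp 6 := by
      have e : Real.exp 6 = Real.exp 1 ^ 6 := by rw [← Real.exp_nat_mul]; norm_num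
      rw [e]
      have : (2.7 : ℝ) ^ 6 ≤ Real.exp 1 ^ 6 :=
        pow_le_pow_left₀ (by norm_num) (by linarith [Real.exp_one_gt_d9]) 6
      refine le_trans (by norm_num) this
    have e1 : n * ε ^ 2 / (32 * tiltConst R (2 * k))
        = effDim k d / (32 * tiltConst R (2 * k) * chiConst R (2 * k)) := by
      rw [hε2]
      field_simp
    have e2 : Real.exp (-2 * (logRate R * (k : ℝ) ^ 2 + 3))
        = 1 / (Real.exp 6 * (Real.exp (logRate R * (k : ℝ) ^ 2)
          * Real.exp (logRate R * (k : ℝ) ^ 2))) := by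
      rw [← Real.exp_add, ← Real.exp_add, one_div, ← Real.exp_neg]
      congr 1
      ring
    rw [e1, e2, mul_one_div, div_le_div_iff₀ (by positivity) (by positivity)]
    calc ((m + 2 : ℕ) : ℝ) * (32 * tiltConst R (2 * k) * chiConst R (2 * k))
        ≤ (3 * effDim k d) * (32 * Real.exp (logRate R * (k : ℝ) ^ 2)
          * Real.exp (logRate R * (k : ℝ) ^ 2)) := by gcongr
      _ = effDim k d * (96 * (Real.exp (logRate R * (k : ℝ) ^ 2)
          * Real.exp (logRate R * (k : ℝ) ^ 2))) := by ring
      _ ≤ _ := by gcongr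
  have hXε : n * (chiConst R (2 * k) * ε ^ 2) = effDim k d := by
    rw [hε2]
    field_simp
  have htail := measure_sqHell_gt_le hR hk hn hε hS h1 h2 hγ h₀ hclose hm
    (by positivity : 0 ≤ logRate R * (k : ℝ) ^ 2 + 3) hc
    (8 / n * (effDim k d * (6 * logRate R + 17) + L))
  have hfinal := exp_mul_packing_le (L := L) hR hk hn hmd hXε
  have hδL : Real.exp (-L) = δ := by
    rw [hL, Real.log_div one_ne_zero hδ.ne', Real.log_one, zero_sub, neg_neg, Real.exp_log hδ]
  rw [hδL] at hfinal
  refine (measure_mono ?_).trans (htail.trans (ENNReal.ofReal_le_ofReal hfinal))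
  intro x hx
  simp only [Set.mem_ofPred_eq] at hx ⊢
  by_contra! hcon
  have htri := sqHell_triangle (hS.1 _ (h1 x)) (hS.1 _ h₀) hγ
  have hnear : sqHell γ₀ γ ≤ effDim k d / n := by
    rw [sqHell_comm]
    calc sqHell γ γ₀ ≤ chiSq γ γ₀ := sqHell_le_chiSq hR hγ (hS.1 _ h₀)
      _ ≤ chiConst R (2 * k) * sqDist γ γ₀ := (chiSq_le hR hγ (hS.1 _ h₀)).2
      _ ≤ chiConst R (2 * k) * ε ^ 2 := by gcongr
      _ = effDim k d / n := by
          rw [hε2]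
          field_simp
  have e : tailConst R * (effDim k d / n * L)
      - (2 * (8 / n * (effDim k d * (6 * logRate R + 17) + L)) + 2 * (effDim k d / n))
      = (tailConst R * (effDim k d * L) - (16 * (effDim k d * (6 * logRate R + 17) + L)
        + 2 * effDim k d)) / n := by
    field_simp
    ring
  -- As `δ < 1 / 2` gives `L ≥ 1 / 2`, each `effDim` costs at most `2 * effDim * L`; then `2 * (96 *
  -- logRate R + 272 + 2) + 16` is `tailConst R`.
  have hpos : 0 ≤ tailConst R * (effDim k d * L) - (16 * (effDim k d * (6 * logRate R + 17) + L)
        + 2 * effDim k d) := by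
    have g1 : effDim k d ≤ 2 * (effDim k d * L) := by nlinarith
    have g2 : L ≤ effDim k d * L := by nlinarith
    have g3 : effDim k d * logRate R ≤ 2 * (effDim k d * L) * logRate R :=
      mul_le_mul_of_nonneg_right g1 hA
    unfold tailConst
    nlinarith
  have := div_nonneg hpos hn0.le
  rw [← e] at this
  linarith

end Estimator

/-! ### From weights and atoms to mixing measures -/

/-- The discrete measure with the given weights and atoms. -/
def toMeasure {E : Type*} [MeasurableSpace E] {k : ℕ} (γ : Atoms k E) : Measure E :=
  ∑ j, ENNReal.ofReal (γ.1 j) • Measure.dirac (γ.2 j)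

theorem mem_mixingClass_iff {R : ℝ} {k d : ℕ} {Γ : Measure (EuclideanSpace ℝ (Fin d))} :
    Γ ∈ mixingClass R k d ↔
      ∃ γ : Atoms k (EuclideanSpace ℝ (Fin d)), IsMixing R γ ∧ Γ = toMeasure γ := by
  constructor
  · rintro ⟨w, μ, h1, h2, h3, rfl⟩
    exact ⟨(w, μ), ⟨h1, h2, h3⟩, rfl⟩
  · rintro ⟨γ, ⟨h1, h2, h3⟩, rfl⟩
    exact ⟨γ.1, γ.2, h1, h2, h3, rfl⟩

theorem mixture_toMeasure {d k : ℕ} {R : ℝ} {γ : Atoms k (EuclideanSpace ℝ (Fin d))}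
    (h : IsMixing R γ) : mixture (toMeasure γ) = law γ := by
  ext s hs
  have hf : Measurable (s.indicator (1 : EuclideanSpace ℝ (Fin d) → ℝ≥0∞)) :=
    measurable_one.indicator hs
  have hshift : ∀ m : EuclideanSpace ℝ (Fin d),
      ∫⁻ y, s.indicator 1 (m + y) ∂(stdGaussian (EuclideanSpace ℝ (Fin d)))
        = ∫⁻ y in s, ENNReal.ofReal (shiftDensity m y)
            ∂(stdGaussian (EuclideanSpace ℝ (Fin d))) := by
    intro m
    rw [← lintegral_map (f := s.indicator 1) (g := fun y => m + y) hf (by fun_prop),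
      map_add_stdGaussian, lintegral_indicator_one hs, withDensity_apply _ hs]
  rw [mixture, ← lintegral_indicator_one hs, Measure.lintegral_conv hf, toMeasure,
    lintegral_finsetSum_measure, law, withDensity_apply _ hs]
  simp_rw [lintegral_smul_measure, lintegral_dirac, hshift, density, smul_eq_mul]
  have e : ∀ x : EuclideanSpace ℝ (Fin d),
      ENNReal.ofReal (∑ j, γ.1 j * shiftDensity (γ.2 j) x)
        = ∑ j, ENNReal.ofReal (γ.1 j) * ENNReal.ofReal (shiftDensity (γ.2 j) x) := by
    intro x
    rw [ENNReal.ofReal_sum_of_nonneg fun j _ => mul_nonneg (h.2.1 j) (shiftDensity_pos _ _).le]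
    exact Finset.sum_congr rfl fun j _ => ENNReal.ofReal_mul (h.2.1 j)
  simp_rw [e]
  rw [lintegral_finsetSum _ fun j _ => (measurable_shiftDensity _).ennreal_ofReal.const_mul _]
  exact Finset.sum_congr rfl fun j _ =>
    (lintegral_const_mul _ (measurable_shiftDensity _).ennreal_ofReal).symm

theorem measurable_mixture {d : ℕ} :
    Measurable (mixture : Measure (EuclideanSpace ℝ (Fin d)) → _) := by
  have hfib : Measurable fun x : EuclideanSpace ℝ (Fin d) =>
      (stdGaussian (EuclideanSpace ℝ (Fin d))).map (Prod.mk x) := Measurable.map_prodMk_left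
  have hprod : Measurable fun Γ : Measure (EuclideanSpace ℝ (Fin d)) =>
      Γ.prod (stdGaussian (EuclideanSpace ℝ (Fin d))) := by
    simp only [Measure.prod]
    exact Measure.measurable_bind' hfib
  exact (Measure.measurable_map _ measurable_add).comp hprod

theorem isProbabilityMeasure_mixture {d k : ℕ} {R : ℝ} {Γ : Measure (EuclideanSpace ℝ (Fin d))}
    (h : Γ ∈ mixingClass R k d) : IsProbabilityMeasure (mixture Γ) := by
  obtain ⟨γ, hγ, rfl⟩ := mem_mixingClass_iff.1 h
  rw [mixture_toMeasure hγ]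
  exact isProbabilityMeasure_law hγ

theorem minimaxRisk_le_properMinimaxRisk (R : ℝ) (k d n : ℕ) :
    minimaxRisk R k d n ≤ properMinimaxRisk R k d n :=
  le_iInf₂ fun Γhat h => iInf₂_le (fun x => mixture (Γhat x))
    ⟨measurable_mixture.comp h.1, fun x => isProbabilityMeasure_mixture (h.2 x)⟩

theorem sampleLaw_toMeasure {d k : ℕ} {R : ℝ} (n : ℕ) {γ : Atoms k (EuclideanSpace ℝ (Fin d))}
    (h : IsMixing R γ) : sampleLaw n (toMeasure γ) = Measure.pi fun _ : Fin n => law γ := by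
  rw [sampleLaw, mixture_toMeasure h]

theorem hellinger_mixture {d k : ℕ} {R : ℝ} {γ γ' : Atoms k (EuclideanSpace ℝ (Fin d))}
    (h : IsMixing R γ) (h' : IsMixing R γ') :
    hellinger (mixture (toMeasure γ)) (mixture (toMeasure γ')) = √(sqHell γ γ') := by
  rw [mixture_toMeasure h, mixture_toMeasure h', hellinger_law h h']

/-- A single proper estimator achieves the effective-dimension rate at all confidence levels. -/
theorem exists_proper_estimator {R : ℝ} (hR : 0 < R) :
    ∃ C : ℝ, 0 < C ∧ ∀ k d n : ℕ, 1 ≤ k → 1 ≤ d → 1 ≤ n →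
      ∃ Γhat : (Fin n → EuclideanSpace ℝ (Fin d)) → Measure (EuclideanSpace ℝ (Fin d)),
        IsMixingEstimator R k Γhat ∧
        ∀ Γ ∈ mixingClass R k d, ∀ δ : ℝ, 0 < δ → δ < 1 / 2 →
          ENNReal.ofReal (1 - δ) ≤ sampleLaw n Γ
            {x | hellinger (mixture (Γhat x)) (mixture Γ)
                ≤ C * √((((k : ℝ) ^ 4 * (d : ℝ) + (2 * (k : ℝ)) ^ (2 * k + 2)) / (n : ℝ))
                    * Real.log (1 / δ))} := by
  have hT : 0 < tailConst R := by unfold tailConst logRate; positivity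
  refine ⟨√(tailConst R), Real.sqrt_pos.2 hT, fun k d n hk hd hn => ?_⟩
  obtain ⟨S, sel, h1, h2, h3, h4⟩ :=
    exists_estimator (E := EuclideanSpace ℝ (Fin d)) hR.le hk hn finrank_euclideanSpace_fin
  refine ⟨fun x => toMeasure (sel x), ⟨measurable_comp_of_finite_range h1 h2 toMeasure,
    fun x => mem_mixingClass_iff.2 ⟨sel x, h3 x, rfl⟩⟩, fun Γ hΓ δ hδ hδ2 => ?_⟩
  obtain ⟨γ, hγ, rfl⟩ := mem_mixingClass_iff.1 hΓ
  have := isProbabilityMeasure_law hγ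
  rw [sampleLaw_toMeasure n hγ]
  have hm : MeasurableSet {x | tailConst R * (effDim k d / n * Real.log (1 / δ))
      < sqHell (sel x) γ} :=
    measurableSet_lt measurable_const
      (measurable_comp_of_finite_range h1 h2 fun γ₁ => sqHell γ₁ γ)
  have hset : {x | tailConst R * (effDim k d / n * Real.log (1 / δ)) < sqHell (sel x) γ}ᶜ ⊆
      {x | hellinger (mixture (toMeasure (sel x))) (mixture (toMeasure γ))
        ≤ √(tailConst R) * √((((k : ℝ) ^ 4 * (d : ℝ) + (2 * (k : ℝ)) ^ (2 * k + 2)) / (n : ℝ))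
          * Real.log (1 / δ))} := by
    intro x hx
    simp only [Set.mem_compl_iff, Set.mem_ofPred_eq, not_lt] at hx ⊢
    rw [hellinger_mixture (h3 x) hγ, ← Real.sqrt_mul hT.le]
    exact Real.sqrt_le_sqrt hx
  refine le_trans ?_ (measure_mono hset)
  rw [prob_compl_eq_one_sub hm, ENNReal.ofReal_sub _ hδ.le, ENNReal.ofReal_one]
  exact tsub_le_tsub_left (h4 γ hγ δ hδ hδ2) 1

/-! ### Upper bound on the risk -/

/-- The mean of a nonnegative variable with exponential tails. -/
theorem lintegral_le_two_of_exp_tail {Ω : Type*} [MeasurableSpace Ω] {P : Measure Ω}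
    [IsProbabilityMeasure P] {z : Ω → ℝ} (hz : Measurable z) (hz0 : ∀ x, 0 ≤ z x)
    (h : ∀ t : ℝ, 1 < t → P {x | t < z x} ≤ ENNReal.ofReal (Real.exp (-t))) :
    ∫⁻ x, ENNReal.ofReal (z x) ∂P ≤ 2 := by
  rw [lintegral_eq_lintegral_meas_lt P (ae_of_all _ hz0) hz.aemeasurable,
    ← Set.Ioc_union_Ioi_eq_Ioi zero_le_one]
  refine (lintegral_union_le _ _ _).trans ?_
  have h1 : ∫⁻ t in Set.Ioc (0 : ℝ) 1, P {x | t < z x} ≤ 1 := by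
    calc ∫⁻ t in Set.Ioc (0 : ℝ) 1, P {x | t < z x} ≤ ∫⁻ _t in Set.Ioc (0 : ℝ) 1, 1 :=
          lintegral_mono fun _ => prob_le_one
      _ = 1 := by simp
  have h2 : ∫⁻ t in Set.Ioi (1 : ℝ), P {x | t < z x} ≤ 1 := by
    calc ∫⁻ t in Set.Ioi (1 : ℝ), P {x | t < z x}
        ≤ ∫⁻ t in Set.Ioi (1 : ℝ), ENNReal.ofReal (Real.exp (-t)) :=
          setLIntegral_mono (by fun_prop) fun t ht => h t ht
      _ = ENNReal.ofReal (∫ t in Set.Ioi (1 : ℝ), Real.exp (-t)) :=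
          (ofReal_integral_eq_lintegral_ofReal (integrableOn_exp_neg_Ioi 1)
            (ae_of_all _ fun _ => (Real.exp_pos _).le)).symm
      _ ≤ 1 := by
          rw [integral_exp_neg_Ioi, ← ENNReal.ofReal_one]
          exact ENNReal.ofReal_le_ofReal (Real.exp_le_one_iff.2 (by norm_num))
  calc _ ≤ (1 : ℝ≥0∞) + 1 := add_le_add h1 h2
    _ = 2 := one_add_one_eq_two

/-- The constant of the upper bound on the minimax risk. -/
def upperConst (R : ℝ) (k : ℕ) : ℝ :=
  3 * √(tailConst R * ((k : ℝ) ^ 4 + (2 * k : ℝ) ^ (2 * k + 2))) + 2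

theorem properMinimaxRisk_le {R : ℝ} (hR : 0 < R) {k d n : ℕ} (hk : 1 ≤ k) (hd : 1 ≤ d)
    (hn : 1 ≤ n) : properMinimaxRisk R k d n
      ≤ ENNReal.ofReal (upperConst R k * min (√((d : ℝ) / (n : ℝ))) 1) := by
  have hT : 0 < tailConst R := by unfold tailConst logRate; positivity
  have hn0 : (0 : ℝ) < n := by exact_mod_cast hn
  have hd1 : (1 : ℝ) ≤ d := by exact_mod_cast hd
  have hD := one_le_effDim hk d
  obtain ⟨S, sel, h1, h2, h3, h4⟩ :=
    exists_estimator (E := EuclideanSpace ℝ (Fin d)) hR.le hk hn finrank_euclideanSpace_fin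
  refine iInf₂_le_of_le (fun x => toMeasure (sel x))
    ⟨measurable_comp_of_finite_range h1 h2 toMeasure,
      fun x => mem_mixingClass_iff.2 ⟨sel x, h3 x, rfl⟩⟩ (iSup₂_le fun Γ hΓ => ?_)
  obtain ⟨γ, hγ, rfl⟩ := mem_mixingClass_iff.1 hΓ
  have := isProbabilityMeasure_law hγ
  simp only [risk]
  rw [sampleLaw_toMeasure n hγ]
  simp_rw [fun x => hellinger_mixture (h3 x) hγ]
  set P := Measure.pi fun _ : Fin n => law γ with hP
  have htriv : ∫⁻ x, ENNReal.ofReal (√(sqHell (sel x) γ)) ∂P ≤ ENNReal.ofReal 2 := by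
    calc _ ≤ ∫⁻ _x, ENNReal.ofReal 2 ∂P := by
          refine lintegral_mono fun x => ENNReal.ofReal_le_ofReal ?_
          refine (Real.sqrt_le_left (by norm_num)).2 ?_
          linarith [sqHell_le_two (h3 x) hγ]
      _ = ENNReal.ofReal 2 := by simp
  have hmain : ∫⁻ x, ENNReal.ofReal (√(sqHell (sel x) γ)) ∂P
      ≤ ENNReal.ofReal (3 * √(tailConst R * (effDim k d / n))) := by
    set B := tailConst R * (effDim k d / n) with hB
    have hB0 : 0 < B := by positivity
    have hzm : Measurable fun x => sqHell (sel x) γ / B :=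
      (measurable_comp_of_finite_range h1 h2 fun γ₁ => sqHell γ₁ γ).div_const B
    have hz0 : ∀ x, 0 ≤ sqHell (sel x) γ / B := fun x => div_nonneg (sqHell_nonneg _ _) hB0.le
    have hz : ∫⁻ x, ENNReal.ofReal (sqHell (sel x) γ / B) ∂P ≤ 2 := by
      refine lintegral_le_two_of_exp_tail hzm hz0 fun t ht => ?_
      -- The tail bound is used with `δ = exp (-t)`; this is why the integration lemma asks for
      -- tails only when `t > 1`.
      have hδ2 : Real.exp (-t) < 1 / 2 := by
        rw [Real.exp_neg, one_div]
        refine inv_strictAnti₀ (by norm_num) ?_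
        linarith [Real.add_one_le_exp t]
      have := h4 γ hγ (Real.exp (-t)) (Real.exp_pos _) hδ2
      rw [one_div, ← Real.exp_neg, neg_neg, Real.log_exp, ← mul_assoc, ← hB] at this
      simp_rw [lt_div_iff₀ hB0, mul_comm t B]
      exact this
    calc _ ≤ ∫⁻ x, (ENNReal.ofReal (√B) + ENNReal.ofReal (√B) *
          ENNReal.ofReal (sqHell (sel x) γ / B)) ∂P := by
          refine lintegral_mono fun x => ?_
          rw [← ENNReal.ofReal_mul (Real.sqrt_nonneg _),
            ← ENNReal.ofReal_add (Real.sqrt_nonneg _) (mul_nonneg (Real.sqrt_nonneg _) (hz0 x))]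
          refine ENNReal.ofReal_le_ofReal ?_
          have e : sqHell (sel x) γ = B * (sqHell (sel x) γ / B) := by field_simp
          conv_lhs => rw [e]
          rw [Real.sqrt_mul hB0.le]
          have hs : √(sqHell (sel x) γ / B) ≤ 1 + sqHell (sel x) γ / B := by
            refine (Real.sqrt_le_left (by linarith [hz0 x])).2 ?_
            nlinarith [hz0 x]
          nlinarith [mul_le_mul_of_nonneg_left hs (Real.sqrt_nonneg B)]
      _ = ENNReal.ofReal (√B) + ENNReal.ofReal (√B) *
          ∫⁻ x, ENNReal.ofReal (sqHell (sel x) γ / B) ∂P := by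
          rw [lintegral_add_left measurable_const, lintegral_const_mul _ hzm.ennreal_ofReal]
          simp
      _ ≤ ENNReal.ofReal (√B) + ENNReal.ofReal (√B) * 2 := by gcongr
      _ = _ := by
          rw [show (2 : ℝ≥0∞) = ENNReal.ofReal 2 by simp, ← ENNReal.ofReal_mul (Real.sqrt_nonneg _),
            ← ENNReal.ofReal_add (Real.sqrt_nonneg _) (by positivity)]
          congr 1
          ring
  have hU2 : 2 ≤ upperConst R k := by
    unfold upperConst
    have := Real.sqrt_nonneg (tailConst R * ((k : ℝ) ^ 4 + (2 * k : ℝ) ^ (2 * k + 2)))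
    linarith
  rcases le_total (√((d : ℝ) / n)) 1 with hle | hle
  · rw [min_eq_left hle]
    refine hmain.trans (ENNReal.ofReal_le_ofReal ?_)
    -- For fixed `k` and `d ≥ 1` the term of `effDim` without `d` may also be multiplied by `d`.
    have e : √(tailConst R * (effDim k d / n))
        ≤ √(tailConst R * ((k : ℝ) ^ 4 + (2 * k : ℝ) ^ (2 * k + 2))) * √((d : ℝ) / n) := by
      rw [← Real.sqrt_mul (by positivity), mul_assoc, ← mul_div_assoc _ (d : ℝ)]
      refine Real.sqrt_le_sqrt (mul_le_mul_of_nonneg_left ?_ hT.le)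
      gcongr
      unfold effDim
      have : (0 : ℝ) ≤ (2 * k : ℝ) ^ (2 * k + 2) := by positivity
      nlinarith
    unfold upperConst
    nlinarith [Real.sqrt_nonneg ((d : ℝ) / n)]
  · rw [min_eq_right hle, mul_one]
    exact htriv.trans (ENNReal.ofReal_le_ofReal hU2)

/-! ### Lower bound: test functions and affinities -/

/-- Bounded test functions separate distributions at most as much as the Hellinger distance. -/
theorem abs_integral_sub_le_hellinger {Ω : Type*} [MeasurableSpace Ω] {P Q : Measure Ω}
    [IsProbabilityMeasure P] [IsProbabilityMeasure Q] {g : Ω → ℝ} (hg : Measurable g)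
    (hg1 : ∀ x, |g x| ≤ 1) :
    |∫ x, g x ∂P - ∫ x, g x ∂Q| ≤ 2 * hellinger P Q := by
  set ν := P + Q with hν
  have hP : P ≪ ν := Measure.absolutelyContinuous_of_le (Measure.le_add_right le_rfl)
  have hQ : Q ≪ ν := Measure.absolutelyContinuous_of_le (Measure.le_add_left le_rfl)
  set p : Ω → ℝ := fun x => (P.rnDeriv ν x).toReal with hp
  set q : Ω → ℝ := fun x => (Q.rnDeriv ν x).toReal with hq
  have hp0 : ∀ x, 0 ≤ p x := fun x => ENNReal.toReal_nonneg
  have hq0 : ∀ x, 0 ≤ q x := fun x => ENNReal.toReal_nonneg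
  have hpm : Measurable p := (Measure.measurable_rnDeriv _ _).ennreal_toReal
  have hqm : Measurable q := (Measure.measurable_rnDeriv _ _).ennreal_toReal
  have ip : Integrable p ν := Measure.integrable_toReal_rnDeriv
  have iq : Integrable q ν := Measure.integrable_toReal_rnDeriv
  have hpI : ∫ x, p x ∂ν = 1 := by rw [hp, Measure.integral_toReal_rnDeriv hP]; simp
  have hqI : ∫ x, q x ∂ν = 1 := by rw [hq, Measure.integral_toReal_rnDeriv hQ]; simp
  have i1 : Integrable (fun x => p x * g x) ν :=
    ip.mul_bdd (c := 1) hg.aestronglyMeasurable (ae_of_all _ fun x => hg1 x)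
  have i2 : Integrable (fun x => q x * g x) ν :=
    iq.mul_bdd (c := 1) hg.aestronglyMeasurable (ae_of_all _ fun x => hg1 x)
  have e : ∫ x, g x ∂P - ∫ x, g x ∂Q = ∫ x, (p x * g x - q x * g x) ∂ν := by
    rw [← integral_rnDeriv_smul hP, ← integral_rnDeriv_smul hQ]
    exact (integral_sub i1 i2).symm
  have i3 : Integrable (fun x => (√(p x) - √(q x)) ^ 2) ν := by
    refine (ip.add iq).mono' (((hpm.sqrt.sub hqm.sqrt).pow_const 2).aestronglyMeasurable)
      (ae_of_all _ fun x => ?_)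
    rw [Real.norm_eq_abs, abs_of_nonneg (sq_nonneg _)]
    exact sq_sqrt_sub_le (hp0 x) (hq0 x)
  set h := hellinger P Q with hh
  have hh2 : ∫ x, (√(p x) - √(q x)) ^ 2 ∂ν = h ^ 2 :=
    (Real.sq_sqrt (integral_nonneg fun _ => sq_nonneg _)).symm
  have hh0 : 0 ≤ h := Real.sqrt_nonneg _
  set D := |∫ x, g x ∂P - ∫ x, g x ∂Q| with hD
  -- Cauchy–Schwarz in parametric form: the optimum `t = 2 / h` gives `2 * h`, and if `h = 0` the
  -- choice `t = 4 / D` rules out `D > 0`.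
  have hbound : ∀ t : ℝ, 0 < t → D ≤ t / 2 * h ^ 2 + 2 / t := by
    intro t ht
    have hpt : ∀ x, |p x * g x - q x * g x|
        ≤ t / 2 * (√(p x) - √(q x)) ^ 2 + 1 / t * (p x + q x) := by
      intro x
      have sp := Real.sq_sqrt (hp0 x)
      have sq := Real.sq_sqrt (hq0 x)
      set u := √(p x)
      set v := √(q x)
      have e1 : |p x * g x - q x * g x| ≤ |u - v| * |u + v| := by
        have e0 : p x * g x - q x * g x = (u - v) * (u + v) * g x := by
          rw [← sp, ← sq]
          ring
        rw [e0, abs_mul, abs_mul]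
        exact mul_le_of_le_one_right (by positivity) (hg1 x)
      have e2 : |u - v| * |u + v| ≤ t / 2 * (u - v) ^ 2 + 1 / (2 * t) * (u + v) ^ 2 := by
        rw [← sq_abs (u - v), ← sq_abs (u + v)]
        have e3 : t / 2 * |u - v| ^ 2 + 1 / (2 * t) * |u + v| ^ 2 - |u - v| * |u + v|
            = 1 / (2 * t) * (t * |u - v| - |u + v|) ^ 2 := by
          field_simp
          ring
        have e4 : 0 ≤ 1 / (2 * t) * (t * |u - v| - |u + v|) ^ 2 := by positivity
        linarith
      have e5 : 1 / (2 * t) * (u + v) ^ 2 ≤ 1 / t * (p x + q x) := by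
        have e6 : 1 / t * (p x + q x) = 1 / (2 * t) * (2 * (u ^ 2 + v ^ 2)) := by
          rw [sp, sq]
          field_simp
        rw [e6]
        refine mul_le_mul_of_nonneg_left ?_ (by positivity)
        nlinarith [sq_nonneg (u - v)]
      linarith
    calc D ≤ ∫ x, |p x * g x - q x * g x| ∂ν := by
          rw [hD, e]
          exact abs_integral_le_integral_abs
      _ ≤ ∫ x, (t / 2 * (√(p x) - √(q x)) ^ 2 + 1 / t * (p x + q x)) ∂ν :=
          integral_mono (i1.sub i2).abs ((i3.const_mul _).add ((ip.add iq).const_mul _)) hpt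
      _ = t / 2 * h ^ 2 + 2 / t := by
          have i4 : Integrable (fun x => p x + q x) ν := ip.add iq
          rw [integral_add (i3.const_mul _) (i4.const_mul _), integral_const_mul,
            integral_const_mul, integral_add ip iq, hpI, hqI, hh2]
          ring
  rcases hh0.eq_or_lt with h0 | hpos
  · rw [← h0]
    by_contra! hcon
    have hDpos : 0 < D := by linarith
    have := hbound (4 / D) (by positivity)
    rw [← h0] at this
    have e : 4 / D / 2 * 0 ^ 2 + 2 / (4 / D) = D / 2 := by
      field_simp
      ring
    linarith
  · have := hbound (2 / h) (by positivity)
    have e : 2 / h / 2 * h ^ 2 + 2 / (2 / h) = 2 * h := by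
      field_simp
      ring
    linarith

/-- Products of measures with densities. -/
theorem pi_withDensity_ofReal {Ω : Type*} [MeasurableSpace Ω] {ν : Measure Ω} [SigmaFinite ν]
    {n : ℕ} {f : Ω → ℝ} (hf0 : ∀ x, 0 ≤ f x) (hfi : Integrable f ν) :
    Measure.pi (fun _ : Fin n => ν.withDensity fun x => ENNReal.ofReal (f x))
      = (Measure.pi fun _ : Fin n => ν).withDensity fun x => ENNReal.ofReal (∏ i, f (x i)) := by
  have : IsFiniteMeasure (ν.withDensity fun x => ENNReal.ofReal (f x)) :=
    isFiniteMeasure_withDensity_ofReal hfi.2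
  refine Measure.pi_eq fun s hs => ?_
  rw [withDensity_apply _ (MeasurableSet.univ_pi hs), Measure.restrict_pi_pi,
    ← ofReal_integral_eq_lintegral_ofReal (Integrable.fintype_prod fun i => hfi.restrict)
      (ae_of_all _ fun x => Finset.prod_nonneg fun i _ => hf0 _),
    integral_fintype_prod_eq_prod (f := fun _ => f),
    ENNReal.ofReal_prod_of_nonneg fun i _ => integral_nonneg hf0]
  refine Finset.prod_congr rfl fun i _ => ?_
  rw [withDensity_apply _ (hs i), ← ofReal_integral_eq_lintegral_ofReal hfi.restrict
    (ae_of_all _ hf0)]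

/-- The testing error of two distributions is bounded below by their affinity. -/
theorem sq_integral_sqrt_mul_le {Ω : Type*} [MeasurableSpace Ω] {ν : Measure Ω} {p q : Ω → ℝ}
    (hp : Measurable p) (hq : Measurable q) (hp0 : ∀ x, 0 ≤ p x) (hq0 : ∀ x, 0 ≤ q x)
    (ip : Integrable p ν) (iq : Integrable q ν) (hpI : ∫ x, p x ∂ν = 1) (hqI : ∫ x, q x ∂ν = 1)
    {A : Set Ω} (hA : MeasurableSet A) (hρ : 0 < ∫ x, √(p x * q x) ∂ν) :
    (∫ x, √(p x * q x) ∂ν) ^ 2 / 2 ≤ ∫ x in A, p x ∂ν + ∫ x in Aᶜ, q x ∂ν := by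
  classical
  set ρ := ∫ x, √(p x * q x) ∂ν with hρdef
  have hpt : ∀ a b t : ℝ, 0 ≤ a → 0 ≤ b → 0 < t → √(a * b) ≤ t / 2 * a + 1 / (2 * t) * b := by
    intro a b t ha hb ht
    have h0 : 0 ≤ t / 2 * a + 1 / (2 * t) * b := by positivity
    refine (Real.sqrt_le_left h0).2 ?_
    have e : (t / 2 * a + 1 / (2 * t) * b) ^ 2 - a * b = (t / 2 * a - 1 / (2 * t) * b) ^ 2 := by
      field_simp
      ring
    nlinarith [sq_nonneg (t / 2 * a - 1 / (2 * t) * b)]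
  have is : Integrable (fun x => √(p x * q x)) ν := by
    refine (ip.add iq).mono' (hp.mul hq).sqrt.aestronglyMeasurable (ae_of_all _ fun x => ?_)
    rw [Real.norm_eq_abs, abs_of_nonneg (Real.sqrt_nonneg _)]
    have := hpt (p x) (q x) 1 (hp0 x) (hq0 x) one_pos
    simp only [Pi.add_apply]
    linarith [hp0 x, hq0 x]
  -- With this parameter the mass bound `2` on the complementary terms costs `ρ / 2`, half of the
  -- affinity.
  set t := 2 / ρ with ht
  have ht0 : 0 < t := by positivity
  have hA1 : ∫ x in A, √(p x * q x) ∂ν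
      ≤ t / 2 * ∫ x in A, p x ∂ν + 1 / (2 * t) * ∫ x in A, q x ∂ν := by
    rw [← integral_const_mul, ← integral_const_mul,
      ← integral_add (ip.restrict.const_mul _) (iq.restrict.const_mul _)]
    exact integral_mono is.restrict ((ip.restrict.const_mul _).add (iq.restrict.const_mul _))
      fun x => hpt _ _ t (hp0 x) (hq0 x) ht0
  have hA2 : ∫ x in Aᶜ, √(p x * q x) ∂ν
      ≤ t / 2 * ∫ x in Aᶜ, q x ∂ν + 1 / (2 * t) * ∫ x in Aᶜ, p x ∂ν := by
    rw [← integral_const_mul, ← integral_const_mul,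
      ← integral_add (iq.restrict.const_mul _) (ip.restrict.const_mul _)]
    refine integral_mono is.restrict ((iq.restrict.const_mul _).add (ip.restrict.const_mul _))
      fun x => ?_
    rw [mul_comm (p x)]
    exact hpt _ _ t (hq0 x) (hp0 x) ht0
  have s1 := integral_add_compl hA is
  have s2 := integral_add_compl hA ip
  have s3 := integral_add_compl hA iq
  have n1 : 0 ≤ ∫ x in A, p x ∂ν := integral_nonneg hp0
  have n2 : 0 ≤ ∫ x in Aᶜ, q x ∂ν := integral_nonneg hq0
  have hle : ∫ x in A, q x ∂ν + ∫ x in Aᶜ, p x ∂ν ≤ 2 := by linarith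
  set B := ∫ x in A, p x ∂ν + ∫ x in Aᶜ, q x ∂ν with hB
  have hfin : ρ ≤ t / 2 * B + 1 / (2 * t) * 2 := by
    have h2t : 0 ≤ 1 / (2 * t) := by positivity
    have := mul_le_mul_of_nonneg_left hle h2t
    rw [hρdef, ← s1]
    nlinarith
  have e1 : t / 2 * B + 1 / (2 * t) * 2 = B / ρ + ρ / 2 := by
    rw [ht]
    field_simp
  rw [e1] at hfin
  have : ρ / 2 ≤ B / ρ := by linarith
  rw [le_div_iff₀ hρ] at this
  nlinarith

/-! ### Two Gaussian hypotheses -/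

section TwoPoint

variable {E : Type*} [NormedAddCommGroup E] [InnerProductSpace ℝ E] [FiniteDimensional ℝ E]
  [MeasurableSpace E] [BorelSpace E]

/-- The Gaussian measure with mean `m` and identity covariance. -/
def shiftLaw (m : E) : Measure E :=
  (stdGaussian E).withDensity fun x => ENNReal.ofReal (shiftDensity m x)

theorem isProbabilityMeasure_shiftLaw (m : E) : IsProbabilityMeasure (shiftLaw m) := by
  rw [shiftLaw, ← map_add_stdGaussian]
  exact Measure.isProbabilityMeasure_map (by fun_prop)

theorem integral_sqrt_shiftDensity (m m' : E) :
    ∫ x, √(shiftDensity m x * shiftDensity m' x) ∂(stdGaussian E)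
      = Real.exp (-(‖m - m'‖ ^ 2 / 8)) := by
  have e : ∀ x : E, √(shiftDensity m x * shiftDensity m' x)
      = Real.exp (-((‖m‖ ^ 2 + ‖m'‖ ^ 2) / 4)) * Real.exp ⟪(1 / 2 : ℝ) • (m + m'), x⟫ := by
    intro x
    rw [shiftDensity, shiftDensity, ← Real.exp_add, ← Real.exp_half, ← Real.exp_add]
    congr 1
    rw [real_inner_smul_left, inner_add_left]
    ring
  simp_rw [e]
  rw [integral_const_mul, integral_exp_inner_stdGaussian, ← Real.exp_add]
  congr 1
  rw [norm_smul, mul_pow, norm_add_sq_real, norm_sub_sq_real]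
  norm_num
  ring

/-- The affinity of the product laws is `exp (-n * ‖m - m'‖² / 8)`; under `hn` its square is at
least `exp (-1) ≥ 1 / 3`, and half of this bounds the testing error. -/
theorem two_point_le (n : ℕ) {m m' : E} {A : Set (Fin n → E)} (hA : MeasurableSet A)
    (hn : n * ‖m - m'‖ ^ 2 ≤ 4) :
    ENNReal.ofReal (1 / 6) ≤ Measure.pi (fun _ : Fin n => shiftLaw m) A
      + Measure.pi (fun _ : Fin n => shiftLaw m') Aᶜ := by
  have hpos : ∀ (m : E) (x : Fin n → E), 0 ≤ ∏ i, shiftDensity m (x i) :=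
    fun m x => Finset.prod_nonneg fun i _ => (shiftDensity_pos _ _).le
  have hint : ∀ m : E, Integrable (fun x : Fin n → E => ∏ i, shiftDensity m (x i))
      (Measure.pi fun _ => stdGaussian E) :=
    fun m => Integrable.fintype_prod fun _ => integrable_shiftDensity m
  have hmeas : ∀ m : E, Measurable fun x : Fin n → E => ∏ i, shiftDensity m (x i) :=
    fun m => Finset.measurable_prod _ fun i _ =>
      (measurable_shiftDensity m).comp (measurable_pi_apply i)
  have hone : ∀ m : E, ∫ x : Fin n → E, ∏ i, shiftDensity m (x i)
      ∂(Measure.pi fun _ => stdGaussian E) = 1 := by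
    intro m
    rw [integral_fintype_prod_eq_pow, integral_shiftDensity, one_pow]
  have haff : ∫ x : Fin n → E, √((∏ i, shiftDensity m (x i)) * ∏ i, shiftDensity m' (x i))
      ∂(Measure.pi fun _ => stdGaussian E) = Real.exp (-(n * ‖m - m'‖ ^ 2 / 8)) := by
    have e : ∀ x : Fin n → E, √((∏ i, shiftDensity m (x i)) * ∏ i, shiftDensity m' (x i))
        = ∏ i, √(shiftDensity m (x i) * shiftDensity m' (x i)) := by
      intro x
      rw [← Finset.prod_mul_distrib, Real.sqrt_prod]
      exact fun i _ => (mul_pos (shiftDensity_pos _ _) (shiftDensity_pos _ _)).le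
    simp_rw [e]
    rw [integral_fintype_prod_eq_pow (fun y : E => √(shiftDensity m y * shiftDensity m' y)),
      integral_sqrt_shiftDensity, Fintype.card_fin, ← Real.exp_nat_mul]
    congr 1
    ring
  have hset : ∀ (m : E) {B : Set (Fin n → E)}, MeasurableSet B →
      Measure.pi (fun _ : Fin n => shiftLaw m) B = ENNReal.ofReal
        (∫ x in B, ∏ i, shiftDensity m (x i) ∂(Measure.pi fun _ => stdGaussian E)) := by
    intro m B hB
    unfold shiftLaw
    rw [pi_withDensity_ofReal (fun x => (shiftDensity_pos m x).le)
      (integrable_shiftDensity m), withDensity_apply _ hB,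
      ofReal_integral_eq_lintegral_ofReal (hint m).restrict (ae_of_all _ (hpos m))]
  rw [hset m hA, hset m' hA.compl, ← ENNReal.ofReal_add (integral_nonneg (hpos m))
    (integral_nonneg (hpos m'))]
  refine ENNReal.ofReal_le_ofReal (le_trans ?_ (sq_integral_sqrt_mul_le (hmeas m) (hmeas m')
    (hpos m) (hpos m') (hint m) (hint m') (hone m) (hone m') hA ?_))
  · rw [haff, ← Real.exp_nat_mul]
    have h1 : Real.exp (-1) ≤ Real.exp ((2 : ℕ) * (-(n * ‖m - m'‖ ^ 2 / 8))) := by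
      refine Real.exp_le_exp.2 ?_
      push_cast
      linarith
    have h2 : 1 / 3 ≤ Real.exp (-1) := by
      rw [Real.exp_neg, one_div]
      exact inv_anti₀ (Real.exp_pos _) (by linarith [Real.exp_one_lt_d9])
    linarith
  · rw [haff]
    exact Real.exp_pos _

theorem integral_sin_shiftLaw (m v c : E) :
    ∫ x, Real.sin ⟪x - c, v⟫ ∂(shiftLaw m)
      = Real.exp (-(‖v‖ ^ 2 / 2)) * Real.sin ⟪m - c, v⟫ := by
  rw [shiftLaw, ← map_add_stdGaussian, integral_map (by fun_prop) (by fun_prop)]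
  have hi : Integrable (fun x : E => Complex.exp (⟪m - c, v⟫ * Complex.I)
      * Complex.exp (⟪x, (0 : E)⟫ + ⟪x, v⟫ * Complex.I)) (stdGaussian E) := by
    refine Integrable.of_bound (C := 1) (by fun_prop) (ae_of_all _ fun x => ?_)
    rw [norm_mul, Complex.norm_exp_ofReal_mul_I, inner_zero_right, Complex.ofReal_zero, zero_add,
      Complex.norm_exp_ofReal_mul_I, one_mul]
  have e : ∀ x : E, Real.sin ⟪m + x - c, v⟫ = RCLike.im (Complex.exp (⟪m - c, v⟫ * Complex.I)
      * Complex.exp (⟪x, (0 : E)⟫ + ⟪x, v⟫ * Complex.I)) := by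
    intro x
    rw [inner_zero_right, Complex.ofReal_zero, zero_add, ← Complex.exp_add, ← add_mul,
      ← Complex.ofReal_add, ← inner_add_left]
    simp only [RCLike.im_eq_complex_im]
    rw [Complex.exp_ofReal_mul_I_im]
    congr 2
    abel
  simp_rw [e]
  rw [integral_im hi, integral_const_mul, integral_cexp_inner_stdGaussian]
  simp only [RCLike.im_eq_complex_im, inner_zero_left, norm_zero]
  have e2 : Complex.exp ((((0 : ℝ) : ℂ) ^ 2 - (‖v‖ : ℂ) ^ 2) / 2 + ((0 : ℝ) : ℂ) * Complex.I)
      = ((Real.exp (-(‖v‖ ^ 2 / 2)) : ℝ) : ℂ) := by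
    push_cast
    congr 1
    ring
  rw [e2, mul_comm, Complex.im_ofReal_mul, Complex.exp_ofReal_mul_I_im]

end TwoPoint

/-! ### Assouad's argument on the cube -/

/-- The vertices of a cube with side length `2 * a` around the origin. -/
def cubeVertex {d : ℕ} (a : ℝ) (τ : Fin d → Bool) : EuclideanSpace ℝ (Fin d) :=
  WithLp.toLp 2 fun i => if τ i then a else -a

/-- Flip a single coordinate. -/
def flipAt {d : ℕ} (i : Fin d) (τ : Fin d → Bool) : Fin d → Bool := Function.update τ i (!τ i)

theorem flipAt_flipAt {d : ℕ} (i : Fin d) (τ : Fin d → Bool) : flipAt i (flipAt i τ) = τ := by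
  simp [flipAt]

theorem norm_sq_cubeVertex {d : ℕ} (a : ℝ) (τ : Fin d → Bool) :
    ‖cubeVertex a τ‖ ^ 2 = d * a ^ 2 := by
  rw [EuclideanSpace.real_norm_sq_eq]
  have : ∀ i, cubeVertex a τ i ^ 2 = a ^ 2 := by
    intro i
    simp only [cubeVertex]
    split_ifs <;> ring
  simp [this]

theorem norm_sq_cubeVertex_sub {d : ℕ} (a : ℝ) (τ τ' : Fin d → Bool) :
    ‖cubeVertex a τ - cubeVertex a τ'‖ ^ 2
      = 4 * a ^ 2 * ∑ i, if τ' i ≠ τ i then (1 : ℝ) else 0 := by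
  rw [EuclideanSpace.real_norm_sq_eq, Finset.mul_sum]
  refine Finset.sum_congr rfl fun i _ => ?_
  simp only [cubeVertex, PiLp.sub_apply]
  cases τ i <;> cases τ' i <;> simp <;> ring

theorem norm_sq_cubeVertex_sub_flipAt {d : ℕ} (a : ℝ) (τ : Fin d → Bool) (i : Fin d) :
    ‖cubeVertex a τ - cubeVertex a (flipAt i τ)‖ ^ 2 = 4 * a ^ 2 := by
  rw [norm_sq_cubeVertex_sub]
  have : ∀ j, (if flipAt i τ j ≠ τ j then (1 : ℝ) else 0) = if j = i then 1 else 0 := by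
    intro j
    by_cases h : j = i
    · subst h
      simp [flipAt]
    · simp [flipAt, h]
  simp_rw [this]
  simp

/-- The measure with all mass at a single point, as a `k`-atomic measure. -/
def pointAtoms {E : Type*} {k : ℕ} (hk : 1 ≤ k) (m : E) : Atoms k E :=
  (fun j => if j = ⟨0, hk⟩ then 1 else 0, fun _ => m)

theorem isMixing_pointAtoms {E : Type*} [NormedAddCommGroup E] {k : ℕ} (hk : 1 ≤ k) {R : ℝ}
    {m : E} (hm : ‖m‖ ≤ R) : IsMixing R (pointAtoms hk m) := by
  refine ⟨fun _ => hm, fun j => ?_, by simp [pointAtoms]⟩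
  simp only [pointAtoms]
  split_ifs <;> norm_num

theorem law_pointAtoms {E : Type*} [NormedAddCommGroup E] [InnerProductSpace ℝ E]
    [FiniteDimensional ℝ E] [MeasurableSpace E] [BorelSpace E] {k : ℕ} (hk : 1 ≤ k) (m : E) :
    law (pointAtoms hk m) = shiftLaw m := by
  unfold law shiftLaw
  congr 1
  ext x
  simp [density, pointAtoms]

/-- Two Gaussian measures with close means differ on a bounded trigonometric test function. -/
theorem quarter_norm_sub_le {d : ℕ} {m m' : EuclideanSpace ℝ (Fin d)} (h : ‖m - m'‖ ≤ 2) :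
    ∃ g : EuclideanSpace ℝ (Fin d) → ℝ, Measurable g ∧ (∀ x, |g x| ≤ 1) ∧
      ‖m - m'‖ / 4 ≤ ∫ x, g x ∂(shiftLaw m) - ∫ x, g x ∂(shiftLaw m') := by
  set s := ‖m - m'‖ with hs
  have hs0 : 0 ≤ s := norm_nonneg _
  set v := s⁻¹ • (m - m') with hv
  set c := (1 / 2 : ℝ) • (m + m') with hc
  -- A sine along the line of the means, centered at their midpoint, has opposite expectations under
  -- the two laws. The gap `2 * exp (-‖v‖² / 2) * sin (s / 2)` is at least `s / π`, hence at least
  -- `s / 4`.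
  refine ⟨fun x => Real.sin ⟪x - c, v⟫, by fun_prop, fun x => Real.abs_sin_le_one _, ?_⟩
  rw [integral_sin_shiftLaw, integral_sin_shiftLaw]
  have hv1 : ‖v‖ ≤ 1 := by
    rw [hv, norm_smul, norm_inv, Real.norm_of_nonneg hs0, ← hs]
    exact inv_mul_le_one
  have e0 : s⁻¹ * s ^ 2 = s := by
    rcases hs0.eq_or_lt with h0 | h0
    · simp [← h0]
    · field_simp
  have e1 : m - c = (1 / 2 : ℝ) • (m - m') := by rw [hc]; module
  have e2 : m' - c = -((1 / 2 : ℝ) • (m - m')) := by rw [hc]; module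
  have e3 : ⟪m - c, v⟫ = s / 2 := by
    rw [e1, hv, real_inner_smul_left, real_inner_smul_right, real_inner_self_eq_norm_sq, ← hs, e0]
    ring
  have e4 : ⟪m' - c, v⟫ = -(s / 2) := by
    rw [e2, ← e1, inner_neg_left, e3]
  rw [e3, e4, Real.sin_neg]
  have hsin : 2 / Real.pi * (s / 2) ≤ Real.sin (s / 2) :=
    Real.mul_le_sin (by linarith) (by linarith [Real.pi_gt_three])
  have hexp : 1 - 1 / 2 ≤ Real.exp (-(‖v‖ ^ 2 / 2)) := by
    have : ‖v‖ ^ 2 ≤ 1 := pow_le_one₀ (norm_nonneg _) hv1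
    linarith [Real.add_one_le_exp (-(‖v‖ ^ 2 / 2))]
  have hpi : s / 4 ≤ 2 / Real.pi * (s / 2) := by
    rw [div_mul_div_comm, mul_comm 2 s, mul_div_mul_right _ _ (two_ne_zero)]
    exact div_le_div_of_nonneg_left hs0 Real.pi_pos Real.pi_le_four
  have hsin0 : 0 ≤ Real.sin (s / 2) := le_trans (by positivity) hsin
  nlinarith [mul_le_mul_of_nonneg_right hexp hsin0]


/-- Any estimator yields a vertex of the cube whose Hamming distance to the true vertex is
controlled by the loss. -/
theorem exists_vertex_estimator {n d : ℕ} (hd : 1 ≤ d) {a : ℝ} (ha : 0 ≤ a)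
    (had : d * a ^ 2 ≤ 1)
    {Phat : (Fin n → EuclideanSpace ℝ (Fin d)) → Measure (EuclideanSpace ℝ (Fin d))}
    (hP : IsEstimator Phat) :
    ∃ sel : (Fin n → EuclideanSpace ℝ (Fin d)) → (Fin d → Bool),
      (∀ σ, MeasurableSet {x | sel x = σ}) ∧ ∀ x τ,
        a / (8 * √d) * ∑ i, (if sel x i ≠ τ i then (1 : ℝ) else 0)
          ≤ hellinger (Phat x) (shiftLaw (cubeVertex a τ)) := by
  have hdist : ∀ τ τ' : Fin d → Bool, ‖cubeVertex a τ - cubeVertex a τ'‖ ≤ 2 := by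
    intro τ τ'
    have h1 : ∀ τ : Fin d → Bool, ‖cubeVertex a τ‖ ≤ 1 := fun τ => by
      have := norm_sq_cubeVertex a τ
      nlinarith [norm_nonneg (cubeVertex a τ)]
    linarith [norm_sub_le (cubeVertex a τ) (cubeVertex a τ'), h1 τ, h1 τ']
  choose g hgm hg1 hg using fun p : (Fin d → Bool) × (Fin d → Bool) =>
    quarter_norm_sub_le (hdist p.1 p.2)
  -- A minimum distance rule: `D` is a maximum over finitely many test functions, one for each pair
  -- of vertices. Its measurability follows from that of the kernel `Phat`. Minimality of `sel x`
  -- and the triangle inequality, on the function separating `τ` from `sel x`, bound the vertex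
  -- distance by `16 * h`.
  let D : (Fin d → Bool) → (Fin n → EuclideanSpace ℝ (Fin d)) → ℝ := fun τ x =>
    ⨆ p, |∫ y, g p y ∂(Phat x) - ∫ y, g p y ∂(shiftLaw (cubeVertex a τ))|
  have hbdd : ∀ τ x, BddAbove (Set.range fun p =>
      |∫ y, g p y ∂(Phat x) - ∫ y, g p y ∂(shiftLaw (cubeVertex a τ))|) :=
    fun τ x => Set.Finite.bddAbove (Set.finite_range _)
  have hDm : ∀ τ, Measurable (D τ) := by
    intro τ
    refine Measurable.iSup fun p => ?_
    let κ : Kernel (Fin n → EuclideanSpace ℝ (Fin d)) (EuclideanSpace ℝ (Fin d)) := ⟨Phat, hP.1⟩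
    have : Measurable fun x => ∫ y, g p y ∂(κ x) :=
      (StronglyMeasurable.integral_kernel (hgm p).stronglyMeasurable).measurable
    exact (this.sub_const _).norm
  obtain ⟨sel, -, hmax, hmeas⟩ := exists_measurable_argmax (S := Finset.univ)
    Finset.univ_nonempty (f := fun τ x => -D τ x) fun τ => (hDm τ).neg
  refine ⟨sel, hmeas, fun x τ => ?_⟩
  have := hP.2 x
  have := isProbabilityMeasure_shiftLaw (cubeVertex a τ)
  set h := hellinger (Phat x) (shiftLaw (cubeVertex a τ)) with hh
  have hDτ : D τ x ≤ 2 * h :=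
    ciSup_le fun p => abs_integral_sub_le_hellinger (hgm p) (hg1 p)
  have hDsel : D (sel x) x ≤ 2 * h := by
    have := hmax x τ (Finset.mem_univ _)
    linarith
  have h1 := (le_ciSup (hbdd τ x) (τ, sel x)).trans hDτ
  have h2 := (le_ciSup (hbdd (sel x) x) (τ, sel x)).trans hDsel
  have h3 := hg (τ, sel x)
  have h4 : ‖cubeVertex a τ - cubeVertex a (sel x)‖ ≤ 16 * h := by
    have h5 := neg_le_of_abs_le h1
    have h6 := le_of_abs_le h2
    simp only at h3
    linarith
  set N := ∑ i, (if sel x i ≠ τ i then (1 : ℝ) else 0) with hN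
  have hN0 : 0 ≤ N := Finset.sum_nonneg fun i _ => by split_ifs <;> norm_num
  have hNd : N ≤ d := by
    calc N ≤ ∑ _i : Fin d, (1 : ℝ) := Finset.sum_le_sum fun i _ => by split_ifs <;> norm_num
      _ = d := by simp
  have h7 := norm_sq_cubeVertex_sub a τ (sel x)
  rw [← hN] at h7
  have hd0 : 0 < √(d : ℝ) := Real.sqrt_pos.2 (by exact_mod_cast hd)
  have h8 : 2 * a * √N = ‖cubeVertex a τ - cubeVertex a (sel x)‖ := by
    rw [← Real.sqrt_sq (norm_nonneg (cubeVertex a τ - cubeVertex a (sel x))), h7,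
      Real.sqrt_mul (by positivity), show 4 * a ^ 2 = (2 * a) ^ 2 by ring,
      Real.sqrt_sq (by positivity)]
  have h9 : N ≤ √N * √d := by
    calc N = √N * √N := (Real.mul_self_sqrt hN0).symm
      _ ≤ √N * √d := mul_le_mul_of_nonneg_left (Real.sqrt_le_sqrt hNd) (Real.sqrt_nonneg _)
  have h10 : a * N ≤ a * (√N * √d) := mul_le_mul_of_nonneg_left h9 ha
  rw [div_mul_eq_mul_div, div_le_iff₀ (by positivity)]
  nlinarith

/-- Averaging over the cube by flipping a single coordinate. -/
theorem card_mul_le_two_mul_sum {d : ℕ} (i : Fin d) (f : (Fin d → Bool) → ℝ≥0∞) {β : ℝ≥0∞}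
    (h : ∀ τ, β ≤ f τ + f (flipAt i τ)) :
    (Fintype.card (Fin d → Bool) : ℝ≥0∞) * β ≤ 2 * ∑ τ, f τ := by
  have e : ∑ τ, f (flipAt i τ) = ∑ τ, f τ :=
    Function.Bijective.sum_comp (Function.Involutive.bijective (flipAt_flipAt i)) f
  calc (Fintype.card (Fin d → Bool) : ℝ≥0∞) * β = ∑ _τ : Fin d → Bool, β := by simp
    _ ≤ ∑ τ, (f τ + f (flipAt i τ)) := Finset.sum_le_sum fun τ _ => h τ
    _ = 2 * ∑ τ, f τ := by rw [Finset.sum_add_distrib, e, two_mul]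

/-- The risk at a vertex dominates the expected Hamming error. Each coordinate is a two-point test
between neighboring vertices, whose errors sum to at least `1 / 6`; averaging over the cube gives
`(a / (8 * √d)) * d / 12 = √d * a / 96`. -/
theorem le_iSup_risk {k n d : ℕ} (hk : 1 ≤ k) (hd : 1 ≤ d) {R a : ℝ} (ha : 0 ≤ a)
    (haR : √d * a ≤ R) (had : d * a ^ 2 ≤ 1) (han : n * a ^ 2 ≤ 1)
    {Phat : (Fin n → EuclideanSpace ℝ (Fin d)) → Measure (EuclideanSpace ℝ (Fin d))}
    (hP : IsEstimator Phat) :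
    ENNReal.ofReal (√d * a / 96) ≤ ⨆ Γ ∈ mixingClass R k d, risk Phat Γ := by
  obtain ⟨sel, hsel, hloss⟩ := exists_vertex_estimator hd ha had hP
  set M := ⨆ Γ ∈ mixingClass R k d, risk Phat Γ with hM
  have hd0 : 0 < √(d : ℝ) := Real.sqrt_pos.2 (by exact_mod_cast hd)
  let f : Fin d → (Fin d → Bool) → ℝ≥0∞ := fun i τ =>
    Measure.pi (fun _ : Fin n => shiftLaw (cubeVertex a τ)) {x | sel x i ≠ τ i}
  have hmeas : ∀ i (b : Bool), MeasurableSet {x | sel x i ≠ b} := fun i b =>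
    (measurable_comp_of_finite_range (fun x => Finset.mem_univ (sel x)) hsel fun σ => σ i)
      (measurableSet_singleton b).compl
  have hrisk : ∀ τ, ENNReal.ofReal (a / (8 * √d)) * ∑ i, f i τ ≤ M := by
    intro τ
    have hnorm : ‖cubeVertex a τ‖ ≤ R := by
      have := norm_sq_cubeVertex a τ
      rw [← Real.sqrt_sq (norm_nonneg (cubeVertex a τ)), this, Real.sqrt_mul (Nat.cast_nonneg d),
        Real.sqrt_sq ha]
      exact haR
    have hmix := isMixing_pointAtoms hk hnorm
    refine le_trans ?_ (le_iSup₂ (f := fun Γ (_ : Γ ∈ mixingClass R k d) => risk Phat Γ)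
      (toMeasure (pointAtoms hk (cubeVertex a τ))) (mem_mixingClass_iff.2 ⟨_, hmix, rfl⟩))
    simp only [risk]
    rw [sampleLaw_toMeasure n hmix, mixture_toMeasure hmix, law_pointAtoms]
    calc ENNReal.ofReal (a / (8 * √d)) * ∑ i, f i τ
        = ∫⁻ x, ENNReal.ofReal (a / (8 * √d)) *
            ∑ i, {x | sel x i ≠ τ i}.indicator 1 x
            ∂(Measure.pi fun _ : Fin n => shiftLaw (cubeVertex a τ)) := by
          rw [lintegral_const_mul _ (Finset.measurable_sum _ fun i _ =>
            measurable_one.indicator (hmeas i (τ i))),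
            lintegral_finsetSum _ fun i _ => measurable_one.indicator (hmeas i (τ i))]
          simp_rw [lintegral_indicator_one (hmeas _ (τ _))]
          rfl
      _ ≤ _ := by
          refine lintegral_mono fun x => ?_
          have e : ∑ i, {x | sel x i ≠ τ i}.indicator
              (1 : (Fin n → EuclideanSpace ℝ (Fin d)) → ℝ≥0∞) x
              = ENNReal.ofReal (∑ i, if sel x i ≠ τ i then (1 : ℝ) else 0) := by
            rw [ENNReal.ofReal_sum_of_nonneg fun i _ => by split_ifs <;> norm_num]
            refine Finset.sum_congr rfl fun i _ => ?_
            by_cases hx : sel x i = τ i <;> simp [Set.indicator, hx]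
          rw [e, ← ENNReal.ofReal_mul (by positivity)]
          exact ENNReal.ofReal_le_ofReal (hloss x τ)
  have hpair : ∀ i τ, ENNReal.ofReal (1 / 6) ≤ f i τ + f i (flipAt i τ) := by
    intro i τ
    have e : {x | sel x i ≠ flipAt i τ i} = {x | sel x i ≠ τ i}ᶜ := by
      ext x
      simp only [flipAt, Function.update_self, Set.mem_ofPred_eq, Set.mem_compl_iff, not_not]
      cases sel x i <;> cases τ i <;> simp
    simp only [f]
    rw [e]
    refine two_point_le n (hmeas i (τ i)) ?_
    rw [norm_sq_cubeVertex_sub_flipAt]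
    linarith
  set c := ENNReal.ofReal (a / (8 * √d)) with hc
  set K : ℝ≥0∞ := (Fintype.card (Fin d → Bool) : ℝ≥0∞) with hK
  have hK0 : K ≠ 0 := by simp [hK]
  have hKt : K ≠ ⊤ := by simp [hK]
  have hsum : K * (c * d * ENNReal.ofReal (1 / 6)) ≤ K * (2 * M) := by
    calc K * (c * d * ENNReal.ofReal (1 / 6))
        = c * ∑ _i : Fin d, K * ENNReal.ofReal (1 / 6) := by
          simp only [Finset.sum_const, Finset.card_univ, Fintype.card_fin, nsmul_eq_mul]
          ring
      _ ≤ c * ∑ i, 2 * ∑ τ, f i τ := by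
          refine mul_le_mul_right (Finset.sum_le_sum fun i _ => ?_) c
          exact card_mul_le_two_mul_sum i (f i) (hpair i)
      _ = 2 * ∑ τ, c * ∑ i, f i τ := by
          rw [← Finset.mul_sum, Finset.sum_comm, ← Finset.mul_sum]
          ring
      _ ≤ 2 * ∑ _τ : Fin d → Bool, M := by
          gcongr with τ
          exact hrisk τ
      _ = K * (2 * M) := by
          simp only [Finset.sum_const, Finset.card_univ, nsmul_eq_mul]
          ring
  have hfin := (ENNReal.mul_le_mul_iff_right hK0 hKt).1 hsum
  have e : c * d * ENNReal.ofReal (1 / 6) = 2 * ENNReal.ofReal (√d * a / 96) := by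
    rw [hc, ← ENNReal.ofReal_natCast, ← ENNReal.ofReal_mul (by positivity),
      ← ENNReal.ofReal_mul (by positivity), show (2 : ℝ≥0∞) = ENNReal.ofReal 2 by simp,
      ← ENNReal.ofReal_mul (by positivity)]
    congr 1
    have hs : (d : ℝ) = √d * √d := (Real.mul_self_sqrt (Nat.cast_nonneg d)).symm
    conv_lhs => rw [hs, Real.sqrt_mul_self hd0.le]
    field_simp
    ring
  rw [e] at hfin
  exact (ENNReal.mul_le_mul_iff_right two_ne_zero (by simp)).1 hfin

theorem le_minimaxRisk {R : ℝ} (hR : 0 < R) {k d n : ℕ} (hk : 1 ≤ k) (hd : 1 ≤ d) (hn : 1 ≤ n) :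
    ENNReal.ofReal (min R 1 / 96 * min (√((d : ℝ) / (n : ℝ))) 1) ≤ minimaxRisk R k d n := by
  have hn0 : 0 < √(n : ℝ) := Real.sqrt_pos.2 (by exact_mod_cast hn)
  have hd0 : 0 < √(d : ℝ) := Real.sqrt_pos.2 (by exact_mod_cast hd)
  have hb : 0 < min R 1 := lt_min hR one_pos
  refine le_iInf₂ fun Phat hP => ?_
  set q := min (√((d : ℝ) / (n : ℝ))) 1 with hq
  have hq0 : 0 ≤ q := le_min (Real.sqrt_nonneg _) zero_le_one
  -- This size puts the vertices in the ball of radius `min R 1` and keeps `n * a² ≤ 1`, so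
  -- neighboring vertices cannot be tested reliably from `n` observations.
  set a := min R 1 * q / √d with ha
  have ha0 : 0 ≤ a := by positivity
  have hda : √d * a = min R 1 * q := by
    rw [ha]
    field_simp
  have hq1 : q ≤ 1 := min_le_right _ _
  have hb1 : min R 1 ≤ 1 := min_le_right _ _
  have hd2 : d * a ^ 2 = (min R 1 * q) ^ 2 := by
    rw [← hda, mul_pow, Real.sq_sqrt (Nat.cast_nonneg d)]
  have hle : min R 1 * q ≤ 1 := mul_le_one₀ hb1 hq0 hq1
  have hn2 : n * a ^ 2 ≤ 1 := by
    have h1 : √n * a ≤ 1 := by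
      have h2 : q ≤ √d / √n := by
        rw [← Real.sqrt_div (Nat.cast_nonneg d)]
        exact min_le_left _ _
      rw [le_div_iff₀ hn0] at h2
      rw [ha, mul_div_assoc', div_le_one hd0]
      nlinarith [mul_nonneg hq0 hn0.le]
    have h3 : n * a ^ 2 = (√n * a) ^ 2 := by
      rw [mul_pow, Real.sq_sqrt (Nat.cast_nonneg n)]
    rw [h3]
    exact pow_le_one₀ (by positivity) h1
  have := le_iSup_risk hk hd ha0 (R := R) (by
    rw [hda]
    nlinarith [min_le_left R 1]) (by
    rw [hd2]
    exact pow_le_one₀ (by positivity) hle) hn2 hP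
  rwa [hda, mul_div_right_comm] at this

end GaussianMixture

end

theorem theorem2 (R : ℝ) (hR : 0 < R) :
    -- the minimax rate, over all estimators and over proper estimators
    (∀ k : ℕ, 1 ≤ k → ∃ c C : ℝ, 0 < c ∧ 0 < C ∧ ∀ d n : ℕ, 1 ≤ d → 1 ≤ n →
      (ENNReal.ofReal (c * min (√((d : ℝ) / (n : ℝ))) 1)
          ≤ GaussianMixture.minimaxRisk R k d n ∧
        GaussianMixture.minimaxRisk R k d n
          ≤ ENNReal.ofReal (C * min (√((d : ℝ) / (n : ℝ))) 1)) ∧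
      (ENNReal.ofReal (c * min (√((d : ℝ) / (n : ℝ))) 1)
          ≤ GaussianMixture.properMinimaxRisk R k d n ∧
        GaussianMixture.properMinimaxRisk R k d n
          ≤ ENNReal.ofReal (C * min (√((d : ℝ) / (n : ℝ))) 1))) ∧
    -- a proper estimator with a high-probability guarantee at all confidence levels
    (∃ C : ℝ, 0 < C ∧ ∀ k d n : ℕ, 1 ≤ k → 1 ≤ d → 1 ≤ n →
      ∃ Γhat : (Fin n → EuclideanSpace ℝ (Fin d)) → Measure (EuclideanSpace ℝ (Fin d)),
        GaussianMixture.IsMixingEstimator R k Γhat ∧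
        ∀ Γ ∈ GaussianMixture.mixingClass R k d, ∀ δ : ℝ, 0 < δ → δ < 1 / 2 →
          ENNReal.ofReal (1 - δ) ≤ GaussianMixture.sampleLaw n Γ
            {x | GaussianMixture.hellinger (GaussianMixture.mixture (Γhat x))
                  (GaussianMixture.mixture Γ)
                ≤ C * √((((k : ℝ) ^ 4 * (d : ℝ) + (2 * (k : ℝ)) ^ (2 * k + 2)) / (n : ℝ))
                    * Real.log (1 / δ))}) := by
  refine ⟨fun k hk => ⟨min R 1 / 96, GaussianMixture.upperConst R k,
    div_pos (lt_min hR one_pos) (by norm_num), ?_, fun d n hd hn => ?_⟩,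
    GaussianMixture.exists_proper_estimator hR⟩
  · unfold GaussianMixture.upperConst
    positivity
  · have h1 := GaussianMixture.le_minimaxRisk hR hk hd hn
    have h2 := GaussianMixture.minimaxRisk_le_properMinimaxRisk R k d n
    have h3 := GaussianMixture.properMinimaxRisk_le hR hk hd hn
    exact ⟨⟨h1, h2.trans h3⟩, ⟨h1.trans h2, h3⟩⟩
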